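/- **Problem.** An instance of range-based fair $k$-center consists of a metric space $(S,d)$ with $n$ points, a partition of $S$ into $m$ demographic groups $S_1,\dots,S_m$, an integer $k\ge 1$, and integers $0\le l_i\le u_i\le |S_i|$ for $i\in[m]$ with $\sum_i l_i\le k\le\sum_i u_i$. A set $C\subseteq S$ is *feasible* if $|C|=k$ and $l_i\le |C\cap S_i|\le u_i$ for all $i$; its cost is $\max_{s\in S}\min_{c\in C}d(s,c)$, and $\mathrm{OPT}$ is the least cost of a feasible set. **Fair shift.** For $A\subseteq S$ and $d'\in(0,\infty]$, a fair shift of $A$ with bound $d'$ is an injective map $g:A\to S$ such that $d(g(a),a)<d'$ for all $a\in A$, $|S_i\cap g(A)|\le u_i$ for all $i$, and $\sum_i\max\{0,\,l_i-|S_i\cap g(A)|\}\le k-|A|$. **Algorithm.** 1. (Gonzalez) Choose $a_1\in S$ arbitrarily, and for $i=2,\dots,k$ let $a_i$ be a point of $S$ farthest from $\{a_1,\dots,a_{i-1}\}$. Let $d_i$ be the distance from $a_i$ to $\{a_1,\dots,a_{i-1}\}$, with $d_1=\infty$. 2. Find the largest $h\in\{1,\dots,k\}$ such that $\{a_1,\dots,a_h\}$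 has a fair shift with bound $d_h/2$. 3. Find a fair shift $g$ of $A=\{a_1,\dots,a_h\}$ with bound $d_h/2$ that minimizes $\max_{a\in A}d(g(a),a)$. 4. Extend $g(A)$ arbitrarily to a feasible set $C$ and return $C$. Ties and arbitrary choices may be resolved in any way. **Theorem.** (a) On every instance, whatever choices are made, every step can be carried out, and every set $C$ that the algorithm can return is feasible and has cost at most $3\,\mathrm{OPT}$. (b) The algorithm runs in $O(nk)$ time. That is, there are one program for a unit-cost real RAM (natural numbers with addition, truncated subtraction and halving; real numbers with addition, subtraction and comparison; arrays; a unit-cost oracle for $d$) and one constant $K$ such that on every instance with $m\le n$ (for example, whenever all groups are nonempty) the program halts after at most $K\,nk$ steps and outputs a set that the above algorithm can return; in particular this set is feasible and has cost at most $3\,\mathrm{OPT}$. -/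

import Mathlib

open scoped ENNReal

namespace FairKCenter

/-! ### The range-based fair k-center problem -/

/-- An instance: a data set of `n` points (named by `Fin n`) with a metric, a partition into `m`
demographic groups, the number `k` of centers, and integer bounds `l i ≤ u i` for each group. -/
structure Instance where
  n : ℕ
  m : ℕ
  k : ℕ
  metric : MetricSpace (Fin n)
  group : Fin n → Fin m
  l : Fin m → ℕ
  u : Fin m → ℕ
  k_pos : 1 ≤ k
  l_le_u : ∀ i, l i ≤ u i
  u_le_card : ∀ i, u i ≤ (Finset.univ.filter fun x => group x = i).card
  sum_l_le : ∑ i, l i ≤ k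
  le_sum_u : k ≤ ∑ i, u i

namespace Instance

variable (I : Instance)

/-- The distance of two data points, as a real number. -/
def d (x y : Fin I.n) : ℝ := I.metric.dist x y

/-- The same distance in `[0, ∞]`, where a minimum over no points is `∞`. -/
noncomputable def ed (x y : Fin I.n) : ℝ≥0∞ := ENNReal.ofReal (I.d x y)

/-- `|C ∩ S_i|`. -/
def count (C : Finset (Fin I.n)) (i : Fin I.m) : ℕ := (C.filter fun x => I.group x = i).card

/-- `C` consists of `k` points and has between `l i` and `u i` points of every group `i`. -/
def Feasible (C : Finset (Fin I.n)) : Prop :=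
  C.card = I.k ∧ ∀ i, I.l i ≤ I.count C i ∧ I.count C i ≤ I.u i

/-- The distance of `x` to the closest point of `C`. -/
noncomputable def distTo (C : Finset (Fin I.n)) (x : Fin I.n) : ℝ≥0∞ := ⨅ c ∈ C, I.ed x c

/-- The k-center objective: the maximum over all points of the distance to the closest center. -/
noncomputable def cost (C : Finset (Fin I.n)) : ℝ≥0∞ := ⨆ x, I.distTo C x

/-- The optimal cost of a feasible set of centers. -/
noncomputable def opt : ℝ≥0∞ := ⨅ (C : Finset (Fin I.n)) (_ : I.Feasible C), I.cost C

/-! ### The algorithm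

The four steps are nondeterministic (ties and arbitrary choices), so each is a relation. Sequences
are indexed from `0`: for `h : Fin k` the first `h + 1` centers are `a 0, …, a h`. -/

/-- The set of the centers chosen before `a i`. -/
def before (a : Fin I.k → Fin I.n) (i : Fin I.k) : Finset (Fin I.n) := (Finset.Iio i).image a

/-- The set of the centers up to and including `a i`. -/
def upTo (a : Fin I.k → Fin I.n) (i : Fin I.k) : Finset (Fin I.n) := (Finset.Iic i).image a

/-- The distance of `a i` to the centers chosen before it; it is `∞` for the first center. -/
noncomputable def gap (a : Fin I.k → Fin I.n) (i : Fin I.k) : ℝ≥0∞ := I.distTo (I.before a i) (a i)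

/-- Step 1 (Gonzalez): each center is a point that is farthest from the centers chosen before it.
This puts no restriction on the first center. -/
def Step1 (a : Fin I.k → Fin I.n) : Prop :=
  ∀ i x, I.distTo (I.before a i) x ≤ I.gap a i

/-- `g` (of which only the values on `A` matter) solves the range-based fair-shift problem for the
set `A` of centers and the distance bound `r`. In `lower`, `l i - count` is truncated subtraction,
that is, `max 0 (l i - count)`. -/
structure IsFairShift (A : Finset (Fin I.n)) (r : ℝ≥0∞) (g : Fin I.n → Fin I.n) : Prop where
  inj : Set.InjOn g A
  close : ∀ a ∈ A, I.ed (g a) a < r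
  upper : ∀ i, I.count (A.image g) i ≤ I.u i
  lower : ∑ i, (I.l i - I.count (A.image g) i) + A.card ≤ I.k

/-- The maximum distance between a point of `A` and its substitute. -/
noncomputable def shiftRadius (A : Finset (Fin I.n)) (g : Fin I.n → Fin I.n) : ℝ≥0∞ :=
  ⨆ a ∈ A, I.ed (g a) a

/-- The centers `a 0, …, a h` admit a fair shift with distance bound half the gap of `a h`. -/
def Shiftable (a : Fin I.k → Fin I.n) (h : Fin I.k) : Prop :=
  ∃ g, I.IsFairShift (I.upTo a h) (I.gap a h / 2) g

/-- Step 2: `a 0, …, a h` is the longest prefix that admits such a fair shift. -/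
def Step2 (a : Fin I.k → Fin I.n) (h : Fin I.k) : Prop :=
  I.Shiftable a h ∧ ∀ h', I.Shiftable a h' → h' ≤ h

/-- Step 3: `g` is such a fair shift of this prefix, of least maximum distance. -/
def Step3 (a : Fin I.k → Fin I.n) (h : Fin I.k) (g : Fin I.n → Fin I.n) : Prop :=
  I.IsFairShift (I.upTo a h) (I.gap a h / 2) g ∧
    ∀ g', I.IsFairShift (I.upTo a h) (I.gap a h / 2) g' →
      I.shiftRadius (I.upTo a h) g ≤ I.shiftRadius (I.upTo a h) g'

/-- Step 4: the substitutes are completed arbitrarily to a set of `k` centers that is fair. -/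
def Step4 (a : Fin I.k → Fin I.n) (h : Fin I.k) (g : Fin I.n → Fin I.n)
    (C : Finset (Fin I.n)) : Prop :=
  (I.upTo a h).image g ⊆ C ∧ I.Feasible C

/-- `C` is a possible output of the algorithm. -/
def IsOutput (C : Finset (Fin I.n)) : Prop :=
  ∃ a h g, I.Step1 a ∧ I.Step2 a h ∧ I.Step3 a h g ∧ I.Step4 a h g C

end Instance

/-! ### The machine model

A real RAM with unit-cost operations. Memory consists of scalar variables and (unbounded) arrays,
holding natural numbers or real numbers; a program names finitely many of them. On natural numbers
there are addition, truncated subtraction and halving; on reals addition, subtraction and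
comparison; the metric is available through a distance oracle. There is no multiplication and no
conversion between reals and natural numbers. -/

structure State where
  nat : ℕ → ℕ
  natArr : ℕ → ℕ → ℕ
  real : ℕ → ℝ
  realArr : ℕ → ℕ → ℝ

inductive NatExpr where
  | lit (c : ℕ)
  | var (x : ℕ)
  | get (A : ℕ) (i : NatExpr)
  | plus (e f : NatExpr)
  | minus (e f : NatExpr)
  | half (e : NatExpr)

namespace NatExpr

def eval (s : State) : NatExpr → ℕ
  | lit c => c
  | var x => s.nat x
  | get A i => s.natArr A (i.eval s)
  | plus e f => e.eval s + f.eval s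
  | minus e f => e.eval s - f.eval s
  | half e => e.eval s / 2

/-- The number of operations in an expression. -/
def cost : NatExpr → ℕ
  | lit _ => 1
  | var _ => 1
  | get _ i => i.cost + 1
  | plus e f => e.cost + f.cost + 1
  | minus e f => e.cost + f.cost + 1
  | half e => e.cost + 1

end NatExpr

inductive RealExpr where
  | zero
  | var (x : ℕ)
  | get (A : ℕ) (i : NatExpr)
  | plus (e f : RealExpr)
  | minus (e f : RealExpr)
  | dist (i j : NatExpr)

namespace RealExpr

/-- `D` is the distance oracle. -/
noncomputable def eval (D : ℕ → ℕ → ℝ) (s : State) : RealExpr → ℝ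
  | zero => 0
  | var x => s.real x
  | get A i => s.realArr A (i.eval s)
  | plus e f => e.eval D s + f.eval D s
  | minus e f => e.eval D s - f.eval D s
  | dist i j => D (i.eval s) (j.eval s)

def cost : RealExpr → ℕ
  | zero => 1
  | var _ => 1
  | get _ i => i.cost + 1
  | plus e f => e.cost + f.cost + 1
  | minus e f => e.cost + f.cost + 1
  | dist i j => i.cost + j.cost + 1

end RealExpr

inductive Test where
  | natLe (e f : NatExpr)
  | realLe (e f : RealExpr)
  | not (b : Test)
  | and (b c : Test)
  | or (b c : Test)

namespace Test

def Holds (D : ℕ → ℕ → ℝ) (s : State) : Test → Prop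
  | natLe e f => e.eval s ≤ f.eval s
  | realLe e f => e.eval D s ≤ f.eval D s
  | not b => ¬ b.Holds D s
  | and b c => b.Holds D s ∧ c.Holds D s
  | or b c => b.Holds D s ∨ c.Holds D s

def cost : Test → ℕ
  | natLe e f => e.cost + f.cost + 1
  | realLe e f => e.cost + f.cost + 1
  | not b => b.cost + 1
  | and b c => b.cost + c.cost + 1
  | or b c => b.cost + c.cost + 1

end Test

inductive Program where
  | skip
  | setNat (x : ℕ) (e : NatExpr)
  | putNat (A : ℕ) (i e : NatExpr)
  | setReal (x : ℕ) (e : RealExpr)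
  | putReal (A : ℕ) (i : NatExpr) (e : RealExpr)
  | seq (p q : Program)
  | ite (b : Test) (p q : Program)
  | loop (b : Test) (p : Program)

namespace State

def setNat (s : State) (x v : ℕ) : State := { s with nat := Function.update s.nat x v }

def putNat (s : State) (A i v : ℕ) : State :=
  { s with natArr := Function.update s.natArr A (Function.update (s.natArr A) i v) }

noncomputable def setReal (s : State) (x : ℕ) (v : ℝ) : State :=
  { s with real := Function.update s.real x v }

noncomputable def putReal (s : State) (A i : ℕ) (v : ℝ) : State :=
  { s with realArr := Function.update s.realArr A (Function.update (s.realArr A) i v) }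

end State

/-- `Exec D p s s' t`: with distance oracle `D`, the (deterministic) program `p`, started in state
`s`, halts in state `s'` after exactly `t` steps. `loop b p` is `while b do p`. -/
inductive Exec (D : ℕ → ℕ → ℝ) : Program → State → State → ℕ → Prop where
  | skip (s : State) : Exec D .skip s s 1
  | setNat (s : State) (x : ℕ) (e : NatExpr) :
      Exec D (.setNat x e) s (s.setNat x (e.eval s)) (e.cost + 1)
  | putNat (s : State) (A : ℕ) (i e : NatExpr) :
      Exec D (.putNat A i e) s (s.putNat A (i.eval s) (e.eval s)) (i.cost + e.cost + 1)
  | setReal (s : State) (x : ℕ) (e : RealExpr) :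
      Exec D (.setReal x e) s (s.setReal x (e.eval D s)) (e.cost + 1)
  | putReal (s : State) (A : ℕ) (i : NatExpr) (e : RealExpr) :
      Exec D (.putReal A i e) s (s.putReal A (i.eval s) (e.eval D s)) (i.cost + e.cost + 1)
  | seq {p q : Program} {s s' s'' : State} {t t' : ℕ} :
      Exec D p s s' t → Exec D q s' s'' t' → Exec D (.seq p q) s s'' (t + t')
  | iteTrue {b : Test} {p q : Program} {s s' : State} {t : ℕ} :
      b.Holds D s → Exec D p s s' t → Exec D (.ite b p q) s s' (b.cost + t + 1)
  | iteFalse {b : Test} {p q : Program} {s s' : State} {t : ℕ} :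
      ¬ b.Holds D s → Exec D q s s' t → Exec D (.ite b p q) s s' (b.cost + t + 1)
  | loopTrue {b : Test} {p : Program} {s s' s'' : State} {t t' : ℕ} :
      b.Holds D s → Exec D p s s' t → Exec D (.loop b p) s' s'' t' →
      Exec D (.loop b p) s s'' (b.cost + t + t' + 1)
  | loopFalse {b : Test} {p : Program} {s : State} :
      ¬ b.Holds D s → Exec D (.loop b p) s s (b.cost + 1)

namespace Instance

variable (I : Instance)

/-- The distance oracle; it answers `0` when asked about something that is not a point. -/
noncomputable def oracle (i j : ℕ) : ℝ :=
  if h : i < I.n ∧ j < I.n then I.d ⟨i, h.1⟩ ⟨j, h.2⟩ else 0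

/-- The input: variables `0, 1, 2` hold `n, m, k` and arrays `0, 1, 2` hold the groups of the
points and the bounds `l`, `u`; everything else is `0`. -/
noncomputable def input : State where
  nat x := if x = 0 then I.n else if x = 1 then I.m else if x = 2 then I.k else 0
  natArr A i :=
    if A = 0 then (if h : i < I.n then (I.group ⟨i, h⟩ : ℕ) else 0)
    else if A = 1 then (if h : i < I.m then I.l ⟨i, h⟩ else 0)
    else if A = 2 then (if h : i < I.m then I.u ⟨i, h⟩ else 0)
    else 0
  real _ := 0
  realArr _ _ := 0

/-- The output: the set of the points listed in the first `k` cells of array `3`. -/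
def output (s : State) : Finset (Fin I.n) :=
  Finset.univ.filter fun x => ∃ j < I.k, s.natArr 3 j = (x : ℕ)

end Instance

end FairKCenter

namespace FairKCenter

namespace Instance

variable (I : Instance)

/-! ### The metric and the objective -/

theorem d_self (x : Fin I.n) : I.d x x = 0 := by
  let := I.metric; exact dist_self x

theorem d_comm (x y : Fin I.n) : I.d x y = I.d y x := by
  let := I.metric; exact dist_comm x y

theorem d_triangle (x y z : Fin I.n) : I.d x z ≤ I.d x y + I.d y z := by
  let := I.metric; exact dist_triangle x y z

theorem d_nonneg (x y : Fin I.n) : 0 ≤ I.d x y := by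
  let := I.metric; exact dist_nonneg

theorem d_pos {x y : Fin I.n} (h : x ≠ y) : 0 < I.d x y := by
  let := I.metric; exact dist_pos.2 h

theorem ed_comm (x y : Fin I.n) : I.ed x y = I.ed y x := by rw [ed, ed, d_comm]

theorem ed_triangle (x y z : Fin I.n) : I.ed x z ≤ I.ed x y + I.ed y z := by
  rw [ed, ed, ed, ← ENNReal.ofReal_add (I.d_nonneg _ _) (I.d_nonneg _ _)]
  exact ENNReal.ofReal_le_ofReal (I.d_triangle _ _ _)

theorem ed_pos {x y : Fin I.n} (h : x ≠ y) : 0 < I.ed x y := ENNReal.ofReal_pos.2 (I.d_pos h)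

theorem ed_lt_top (x y : Fin I.n) : I.ed x y < ⊤ := ENNReal.ofReal_lt_top

theorem distTo_le {C : Finset (Fin I.n)} {c : Fin I.n} (hc : c ∈ C) (x : Fin I.n) :
    I.distTo C x ≤ I.ed x c := iInf₂_le c hc

theorem distTo_anti {C C' : Finset (Fin I.n)} (h : C ⊆ C') (x : Fin I.n) :
    I.distTo C' x ≤ I.distTo C x :=
  le_iInf₂ fun _ hc => I.distTo_le (h hc) x

theorem exists_ed_eq_distTo {C : Finset (Fin I.n)} (hC : C.Nonempty) (x : Fin I.n) :
    ∃ c ∈ C, I.ed x c = I.distTo C x := by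
  obtain ⟨c, hc, h⟩ := C.exists_min_image (I.ed x) hC
  exact ⟨c, hc, le_antisymm (le_iInf₂ h) (I.distTo_le hc x)⟩

theorem cost_lt_top {C : Finset (Fin I.n)} (hC : C.Nonempty) : I.cost C < ⊤ := by
  obtain ⟨c, hc⟩ := hC
  have : I.cost C ≤ ∑ x, I.ed x c :=
    iSup_le fun x => (I.distTo_le hc x).trans
      (Finset.single_le_sum (f := fun x => I.ed x c) (fun _ _ => zero_le) (Finset.mem_univ x))
  exact this.trans_lt (ENNReal.sum_lt_top.2 fun x _ => I.ed_lt_top x c)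

/-! ### Extension to a feasible set -/

theorem card_eq_sum_count (C : Finset (Fin I.n)) : C.card = ∑ i, I.count C i :=
  Finset.card_eq_sum_card_fiberwise fun x _ => Finset.mem_univ (I.group x)

theorem count_insert {C : Finset (Fin I.n)} {x : Fin I.n} (hx : x ∉ C) (i : Fin I.m) :
    I.count (insert x C) i = I.count C i + if I.group x = i then 1 else 0 := by
  unfold count
  rw [Finset.filter_insert]
  split_ifs with h
  · rw [Finset.card_insert_of_notMem (by simp [hx])]
  · simp

theorem count_mono {C C' : Finset (Fin I.n)} (h : C ⊆ C') (i : Fin I.m) :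
    I.count C i ≤ I.count C' i :=
  Finset.card_le_card (Finset.filter_subset_filter _ h)

theorem exists_notMem_of_count_lt {C : Finset (Fin I.n)} {i : Fin I.m}
    (h : I.count C i < I.u i) : ∃ x, x ∉ C ∧ I.group x = i := by
  by_contra! hc
  refine absurd ((I.u_le_card i).trans (Finset.card_le_card ?_)) (not_le.2 h)
  intro x hx
  simp only [Finset.mem_filter, Finset.mem_univ, true_and] at hx ⊢
  exact ⟨by_contra fun h => hc x h hx, hx⟩

/-- Induction on `k - |A|`, keeping the deficit plus `|A|` at most `k`. A point of a group below its
lower bound raises the size and lowers the deficit by one each. Once the deficit is zero, any group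
below its upper bound will do, and `k ≤ ∑ u` supplies one while `|A| < k`. -/
theorem exists_feasible_superset (A : Finset (Fin I.n)) (hu : ∀ i, I.count A i ≤ I.u i)
    (hl : ∑ i, (I.l i - I.count A i) + A.card ≤ I.k) : ∃ C, A ⊆ C ∧ I.Feasible C := by
  induction hr : I.k - A.card generalizing A with
  | zero =>
    have h1 : A.card = I.k := by omega
    have h2 : ∑ i, (I.l i - I.count A i) = 0 := by omega
    rw [Finset.sum_eq_zero_iff] at h2
    exact ⟨A, subset_rfl, h1, fun i => ⟨by have := h2 i (Finset.mem_univ i); omega, hu i⟩⟩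
  | succ r ih =>
    obtain ⟨i, hi, hl'⟩ : ∃ i, I.count A i < I.u i ∧
        (I.count A i < I.l i ∨ ∑ i, (I.l i - I.count A i) = 0) := by
      by_cases h0 : ∑ i, (I.l i - I.count A i) = 0
      · by_contra! hc
        have h1 : ∑ i, I.u i ≤ ∑ i, I.count A i :=
          Finset.sum_le_sum fun i _ => by
            by_contra! h
            exact (hc i h).2 h0
        rw [← card_eq_sum_count] at h1
        have := I.le_sum_u
        omega
      · obtain ⟨i, -, hi⟩ := Finset.exists_ne_zero_of_sum_ne_zero h0
        exact ⟨i, by have := I.l_le_u i; omega, Or.inl (by omega)⟩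
    obtain ⟨x, hx, rfl⟩ := I.exists_notMem_of_count_lt hi
    obtain ⟨C, hC, hf⟩ := ih (insert x A)
      (fun j => by
        rw [I.count_insert hx]
        split_ifs with h
        · subst h; omega
        · have := hu j; omega)
      (by
        rw [Finset.card_insert_of_notMem hx]
        rcases hl' with h | h
        · have : ∑ i, (I.l i - I.count (insert x A) i) < ∑ i, (I.l i - I.count A i) :=
            Finset.sum_lt_sum (fun j _ => by rw [I.count_insert hx]; omega)
              ⟨I.group x, Finset.mem_univ _, by rw [I.count_insert hx]; simp; omega⟩
          omega
        · have : ∑ i, (I.l i - I.count (insert x A) i) ≤ ∑ i, (I.l i - I.count A i) :=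
            Finset.sum_le_sum fun j _ => by rw [I.count_insert hx]; omega
          omega)
      (by rw [Finset.card_insert_of_notMem hx]; omega)
    exact ⟨C, (Finset.subset_insert _ _).trans hC, hf⟩

theorem exists_feasible : ∃ C, I.Feasible C := by
  obtain ⟨C, -, h⟩ := I.exists_feasible_superset ∅ (by simp [count]) (by simp [count, I.sum_l_le])
  exact ⟨C, h⟩

theorem k_le_n : I.k ≤ I.n := by
  obtain ⟨C, h, -⟩ := I.exists_feasible
  rw [← h]
  exact (Finset.card_le_univ C).trans_eq (Fintype.card_fin _)

variable {I} in
theorem Feasible.nonempty {C : Finset (Fin I.n)} (h : I.Feasible C) : C.Nonempty := by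
  rw [← Finset.card_pos, h.1]
  exact I.k_pos

theorem exists_cost_eq_opt : ∃ C, I.Feasible C ∧ I.cost C = I.opt := by
  classical
  obtain ⟨C₀, h₀⟩ := I.exists_feasible
  obtain ⟨C, hC, h⟩ := (Finset.univ.filter I.Feasible).exists_min_image I.cost ⟨C₀, by simpa⟩
  simp only [Finset.mem_filter, Finset.mem_univ, true_and] at hC h
  exact ⟨C, hC, le_antisymm (le_iInf₂ h) (iInf₂_le C hC)⟩

theorem opt_lt_top : I.opt < ⊤ := by
  obtain ⟨C, h, h'⟩ := I.exists_cost_eq_opt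
  exact h' ▸ I.cost_lt_top h.nonempty

/-! ### The greedy sequence -/

section Greedy

variable {I} {a : Fin I.k → Fin I.n}

theorem mem_before {i : Fin I.k} {x : Fin I.n} : x ∈ I.before a i ↔ ∃ j < i, a j = x := by
  simp [before]

theorem mem_upTo {i : Fin I.k} {x : Fin I.n} : x ∈ I.upTo a i ↔ ∃ j ≤ i, a j = x := by
  simp [upTo]

theorem gap_eq_top {i : Fin I.k} (hi : (i : ℕ) = 0) : I.gap a i = ⊤ := by
  have : I.before a i = ∅ := by
    rw [Finset.eq_empty_iff_forall_notMem]
    intro x hx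
    obtain ⟨j, hj, -⟩ := mem_before.1 hx
    rw [Fin.lt_def] at hj
    omega
  simp [gap, distTo, this]

/-- At time `i` the later center `a j` was a candidate too, and it was at least as far from the
centers then chosen as from those before `j`. -/
theorem Step1.gap_anti (h : I.Step1 a) {i j : Fin I.k} (hij : i ≤ j) : I.gap a j ≤ I.gap a i := by
  refine le_trans (I.distTo_anti ?_ _) (h i (a j))
  exact Finset.image_subset_image (Finset.Iio_subset_Iio hij)

/-- The separation on which all disjointness rests: the later of the two centers has its gap bounded
by this distance, and gaps decrease. -/
theorem Step1.gap_le_ed (h : I.Step1 a) {i j t : Fin I.k} (hi : i ≤ t) (hj : j ≤ t)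
    (hij : i ≠ j) : I.gap a t ≤ I.ed (a i) (a j) := by
  wlog hlt : j < i generalizing i j
  · rw [ed_comm]
    exact this hj hi hij.symm (lt_of_le_of_ne (not_lt.1 hlt) hij)
  · exact (h.gap_anti hi).trans (I.distTo_le (mem_before.2 ⟨j, hlt, rfl⟩) _)

theorem Step1.gap_pos (h : I.Step1 a) (i : Fin I.k) : 0 < I.gap a i := by
  obtain ⟨x, hx⟩ : ∃ x, x ∉ I.before a i := by
    by_contra! hc
    have h1 : (Finset.univ : Finset (Fin I.n)).card ≤ (I.before a i).card :=
      Finset.card_le_card fun x _ => hc x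
    have h2 : (I.before a i).card ≤ i := Finset.card_image_le.trans (by simp)
    rw [Finset.card_univ, Fintype.card_fin] at h1
    have := I.k_le_n
    omega
  refine lt_of_lt_of_le ?_ (h i x)
  rcases (I.before a i).eq_empty_or_nonempty with h0 | h0
  · simp [distTo, h0]
  · obtain ⟨c, hc, he⟩ := I.exists_ed_eq_distTo h0 x
    rw [← he]
    exact I.ed_pos fun hxc => hx (hxc ▸ hc)

theorem Step1.injective (h : I.Step1 a) : Function.Injective a := by
  intro i j hij
  by_contra hne
  have h1 := h.gap_le_ed (le_max_left i j) (le_max_right i j) hne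
  rw [hij] at h1
  have h2 : I.ed (a j) (a j) = 0 := by simp [ed, d_self]
  rw [h2] at h1
  exact absurd (h.gap_pos (max i j)) (not_lt.2 h1)

theorem Step1.card_upTo (h : I.Step1 a) (i : Fin I.k) : (I.upTo a i).card = i + 1 := by
  rw [upTo, Finset.card_image_of_injective _ h.injective, Fin.card_Iic]

end Greedy

theorem exists_step1 : ∃ a, I.Step1 a := by
  have hn : 0 < I.n := lt_of_lt_of_le I.k_pos I.k_le_n
  have hne : (Finset.univ : Finset (Fin I.n)).Nonempty := ⟨⟨0, hn⟩, Finset.mem_univ _⟩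
  have far : ∀ B : Finset (Fin I.n), ∃ y, ∀ x, I.distTo B x ≤ I.distTo B y := fun B => by
    obtain ⟨y, -, h⟩ := Finset.univ.exists_max_image (I.distTo B) hne
    exact ⟨y, fun x => h x (Finset.mem_univ x)⟩
  choose f hf using far
  -- Each center depends on all earlier ones, so the recursion carries the list of the first `i`
  -- centers, the latest at the head.
  let b : ℕ → List (Fin I.n) := fun i => Nat.rec [] (fun _ L => f L.toFinset :: L) i
  have hb : ∀ i, b (i + 1) = f (b i).toFinset :: b i := fun _ => rfl
  have hmem : ∀ i x, x ∈ b i ↔ ∃ j < i, f (b j).toFinset = x := by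
    intro i
    induction i with
    | zero => intro x; simp [b]
    | succ i ih =>
      intro x
      rw [hb, List.mem_cons, ih]
      constructor
      · rintro (rfl | ⟨j, hj, rfl⟩)
        · exact ⟨i, by omega, rfl⟩
        · exact ⟨j, by omega, rfl⟩
      · rintro ⟨j, hj, rfl⟩
        rcases Nat.lt_succ_iff_lt_or_eq.1 hj with h | rfl
        · exact Or.inr ⟨j, h, rfl⟩
        · exact Or.inl rfl
  let a : Fin I.k → Fin I.n := fun i => f (b i).toFinset
  have hB : ∀ i, I.before a i = (b i).toFinset := by
    intro i
    ext x
    rw [mem_before, List.mem_toFinset, hmem]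
    constructor
    · rintro ⟨j, hj, rfl⟩; exact ⟨j, hj, rfl⟩
    · rintro ⟨j, hj, rfl⟩; exact ⟨⟨j, hj.trans i.2⟩, hj, rfl⟩
  refine ⟨a, fun i x => ?_⟩
  rw [gap, hB]
  exact hf _ x

/-! ### The approximation guarantee -/

section Approximation

variable {I} {a : Fin I.k → Fin I.n}

/-- The optimal centers provide fair shifts of all prefixes whose gap exceeds `2 * opt`. -/
theorem Step1.exists_shift_of_opt_lt (h1 : I.Step1 a) {h : Fin I.k} (hh : I.opt < I.gap a h / 2) :
    ∃ g, I.IsFairShift (I.upTo a h) (I.gap a h / 2) g ∧ I.shiftRadius (I.upTo a h) g ≤ I.opt := by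
  obtain ⟨C, hC, hcost⟩ := I.exists_cost_eq_opt
  have : ∀ x, ∃ c ∈ C, I.ed c x ≤ I.opt := fun x => by
    obtain ⟨c, hc, he⟩ := I.exists_ed_eq_distTo hC.nonempty x
    refine ⟨c, hc, ?_⟩
    rw [ed_comm, he, ← hcost]
    exact le_iSup (I.distTo C) x
  choose g hgC hg using this
  have hsub : (I.upTo a h).image g ⊆ C := by
    intro x hx
    obtain ⟨y, -, rfl⟩ := Finset.mem_image.1 hx
    exact hgC y
  have hinj : Set.InjOn g (I.upTo a h) := by
    intro x hx y hy hxy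
    obtain ⟨i, hi, rfl⟩ := mem_upTo.1 (Finset.mem_coe.1 hx)
    obtain ⟨j, hj, rfl⟩ := mem_upTo.1 (Finset.mem_coe.1 hy)
    by_contra hne
    have hle := h1.gap_le_ed hi hj (fun h => hne (h ▸ rfl))
    -- A common optimal center would bring `a i` and `a j` closer together than their separation.
    have hlt : I.ed (a i) (a j) < I.gap a h / 2 + I.gap a h / 2 := by
      refine lt_of_le_of_lt (I.ed_triangle _ (g (a i)) _) (ENNReal.add_lt_add ?_ ?_)
      · rw [ed_comm]; exact (hg _).trans_lt hh
      · rw [hxy]; exact (hg _).trans_lt hh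
    rw [ENNReal.add_halves] at hlt
    exact absurd hlt (not_lt.2 hle)
  refine ⟨g, ⟨hinj, fun x _ => (hg x).trans_lt hh,
    fun i => (I.count_mono hsub i).trans (hC.2 i).2, ?_⟩, iSup₂_le fun x _ => hg x⟩
  -- The optimal set meets the lower bounds, so the deficit is at most the number of its points
  -- outside the image, which is `k - |A|`.
  have h2 : ∑ i, (I.l i - I.count ((I.upTo a h).image g) i) ≤
      ∑ i, (I.count C i - I.count ((I.upTo a h).image g) i) :=
    Finset.sum_le_sum fun i _ => Nat.sub_le_sub_right (hC.2 i).1 _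
  have h3 : ∑ i, (I.count C i - I.count ((I.upTo a h).image g) i) +
      ∑ i, I.count ((I.upTo a h).image g) i = ∑ i, I.count C i := by
    rw [← Finset.sum_add_distrib]
    exact Finset.sum_congr rfl fun i _ => Nat.sub_add_cancel (I.count_mono hsub i)
  rw [← card_eq_sum_count, ← card_eq_sum_count, Finset.card_image_of_injOn hinj, hC.1] at h3
  omega

theorem opt_lt_gap_zero {i : Fin I.k} (hi : (i : ℕ) = 0) : I.opt < I.gap a i / 2 := by
  rw [gap_eq_top hi, ENNReal.top_div_of_ne_top (by simp)]
  exact I.opt_lt_top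

theorem Step1.shiftable_zero (h1 : I.Step1 a) {i : Fin I.k} (hi : (i : ℕ) = 0) :
    I.Shiftable a i := by
  obtain ⟨g, hg, -⟩ := h1.exists_shift_of_opt_lt (opt_lt_gap_zero hi)
  exact ⟨g, hg⟩

theorem Step1.exists_step2 (h1 : I.Step1 a) : ∃ h, I.Step2 a h := by
  classical
  obtain ⟨h, hh, hmax⟩ := (Finset.univ.filter (I.Shiftable a)).exists_max_image id
    ⟨⟨0, I.k_pos⟩, by simpa using h1.shiftable_zero rfl⟩
  simp only [Finset.mem_filter, Finset.mem_univ, true_and, id] at hh hmax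
  exact ⟨h, hh, hmax⟩

theorem Step2.exists_step3 {h : Fin I.k} (h2 : I.Step2 a h) : ∃ g, I.Step3 a h g := by
  classical
  obtain ⟨g₀, h₀⟩ := h2.1
  obtain ⟨g, hg, hmin⟩ := (Finset.univ.filter
    (I.IsFairShift (I.upTo a h) (I.gap a h / 2))).exists_min_image (I.shiftRadius (I.upTo a h))
    ⟨g₀, by simpa⟩
  simp only [Finset.mem_filter, Finset.mem_univ, true_and] at hg hmin
  exact ⟨g, hg, hmin⟩

theorem Step3.exists_step4 {h : Fin I.k} {g : Fin I.n → Fin I.n} (h3 : I.Step3 a h g) :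
    ∃ C, I.Step4 a h g C := by
  obtain ⟨C, hC, hf⟩ := I.exists_feasible_superset ((I.upTo a h).image g) h3.1.upper
    (by rw [Finset.card_image_of_injOn h3.1.inj]; exact h3.1.lower)
  exact ⟨C, hC, hf⟩

/-- Some prefix of the greedy sequence has a gap exceeding `2 * opt` and covers all points within
distance `2 * opt`. -/
theorem Step1.exists_covering_prefix (h1 : I.Step1 a) :
    ∃ q, I.opt < I.gap a q / 2 ∧ ∀ x, I.distTo (I.upTo a q) x ≤ 2 * I.opt := by
  classical
  obtain ⟨q, hq, hmax⟩ := (Finset.univ.filter fun q => I.opt < I.gap a q / 2).exists_max_image id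
    ⟨⟨0, I.k_pos⟩, by simpa using opt_lt_gap_zero rfl⟩
  simp only [Finset.mem_filter, Finset.mem_univ, true_and, id] at hq hmax
  have half : ∀ r : ℝ≥0∞, ¬ I.opt < r / 2 → r ≤ 2 * I.opt := fun r hr => by
    rw [not_lt, ENNReal.div_le_iff (by simp) (by simp)] at hr
    rwa [mul_comm]
  refine ⟨q, hq, fun x => ?_⟩
  -- If a next center exists, it is a farthest point and by maximality of `q` its gap is at most `2
  -- * opt`. Otherwise the prefix already has `k` points, and the pigeonhole principle takes over.
  by_cases hk : (q : ℕ) + 1 < I.k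
  · let t : Fin I.k := ⟨q + 1, hk⟩
    have hb : I.before a t = I.upTo a q := by
      ext y
      rw [mem_before, mem_upTo]
      refine exists_congr fun j => and_congr_left fun _ => ?_
      rw [Fin.lt_def, Fin.le_def]
      exact Nat.lt_succ_iff
    rw [← hb]
    refine (h1 t x).trans (half _ fun ht => ?_)
    have := hmax t ht
    rw [Fin.le_def] at this
    simp [t] at this
  · by_contra! hx
    obtain ⟨C, hC, hcost⟩ := I.exists_cost_eq_opt
    have : ∀ x, ∃ c ∈ C, I.ed x c ≤ I.opt := fun x => by
      obtain ⟨c, hc, he⟩ := I.exists_ed_eq_distTo hC.nonempty x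
      exact ⟨c, hc, by rw [he, ← hcost]; exact le_iSup (I.distTo C) x⟩
    choose f hfC hf using this
    have hne : x ∉ I.upTo a q := fun hmem => by
      have h2 := I.distTo_le hmem x
      have h3 : I.ed x x = 0 := by simp [ed, d_self]
      rw [h3] at h2
      exact absurd hx (not_lt.2 (h2.trans zero_le))
    have hsep : ∀ y z, y ∈ insert x (I.upTo a q) → z ∈ insert x (I.upTo a q) → y ≠ z →
        2 * I.opt < I.ed y z := by
      intro y z hy hz hyz
      rcases Finset.mem_insert.1 hy with rfl | hy
      · rcases Finset.mem_insert.1 hz with rfl | hz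
        · exact absurd rfl hyz
        · exact hx.trans_le (I.distTo_le hz _)
      · rcases Finset.mem_insert.1 hz with hzx | hz
        · rw [hzx, ed_comm]; exact hx.trans_le (I.distTo_le hy _)
        · obtain ⟨i, hi, rfl⟩ := mem_upTo.1 hy
          obtain ⟨j, hj, rfl⟩ := mem_upTo.1 hz
          refine lt_of_lt_of_le ?_ (h1.gap_le_ed hi hj fun h => hyz (h ▸ rfl))
          rw [mul_comm]
          exact (ENNReal.lt_div_iff_mul_lt (by simp) (by simp)).1 hq
    have hinj : Set.InjOn f (insert x (I.upTo a q) : Finset (Fin I.n)) := by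
      intro y hy z hz hyz
      by_contra hne
      refine absurd (hsep y z hy hz hne) (not_lt.2 ?_)
      refine (I.ed_triangle y (f y) z).trans ?_
      rw [two_mul]
      refine add_le_add (hf y) ?_
      rw [hyz, ed_comm]
      exact hf z
    have hcard := Finset.card_le_card_of_injOn f (fun y _ => hfC y) hinj
    rw [Finset.card_insert_of_notMem hne, h1.card_upTo, hC.1] at hcard
    omega

/-- The covering prefix is shiftable, hence contained in the one chosen in step 2. A point is within
`2 * opt` of some center of it, and the substitute of that center is at most `opt` farther away. -/
theorem cost_le_of_steps {h : Fin I.k} {g : Fin I.n → Fin I.n} {C : Finset (Fin I.n)}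
    (h1 : I.Step1 a) (h2 : I.Step2 a h) (h3 : I.Step3 a h g) (h4 : I.Step4 a h g C) :
    I.cost C ≤ 3 * I.opt := by
  obtain ⟨q, hq, hcov⟩ := h1.exists_covering_prefix
  have hqh : q ≤ h := h2.2 q (by obtain ⟨g, hg, -⟩ := h1.exists_shift_of_opt_lt hq; exact ⟨g, hg⟩)
  have hr : I.shiftRadius (I.upTo a h) g ≤ I.opt := by
    -- Either the shift to the optimal centers competes in step 3, or the distance bound itself is
    -- at most `opt`.
    by_cases hh : I.opt < I.gap a h / 2
    · obtain ⟨g', hg', hr'⟩ := h1.exists_shift_of_opt_lt hh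
      exact (h3.2 g' hg').trans hr'
    · exact iSup₂_le fun x hx => (h3.1.close x hx).le.trans (not_lt.1 hh)
  refine iSup_le fun x => ?_
  have hne : (I.upTo a q).Nonempty := ⟨a q, mem_upTo.2 ⟨q, le_rfl, rfl⟩⟩
  obtain ⟨y, hy, he⟩ := I.exists_ed_eq_distTo hne x
  have hy' : y ∈ I.upTo a h := by
    obtain ⟨j, hj, rfl⟩ := mem_upTo.1 hy
    exact mem_upTo.2 ⟨j, hj.trans hqh, rfl⟩
  refine (I.distTo_le (h4.1 (Finset.mem_image_of_mem g hy')) x).trans ?_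
  refine (I.ed_triangle x y (g y)).trans ?_
  have h5 : I.ed y (g y) ≤ I.opt := by
    rw [ed_comm]
    exact (le_iSup₂ (f := fun b _ => I.ed (g b) b) y hy').trans hr
  calc I.ed x y + I.ed y (g y) ≤ 2 * I.opt + I.opt := add_le_add (he ▸ hcov x) h5
    _ = 3 * I.opt := by ring

theorem IsOutput.feasible {C : Finset (Fin I.n)} (h : I.IsOutput C) : I.Feasible C := by
  obtain ⟨a, h, g, -, -, -, h4⟩ := h
  exact h4.2

theorem IsOutput.cost_le {C : Finset (Fin I.n)} (h : I.IsOutput C) : I.cost C ≤ 3 * I.opt := by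
  obtain ⟨a, h, g, h1, h2, h3, h4⟩ := h
  exact cost_le_of_steps h1 h2 h3 h4

end Approximation

end Instance


/-! ### Reasoning about programs -/

infixr:60 ";;" => Program.seq

namespace Program

/-- `p.wNat x`: the program assigns to the natural variable `x`. -/
def wNat : Program → ℕ → Bool
  | skip, _ => false
  | setNat x _, y => y == x
  | putNat _ _ _, _ => false
  | setReal _ _, _ => false
  | putReal _ _ _, _ => false
  | seq p q, y => p.wNat y || q.wNat y
  | ite _ p q, y => p.wNat y || q.wNat y
  | loop _ p, y => p.wNat y

/-- `p.wNatArr A`: the program writes to the natural array `A`. -/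
def wNatArr : Program → ℕ → Bool
  | skip, _ => false
  | setNat _ _, _ => false
  | putNat A _ _, y => y == A
  | setReal _ _, _ => false
  | putReal _ _ _, _ => false
  | seq p q, y => p.wNatArr y || q.wNatArr y
  | ite _ p q, y => p.wNatArr y || q.wNatArr y
  | loop _ p, y => p.wNatArr y

/-- `p.wRealArr A`: the program writes to the real array `A`. -/
def wRealArr : Program → ℕ → Bool
  | skip, _ => false
  | setNat _ _, _ => false
  | putNat _ _ _, _ => false
  | setReal _ _, _ => false
  | putReal A _ _, y => y == A
  | seq p q, y => p.wRealArr y || q.wRealArr y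
  | ite _ p q, y => p.wRealArr y || q.wRealArr y
  | loop _ p, y => p.wRealArr y

def loopFree : Program → Bool
  | seq p q => p.loopFree && q.loopFree
  | ite _ p q => p.loopFree && q.loopFree
  | loop _ _ => false
  | _ => true

/-- A bound on the running time of a loop-free program. -/
def size : Program → ℕ
  | skip => 1
  | setNat _ e => e.cost + 1
  | putNat _ i e => i.cost + e.cost + 1
  | setReal _ e => e.cost + 1
  | putReal _ i e => i.cost + e.cost + 1
  | seq p q => p.size + q.size
  | ite b p q => b.cost + max p.size q.size + 1
  | loop _ _ => 0

open Classical in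
/-- The effect of a loop-free program. -/
noncomputable def run (D : ℕ → ℕ → ℝ) : Program → State → State
  | skip, s => s
  | setNat x e, s => s.setNat x (e.eval s)
  | putNat A i e, s => s.putNat A (i.eval s) (e.eval s)
  | setReal x e, s => s.setReal x (e.eval D s)
  | putReal A i e, s => s.putReal A (i.eval s) (e.eval D s)
  | seq p q, s => q.run D (p.run D s)
  | ite b p q, s => if b.Holds D s then p.run D s else q.run D s
  | loop _ _, s => s

end Program

/-! ### The memory after a single write -/

namespace State

variable (s : State) (x y A B i j v : ℕ) (r : ℝ)

@[simp] theorem nat_setNat : (s.setNat x v).nat y = if y = x then v else s.nat y := by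
  simp [setNat, Function.update_apply]
@[simp] theorem natArr_setNat : (s.setNat x v).natArr = s.natArr := rfl
@[simp] theorem realArr_setNat : (s.setNat x v).realArr = s.realArr := rfl
@[simp] theorem nat_putNat : (s.putNat A i v).nat = s.nat := rfl
@[simp] theorem natArr_putNat : (s.putNat A i v).natArr B =
    if B = A then Function.update (s.natArr B) i v else s.natArr B := by
  by_cases h : B = A
  · subst h; simp [putNat]
  · simp [putNat, h]
@[simp] theorem realArr_putNat : (s.putNat A i v).realArr = s.realArr := rfl
@[simp] theorem nat_setReal : (s.setReal x r).nat = s.nat := rfl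
@[simp] theorem natArr_setReal : (s.setReal x r).natArr = s.natArr := rfl
@[simp] theorem realArr_setReal : (s.setReal x r).realArr = s.realArr := rfl
@[simp] theorem nat_putReal : (s.putReal A i r).nat = s.nat := rfl
@[simp] theorem natArr_putReal : (s.putReal A i r).natArr = s.natArr := rfl
@[simp] theorem realArr_putReal : (s.putReal A i r).realArr B =
    if B = A then Function.update (s.realArr B) i r else s.realArr B := by
  by_cases h : B = A
  · subst h; simp [putReal]
  · simp [putReal, h]

end State

/-- The states `s` and `s'` agree on everything that `p` does not write (scalar reals, which no
program below uses, excepted). -/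
structure Same (p : Program) (s s' : State) : Prop where
  nat : ∀ x, p.wNat x = false → s'.nat x = s.nat x
  natArr : ∀ A, p.wNatArr A = false → s'.natArr A = s.natArr A
  realArr : ∀ A, p.wRealArr A = false → s'.realArr A = s.realArr A

namespace Same

variable {p q : Program} {s s' s'' : State}

theorem refl (p : Program) (s : State) : Same p s s := ⟨fun _ _ => rfl, fun _ _ => rfl, fun _ _ => rfl⟩

theorem trans (h : Same p s s') (h' : Same p s' s'') : Same p s s'' :=
  ⟨fun x hx => (h'.nat x hx).trans (h.nat x hx),
    fun x hx => (h'.natArr x hx).trans (h.natArr x hx),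
    fun x hx => (h'.realArr x hx).trans (h.realArr x hx)⟩

theorem mono (h : Same p s s') (h1 : ∀ x, q.wNat x = false → p.wNat x = false)
    (h2 : ∀ x, q.wNatArr x = false → p.wNatArr x = false)
    (h3 : ∀ x, q.wRealArr x = false → p.wRealArr x = false) : Same q s s' :=
  ⟨fun x hx => h.nat x (h1 x hx), fun x hx => h.natArr x (h2 x hx),
    fun x hx => h.realArr x (h3 x hx)⟩

theorem seq_left (h : Same p s s') : Same (p ;; q) s s' :=
  h.mono (by simp +contextual [Program.wNat]) (by simp +contextual [Program.wNatArr])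
    (by simp +contextual [Program.wRealArr])

theorem seq_right (h : Same q s s') : Same (p ;; q) s s' :=
  h.mono (by simp +contextual [Program.wNat]) (by simp +contextual [Program.wNatArr])
    (by simp +contextual [Program.wRealArr])

theorem ite_left {b : Test} (h : Same p s s') : Same (.ite b p q) s s' :=
  h.mono (by simp +contextual [Program.wNat]) (by simp +contextual [Program.wNatArr])
    (by simp +contextual [Program.wRealArr])

theorem ite_right {b : Test} (h : Same q s s') : Same (.ite b p q) s s' :=
  h.mono (by simp +contextual [Program.wNat]) (by simp +contextual [Program.wNatArr])
    (by simp +contextual [Program.wRealArr])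

theorem of_loop {b : Test} (h : Same p s s') : Same (.loop b p) s s' :=
  h.mono (by simp [Program.wNat]) (by simp [Program.wNatArr]) (by simp [Program.wRealArr])

end Same

/-- The frame rule. The write sets are Booleans computed from the syntax, so that later the claim
that a cell is untouched is proved by `rfl`. -/
theorem Exec.same {D : ℕ → ℕ → ℝ} {p : Program} {s s' : State} {t : ℕ} (h : Exec D p s s' t) :
    Same p s s' := by
  induction h with
  | skip s => exact .refl _ _
  | setNat s x e =>
    refine ⟨fun y hy => ?_, fun _ _ => rfl, fun _ _ => rfl⟩
    simp only [Program.wNat, beq_eq_false_iff_ne] at hy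
    simp [hy]
  | putNat s A i e =>
    refine ⟨fun _ _ => rfl, fun y hy => ?_, fun _ _ => rfl⟩
    simp only [Program.wNatArr, beq_eq_false_iff_ne] at hy
    funext j
    simp [hy]
  | setReal s x e => exact ⟨fun _ _ => rfl, fun _ _ => rfl, fun _ _ => rfl⟩
  | putReal s A i e =>
    refine ⟨fun _ _ => rfl, fun _ _ => rfl, fun y hy => ?_⟩
    simp only [Program.wRealArr, beq_eq_false_iff_ne] at hy
    funext j
    simp [hy]
  | seq _ _ h h' => exact h.seq_left.trans h'.seq_right
  | iteTrue _ _ h => exact h.ite_left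
  | iteFalse _ _ h => exact h.ite_right
  | loopTrue _ _ _ h h' => exact h.of_loop.trans h'
  | loopFalse _ => exact .refl _ _

/-- Started in `s`, the program halts within `T` steps in a state that satisfies `Q`. -/
def Runs (D : ℕ → ℕ → ℝ) (p : Program) (s : State) (Q : State → Prop) (T : ℕ) : Prop :=
  ∃ s' t, Exec D p s s' t ∧ t ≤ T ∧ Q s'

/-- This reduces the correctness of straight-line code to simplifying `run`. The bound `size`
charges the longer branch of each conditional. -/
theorem Program.exec_run (D : ℕ → ℕ → ℝ) {p : Program} (hp : p.loopFree = true) (s : State) :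
    ∃ t ≤ p.size, Exec D p s (p.run D s) t := by
  induction p generalizing s with
  | skip => exact ⟨_, le_rfl, .skip s⟩
  | setNat x e => exact ⟨_, le_rfl, .setNat s x e⟩
  | putNat A i e => exact ⟨_, le_rfl, .putNat s A i e⟩
  | setReal x e => exact ⟨_, le_rfl, .setReal s x e⟩
  | putReal A i e => exact ⟨_, le_rfl, .putReal s A i e⟩
  | seq p q ihp ihq =>
    simp only [loopFree, Bool.and_eq_true] at hp
    obtain ⟨t, ht, h⟩ := ihp hp.1 s
    obtain ⟨t', ht', h'⟩ := ihq hp.2 (p.run D s)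
    exact ⟨_, Nat.add_le_add ht ht', .seq h h'⟩
  | ite b p q ihp ihq =>
    simp only [loopFree, Bool.and_eq_true] at hp
    by_cases hb : b.Holds D s
    · obtain ⟨t, ht, h⟩ := ihp hp.1 s
      refine ⟨_, ?_, by simpa [run, hb] using Exec.iteTrue (q := q) hb h⟩
      simp only [size]
      omega
    · obtain ⟨t, ht, h⟩ := ihq hp.2 s
      refine ⟨_, ?_, by simpa [run, hb] using Exec.iteFalse (p := p) hb h⟩
      simp only [size]
      omega
  | loop b p _ => simp [loopFree] at hp

/-! ### Composition rules for timed execution -/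

namespace Runs

variable {D : ℕ → ℕ → ℝ} {p q : Program} {s : State} {Q Q' : State → Prop} {T T' T₁ T₂ : ℕ}

theorem mono (h : Runs D p s Q' T') (hQ : ∀ s', Same p s s' → Q' s' → Q s') (hT : T' ≤ T) :
    Runs D p s Q T := by
  obtain ⟨s', t, h, ht, hq⟩ := h
  exact ⟨s', t, h, ht.trans hT, hQ s' h.same hq⟩

theorem straight (hp : p.loopFree = true) (hQ : Q (p.run D s)) (hT : p.size ≤ T) :
    Runs D p s Q T := by
  obtain ⟨t, ht, h⟩ := p.exec_run D hp s
  exact ⟨_, t, h, ht.trans hT, hQ⟩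

theorem seq (h : Runs D p s Q' T₁) (h' : ∀ s', Same p s s' → Q' s' → Runs D q s' Q T₂)
    (hT : T₁ + T₂ ≤ T) : Runs D (p ;; q) s Q T := by
  obtain ⟨s', t, h, ht, hq⟩ := h
  obtain ⟨s'', t', h', ht', hq'⟩ := h' s' h.same hq
  exact ⟨s'', t + t', .seq h h', by omega, hq'⟩

/-- A loop-free program followed by another one. -/
theorem straight_seq (hp : p.loopFree = true) (h : Runs D q (p.run D s) Q T₂)
    (hT : p.size + T₂ ≤ T) : Runs D (p ;; q) s Q T :=
  (straight (Q := fun s' => s' = p.run D s) hp rfl le_rfl).seq (fun _ _ h' => h' ▸ h) hT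

theorem ite {b : Test} (h : b.Holds D s → Runs D p s Q T₁) (h' : ¬ b.Holds D s → Runs D q s Q T₂)
    (hT : b.cost + max T₁ T₂ + 1 ≤ T) : Runs D (.ite b p q) s Q T := by
  by_cases hb : b.Holds D s
  · obtain ⟨s', t, h, ht, hq⟩ := h hb
    exact ⟨s', _, .iteTrue hb h, by omega, hq⟩
  · obtain ⟨s', t, h, ht, hq⟩ := h' hb
    exact ⟨s', _, .iteFalse hb h, by omega, hq⟩

/-- The loop rule, with a measure that bounds the number of iterations. -/
theorem loop {b : Test} {c : ℕ} (Inv : State → Prop) (μ : State → ℕ) (h0 : Inv s)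
    (step : ∀ s', Same p s s' → Inv s' → b.Holds D s' →
      Runs D p s' (fun s'' => Inv s'' ∧ μ s'' < μ s') c)
    (hT : μ s * (c + b.cost + 1) + b.cost + 1 ≤ T) :
    Runs D (.loop b p) s (fun s' => Inv s' ∧ ¬ b.Holds D s') T := by
  -- Strong induction on the measure; `Same p s s'` is carried along so that frame facts about the
  -- start of the loop are available in every iteration.
  suffices H : ∀ N s', Same p s s' → Inv s' → μ s' = N →
      Runs D (.loop b p) s' (fun s' => Inv s' ∧ ¬ b.Holds D s')
        (N * (c + b.cost + 1) + b.cost + 1) from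
    (H (μ s) s (.refl _ _) h0 rfl).mono (fun _ _ h => h) hT
  intro N
  induction N using Nat.strong_induction_on with
  | _ N ih =>
    intro s' hs hI hN
    by_cases hb : b.Holds D s'
    · obtain ⟨s₁, t, h, ht, hI₁, hμ⟩ := step s' hs hI hb
      obtain ⟨s₂, t', h', ht', hq⟩ := ih (μ s₁) (hN ▸ hμ) s₁ (hs.trans h.same) hI₁ rfl
      refine ⟨s₂, _, .loopTrue hb h h', ?_, hq⟩
      have : (μ s₁ + 1) * (c + b.cost + 1) ≤ N * (c + b.cost + 1) :=
        Nat.mul_le_mul_right _ (by omega)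
      rw [Nat.add_mul] at this
      omega
    · exact ⟨s', _, .loopFalse hb, by omega, hI, hb⟩

end Runs

/-- `for x in [0, e) do p` -/
def forUp (x : ℕ) (e : NatExpr) (p : Program) : Program :=
  .setNat x (.lit 0) ;;
    .loop (.not (.natLe e (.var x))) (p ;; .setNat x (.plus (.var x) (.lit 1)))

/-- The body must leave the counter alone, and the bound `e` must keep its value `N` under all
writes of the loop; the invariant for `i + 1` is required after the counter has advanced. Per
iteration, `e.cost + 8` pays for the test, the increment and the loop overhead. -/
theorem Runs.forUp {D : ℕ → ℕ → ℝ} {x : ℕ} {e : NatExpr} {p : Program} {s : State} {c T : ℕ}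
    (N : ℕ) (Inv : ℕ → State → Prop) (hp : p.wNat x = false)
    (he : ∀ s', Same (forUp x e p) s s' → e.eval s' = N)
    (h0 : Inv 0 (s.setNat x 0))
    (step : ∀ i s', i < N → Same (FairKCenter.forUp x e p) s s' → s'.nat x = i → Inv i s' →
      Runs D p s' (fun s'' => Inv (i + 1) (s''.setNat x (i + 1))) c)
    (hT : N * (c + e.cost + 8) + e.cost + 8 ≤ T) :
    Runs D (forUp x e p) s (fun s' => Inv N s') T := by
  have hsame0 : Same (FairKCenter.forUp x e p) s (s.setNat x 0) := by
    refine ⟨fun y hy => ?_, fun _ _ => rfl, fun _ _ => rfl⟩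
    simp only [FairKCenter.forUp, Program.wNat, Bool.or_eq_false_iff, beq_eq_false_iff_ne] at hy
    simp [hy.1]
  refine Runs.straight_seq rfl ?_ (T₂ := N * (c + e.cost + 8) + e.cost + 4) ?_
  · refine Runs.mono (Runs.loop (c := c + 4)
      (fun s' => s'.nat x ≤ N ∧ Inv (s'.nat x) s') (fun s' => N - s'.nat x)
      ?_ ?_ le_rfl) ?_ ?_
    · simpa [Program.run, NatExpr.eval] using h0
    · intro s' hs' ⟨hle, hI⟩ hb
      have hs : Same (FairKCenter.forUp x e p) s s' := hsame0.trans hs'.of_loop.seq_right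
      have hlt : s'.nat x < N := by
        simpa [Test.Holds, NatExpr.eval, he s' hs] using hb
      refine (step _ s' hlt hs rfl hI).seq (T₂ := 4) (fun s'' h'' hI' => ?_) le_rfl
      refine Runs.straight rfl ?_ (by simp [Program.size, NatExpr.cost])
      simp only [Program.run, NatExpr.eval, State.nat_setNat, if_true]
      rw [h''.nat x hp]
      exact ⟨⟨hlt, hI'⟩, by omega⟩
    · intro s' hs' ⟨⟨hle, hI⟩, hb⟩
      have hs : Same (FairKCenter.forUp x e p) s s' := hsame0.trans hs'.seq_right
      have : N ≤ s'.nat x := by simpa [Test.Holds, NatExpr.eval, he s' hs] using hb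
      rwa [le_antisymm hle this] at hI
    · simp only [Program.run, NatExpr.eval, State.nat_setNat, if_true, Test.cost, NatExpr.cost,
        Nat.sub_zero]
      have : c + 4 + (e.cost + 1 + 1 + 1) + 1 = c + e.cost + 8 := by ring
      rw [this]
      omega
  · simp only [Program.size, NatExpr.cost]
    omega

attribute [simp] Program.run NatExpr.eval RealExpr.eval Test.Holds


/-! ### Matching centers to points under group constraints -/

/-- Centers `0, …, p - 1` are to be matched to points `x < n`; a point `x` is available to the
center `act x` only. Group `g` has room for `u g` points, and the total excess over the lower
bounds `l g` may be at most `F`. -/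
structure Network where
  n : ℕ
  m : ℕ
  p : ℕ
  F : ℕ
  grp : ℕ → ℕ
  l : ℕ → ℕ
  u : ℕ → ℕ
  act : ℕ → ℕ

namespace Network

variable (N : Network)

/-- The number of centers matched to points of group `g`; a center `j` is free if `n ≤ M j`. -/
def cnt (M : ℕ → ℕ) (g : ℕ) : ℕ :=
  ((Finset.range N.p).filter fun j => M j < N.n ∧ N.grp (M j) = g).card

def exc (T : ℕ → ℕ) : ℕ := ∑ g ∈ Finset.range N.m, (T g - N.l g)

def Fits (T : ℕ → ℕ) : Prop := (∀ g < N.m, T g ≤ N.u g) ∧ N.exc T ≤ N.F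

structure IsMatching (M : ℕ → ℕ) : Prop where
  edge : ∀ j < N.p, M j < N.n → N.act (M j) = j
  fits : N.Fits (N.cnt M)

def Full (M : ℕ → ℕ) : Prop := ∀ j < N.p, M j < N.n

def Feasible : Prop := ∃ M, N.IsMatching M ∧ N.Full M

/-- The number of free centers. -/
def free (M : ℕ → ℕ) : ℕ := ((Finset.range N.p).filter fun j => ¬ M j < N.n).card

def addOne (T : ℕ → ℕ) (g : ℕ) : ℕ → ℕ := fun w => T w + if w = g then 1 else 0

/-- The arcs of the residual graph, with labels. The nodes are the centers `j`, the groups `k + g`,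
a pool `k + m` for the excess and a sink `k + m + 1`. -/
inductive Res (k : ℕ) (M : ℕ → ℕ) : ℕ → ℕ → ℕ → Prop
  | point {x : ℕ} : x < N.n → N.act x < N.p → Res k M (N.act x) (k + N.grp x) x
  | back {j : ℕ} : j < N.p → M j < N.n → Res k M (k + N.grp (M j)) j 0
  | toPool {g : ℕ} : g < N.m → N.cnt M g < N.u g → Res k M (k + g) (k + N.m) 0
  | ofPool {g : ℕ} : g < N.m → N.l g < N.cnt M g → Res k M (k + N.m) (k + g) 0
  | toSink {g : ℕ} : g < N.m → N.cnt M g < N.l g → Res k M (k + g) (k + N.m + 1) 0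
  | poolSink : N.exc (N.cnt M) < N.F → Res k M (k + N.m) (k + N.m + 1) 0

variable {N}

theorem exc_addOne (T : ℕ → ℕ) {g : ℕ} (hg : g < N.m) :
    N.exc (addOne T g) = N.exc T + if N.l g ≤ T g then 1 else 0 := by
  have h : ∀ w ∈ Finset.range N.m, addOne T g w - N.l w =
      (T w - N.l w) + if g = w then (if N.l g ≤ T g then 1 else 0) else 0 := by
    intro w _
    unfold addOne
    by_cases hw : w = g
    · subst hw
      simp only [if_true]
      split_ifs <;> omega
    · simp [hw, Ne.symm hw]
  rw [exc, Finset.sum_congr rfl h, Finset.sum_add_distrib, Finset.sum_ite_eq, exc]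
  simp [hg]

theorem exc_congr {T T' : ℕ → ℕ} (h : ∀ g < N.m, T g = T' g) : N.exc T = N.exc T' :=
  Finset.sum_congr rfl fun g hg => by rw [h g (Finset.mem_range.1 hg)]

theorem Fits.congr {T T' : ℕ → ℕ} (hT : N.Fits T) (h : ∀ g < N.m, T' g = T g) : N.Fits T' :=
  ⟨fun g hg => (h g hg).trans_le (hT.1 g hg), (exc_congr h).trans_le hT.2⟩

theorem Fits.mono {T T' : ℕ → ℕ} (hT : N.Fits T) (h : ∀ g < N.m, T' g ≤ T g) : N.Fits T' :=
  ⟨fun g hg => (h g hg).trans (hT.1 g hg), le_trans (Finset.sum_le_sum fun g hg =>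
    Nat.sub_le_sub_right (h g (Finset.mem_range.1 hg)) _) hT.2⟩

theorem cnt_congr {M M' : ℕ → ℕ} (h : ∀ j < N.p, M' j = M j) (g : ℕ) :
    N.cnt M' g = N.cnt M g := by
  unfold cnt
  congr 1
  refine Finset.filter_congr fun j hj => ?_
  rw [h j (Finset.mem_range.1 hj)]

theorem cnt_eq_add (M : ℕ → ℕ) {j : ℕ} (hj : j < N.p) (w : ℕ) :
    N.cnt M w = (if M j < N.n ∧ N.grp (M j) = w then 1 else 0) +
      ∑ i ∈ (Finset.range N.p).erase j, if M i < N.n ∧ N.grp (M i) = w then 1 else 0 := by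
  rw [cnt, Finset.card_filter]
  exact (Finset.add_sum_erase _ (fun i => if M i < N.n ∧ N.grp (M i) = w then 1 else 0)
    (Finset.mem_range.2 hj)).symm

/-- Stated with a sum on both sides, which keeps truncated subtraction out of the later counting.
The old value `M j` may be free, and then nothing is given up. -/
theorem cnt_update (M : ℕ → ℕ) {j x : ℕ} (hj : j < N.p) (hx : x < N.n) (w : ℕ) :
    N.cnt (Function.update M j x) w + (if M j < N.n ∧ N.grp (M j) = w then 1 else 0) =
      N.cnt M w + if N.grp x = w then 1 else 0 := by
  rw [cnt_eq_add _ hj, cnt_eq_add M hj]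
  have : ∑ i ∈ (Finset.range N.p).erase j, (if Function.update M j x i < N.n ∧
      N.grp (Function.update M j x i) = w then 1 else 0) =
      ∑ i ∈ (Finset.range N.p).erase j, if M i < N.n ∧ N.grp (M i) = w then 1 else 0 :=
    Finset.sum_congr rfl fun i hi => by
      rw [Function.update_of_ne (Finset.ne_of_mem_erase hi)]
  rw [this]
  simp only [Function.update_self, hx, true_and]
  omega

/-! ### The cut certificate -/

/-- If the sink is not reachable from a free center, no matching is full. -/
theorem not_feasible_of_closed {k : ℕ} {M : ℕ → ℕ} (hgrp : ∀ x < N.n, N.grp x < N.m)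
    (S : Set ℕ) {c : ℕ} (hc : c < N.p) (hfree : ¬ M c < N.n) (hcS : c ∈ S)
    (hclosed : ∀ a b x, a ∈ S → N.Res k M a b x → b ∈ S) (hsink : k + N.m + 1 ∉ S) :
    ¬ N.Feasible := by
  classical
  rintro ⟨M', hM', hfull⟩
  set G := (Finset.range N.m).filter fun g => k + g ∈ S with hG
  set R := (Finset.range N.p).filter fun j => j ∈ S with hR
  -- Every center in `S` is matched by `M'`, and the point arc it uses leads to a group in `S`.
  have h1 : R.card ≤ ∑ g ∈ G, N.cnt M' g := by
    rw [Finset.card_eq_sum_card_fiberwise (f := fun j => N.grp (M' j)) (t := G)]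
    · refine Finset.sum_le_sum fun g _ => Finset.card_le_card fun j hj => ?_
      simp only [hR, Finset.mem_filter, Finset.mem_range] at hj ⊢
      exact ⟨hj.1.1, hfull j hj.1.1, hj.2⟩
    · intro j hj
      simp only [hR, hG, Finset.coe_filter, Finset.mem_range, Set.mem_ofPred_eq] at hj ⊢
      have hj' := hfull j hj.1
      refine ⟨hgrp _ hj', ?_⟩
      have he := hM'.edge j hj.1 hj'
      have := Res.point (N := N) (k := k) (M := M) hj' (he.symm ▸ hj.1)
      exact hclosed _ _ _ (he.symm ▸ hj.2) this
  -- Centers that `M` matches into groups of `G` lie in `S` by the back arcs, while `c` lies in `S`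
  -- and is unmatched, so the inequality is strict.
  have h2 : ∑ g ∈ G, N.cnt M g < R.card := by
    set Q := (Finset.range N.p).filter fun j => M j < N.n ∧ N.grp (M j) ∈ G with hQ
    have h3 : Q.card = ∑ g ∈ G, N.cnt M g := by
      rw [Finset.card_eq_sum_card_fiberwise (f := fun j => N.grp (M j)) (t := G)]
      · refine Finset.sum_congr rfl fun g hg => ?_
        unfold cnt
        congr 1
        ext j
        simp only [hQ, Finset.mem_filter]
        constructor
        · rintro ⟨⟨h1, h2, -⟩, h3⟩; exact ⟨h1, h2, h3⟩
        · rintro ⟨h1, h2, h3⟩; exact ⟨⟨h1, h2, h3 ▸ hg⟩, h3⟩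
      · intro j hj
        simp only [hQ, Finset.coe_filter, Set.mem_ofPred_eq] at hj
        exact hj.2.2
    rw [← h3]
    refine Finset.card_lt_card (Finset.ssubset_iff_of_subset ?_ |>.2 ⟨c, ?_, ?_⟩)
    · intro j hj
      simp only [hQ, hG, hR, Finset.mem_filter, Finset.mem_range] at hj ⊢
      exact ⟨hj.1, hclosed _ _ _ hj.2.2.2 (Res.back hj.1 hj.2.1)⟩
    · simp [hR, hc, hcS]
    · simp only [hQ, Finset.mem_filter]
      exact fun h => hfree h.2.1
  have hl : ∀ g ∈ G, N.l g ≤ N.cnt M g := by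
    intro g hg
    simp only [hG, Finset.mem_filter, Finset.mem_range] at hg
    by_contra! h
    exact hsink (hclosed _ _ _ hg.2 (Res.toSink hg.1 h))
  -- With the pool in `S`, its capacity is used up and all excess of `M` sits in `G`, so `M` has at
  -- least `F + ∑ l` units there, which no matching exceeds. Without it, every group of `G` is at
  -- its upper bound.
  by_cases hp : k + N.m ∈ S
  · have hF : N.F ≤ N.exc (N.cnt M) := by
      by_contra! h
      exact hsink (hclosed _ _ _ hp (Res.poolSink h))
    have h4 : N.exc (N.cnt M) = ∑ g ∈ G, (N.cnt M g - N.l g) := by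
      rw [exc, hG]
      refine (Finset.sum_subset (Finset.filter_subset _ _) fun g hg hg' => ?_).symm
      by_contra h
      refine hg' (Finset.mem_filter.2 ⟨hg, hclosed _ _ _ hp
        (Res.ofPool (Finset.mem_range.1 hg) ?_)⟩)
      omega
    have h5 : ∑ g ∈ G, (N.cnt M' g - N.l g) ≤ N.F :=
      (Finset.sum_le_sum_of_subset (Finset.filter_subset _ _)).trans hM'.fits.2
    have h6 : ∑ g ∈ G, N.cnt M' g ≤ ∑ g ∈ G, (N.cnt M' g - N.l g) + ∑ g ∈ G, N.l g := by
      rw [← Finset.sum_add_distrib]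
      exact Finset.sum_le_sum fun g _ => by omega
    have h7 : ∑ g ∈ G, N.cnt M g = ∑ g ∈ G, (N.cnt M g - N.l g) + ∑ g ∈ G, N.l g := by
      rw [← Finset.sum_add_distrib]
      exact Finset.sum_congr rfl fun g hg => by have := hl g hg; omega
    omega
  · have h3 : ∑ g ∈ G, N.cnt M' g ≤ ∑ g ∈ G, N.cnt M g := by
      refine Finset.sum_le_sum fun g hg => ?_
      simp only [hG, Finset.mem_filter, Finset.mem_range] at hg
      refine (hM'.fits.1 g hg.1).trans ?_
      by_contra! h
      exact hp (hclosed _ _ _ hg.2 (Res.toPool hg.1 h))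
    omega

/-! ### Augmentation -/

/-- The state of an augmentation that is traced back from the sink to the free center `c` and has
arrived at the node `v`: `M'` differs from `M` on the part of the path behind `v`, and is short of
one unit at `v`. `pos` increases along the path. -/
structure Augmenting (N : Network) (k : ℕ) (M : ℕ → ℕ) (c : ℕ) (pos : ℕ → ℕ) (v : ℕ)
    (M' : ℕ → ℕ) : Prop where
  edge : ∀ j < N.p, M' j < N.n → N.act (M' j) = j
  keep : ∀ j < N.p, M j < N.n → M' j < N.n
  agree : ∀ j < N.p, pos j < pos v → M' j = M j
  sink : v = k + N.m + 1 → ∀ j < N.p, M' j = M j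
  group : ∀ g < N.m, v = k + g → N.Fits (addOne (N.cnt M') g) ∧ N.cnt M g ≤ N.cnt M' g + 1 ∧
    ∀ w < N.m, pos (k + w) < pos v → N.cnt M' w = N.cnt M w
  pool : v = k + N.m → N.Fits (N.cnt M') ∧ N.exc (N.cnt M') < N.F ∧
    ∀ w < N.m, pos (k + w) < pos v → N.cnt M' w = N.cnt M w
  center : v < k → v ≠ c → N.Fits (addOne (N.cnt M') (N.grp (M v))) ∧
    ∀ w < N.m, pos (k + w) < pos v → addOne (N.cnt M') (N.grp (M v)) w = N.cnt M w
  start : v < k → v = c → M' c < N.n ∧ N.Fits (N.cnt M')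

variable {k : ℕ} {M M' : ℕ → ℕ} {c : ℕ} {pos : ℕ → ℕ} {v : ℕ}

/-- The walk back starts with the unchanged matching. Centers, groups, pool and sink have disjoint
ranges of numbers, so here and below the clauses for the other kinds of nodes are vacuous. At a
group, one more unit of it must fit; at a center, its former group must be able to take back the
unit it has just lost. -/
theorem IsMatching.augmenting_sink (hM : N.IsMatching M) :
    N.Augmenting k M c pos (k + N.m + 1) M where
  edge := hM.edge
  keep _ _ h := h
  agree _ _ _ := rfl
  sink _ _ _ := rfl
  group _ _ _ := by omega
  pool _ := by omega
  center _ := by omega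
  start _ := by omega

theorem Augmenting.isMatching (h : N.Augmenting k M c pos c M') (hc : c < k) :
    N.IsMatching M' ∧ M' c < N.n :=
  ⟨⟨h.edge, (h.start hc rfl).2⟩, (h.start hc rfl).1⟩

/-- Going back over an arc into a center. -/
theorem Augmenting.back (h : N.Augmenting k M c pos v M') (hpk : N.p ≤ k)
    (hgrp : ∀ x < N.n, N.grp x < N.m) (hv : v < N.p) (hMv : M v < N.n) (hvc : v ≠ c)
    (hpos : pos (k + N.grp (M v)) < pos v) :
    N.Augmenting k M c pos (k + N.grp (M v)) M' := by
  have hg := hgrp _ hMv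
  obtain ⟨h1, h2⟩ := h.center (by omega) hvc
  refine ⟨h.edge, h.keep, fun j hj hp => h.agree j hj (hp.trans hpos), by omega, ?_, by omega,
    by omega, by omega⟩
  intro g _ hgg
  obtain rfl : N.grp (M v) = g := by omega
  refine ⟨h1, (h2 _ hg hpos).ge.trans (by simp [addOne]), fun w hw hwp => ?_⟩
  rw [← h2 w hw (hwp.trans hpos), addOne, if_neg, add_zero]
  rintro rfl
  exact lt_irrefl _ hwp

/-- Going back over an arc out of the pool. -/
theorem Augmenting.ofPool (h : N.Augmenting k M c pos v M') {g : ℕ} (hg : g < N.m)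
    (hv : v = k + g) (hl : N.l g < N.cnt M g) (hpos : pos (k + N.m) < pos v) :
    N.Augmenting k M c pos (k + N.m) M' := by
  obtain ⟨h1, h2, h3⟩ := h.group g hg hv
  refine ⟨h.edge, h.keep, fun j hj hp => h.agree j hj (hp.trans hpos), by omega, by omega,
    fun _ => ⟨?_, ?_, fun w hw hwp => h3 w hw (hwp.trans hpos)⟩, by omega, by omega⟩
  · exact h1.mono fun w _ => by simp [addOne]
  -- The promised unit at `g` would lie above `l g` and count as excess, so without it the excess is
  -- strictly below `F`.
  · have := h1.2
    rw [exc_addOne _ hg, if_pos (by omega)] at this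
    omega

/-- Going back over an arc into the pool. -/
theorem Augmenting.toPool (h : N.Augmenting k M c pos (k + N.m) M') {g : ℕ} (hg : g < N.m)
    (hu : N.cnt M g < N.u g) (hpos : pos (k + g) < pos (k + N.m)) :
    N.Augmenting k M c pos (k + g) M' := by
  obtain ⟨h1, h2, h3⟩ := h.pool rfl
  -- The group comes earlier on the path, so its count is still that of `M` and the room below `u g`
  -- is still there. The pool has room for one unit of excess.
  have h4 := h3 g hg hpos
  refine ⟨h.edge, h.keep, fun j hj hp => h.agree j hj (hp.trans hpos), by omega, ?_, by omega,
    by omega, by omega⟩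
  intro g' _ hgg
  obtain rfl : g = g' := by omega
  refine ⟨⟨fun w hw => ?_, ?_⟩, by omega, fun w hw hwp => h3 w hw (hwp.trans hpos)⟩
  · unfold addOne
    have := h1.1 w hw
    split_ifs with hwg
    · subst hwg; omega
    · omega
  · rw [exc_addOne _ hg]
    split_ifs <;> omega

/-- Going back over an arc from a group to the sink. -/
theorem Augmenting.toSink (h : N.Augmenting k M c pos (k + N.m + 1) M') (hM : N.IsMatching M)
    (hlu : ∀ g < N.m, N.l g ≤ N.u g) {g : ℕ} (hg : g < N.m)
    (hl : N.cnt M g < N.l g) (hpos : pos (k + g) < pos (k + N.m + 1)) :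
    N.Augmenting k M c pos (k + g) M' := by
  have h1 := h.sink rfl
  have h2 := cnt_congr h1
  have h3 : N.cnt M' = N.cnt M := funext h2
  refine ⟨h.edge, h.keep, fun j hj hp => h.agree j hj (hp.trans hpos), by omega, ?_, by omega,
    by omega, by omega⟩
  intro g' _ hgg
  obtain rfl : g = g' := by omega
  rw [h3]
  refine ⟨⟨fun w hw => ?_, ?_⟩, by omega, fun w hw hwp => rfl⟩
  · unfold addOne
    have := hM.fits.1 w hw
    split_ifs with hwg
    · subst hwg; have := hlu w hw; omega
    · omega
  -- A unit below the lower bound adds nothing to the excess.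
  · rw [exc_addOne _ hg, if_neg (by omega)]
    exact hM.fits.2

/-- Going back over the arc from the pool to the sink. -/
theorem Augmenting.poolSink (h : N.Augmenting k M c pos (k + N.m + 1) M') (hM : N.IsMatching M)
    (hF : N.exc (N.cnt M) < N.F) (hpos : pos (k + N.m) < pos (k + N.m + 1)) :
    N.Augmenting k M c pos (k + N.m) M' := by
  have h3 : N.cnt M' = N.cnt M := funext (cnt_congr (h.sink rfl))
  refine ⟨h.edge, h.keep, fun j hj hp => h.agree j hj (hp.trans hpos), by omega, by omega,
    fun _ => ?_, by omega, by omega⟩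
  rw [h3]
  exact ⟨hM.fits, hF, fun _ _ _ => rfl⟩

/-- Going back over the arc of an available point `x`. -/
theorem Augmenting.point {x : ℕ} (h : N.Augmenting k M c pos (k + N.grp x) M') (hpk : N.p ≤ k)
    (hgrp : ∀ x < N.n, N.grp x < N.m) (hx : x < N.n) (hax : N.act x < N.p)
    (hc : ¬ M c < N.n) (hm : N.act x ≠ c → M (N.act x) < N.n)
    (hpos : pos (N.act x) < pos (k + N.grp x)) :
    N.Augmenting k M c pos (N.act x) (Function.update M' (N.act x) x) := by
  obtain ⟨h1, -, h3⟩ := h.group _ (hgrp x hx) rfl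
  have hu := cnt_update (N := N) M' hax hx
  have hagree := h.agree _ hax hpos
  rw [hagree] at hu
  refine ⟨fun j hj hjn => ?_, fun j hj hjn => ?_, fun j hj hp => ?_, by omega, by omega, by omega,
    fun _ hne => ?_, fun _ he => ?_⟩
  · by_cases hjx : j = N.act x
    · subst hjx; simp
    · rw [Function.update_of_ne hjx] at hjn ⊢
      exact h.edge j hj hjn
  · by_cases hjx : j = N.act x
    · subst hjx; simpa
    · rw [Function.update_of_ne hjx]
      exact h.keep j hj hjn
  · have hjx : j ≠ N.act x := by rintro rfl; exact lt_irrefl _ hp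
    rw [Function.update_of_ne hjx]
    exact h.agree j hj (hp.trans hpos)
  · have hmn := hm hne
    -- The center exchanges a unit of its old group for one of `grp x`. Giving the old unit back
    -- afterwards therefore has the same counts as adding the new unit to `M'`.
    have h4 : ∀ w, addOne (N.cnt (Function.update M' (N.act x) x)) (N.grp (M (N.act x))) w =
        addOne (N.cnt M') (N.grp x) w := by
      intro w
      have := hu w
      simp only [hmn, true_and] at this
      simp only [addOne, eq_comm (a := w)]
      exact this
    refine ⟨h1.congr fun w _ => h4 w, fun w hw hwp => ?_⟩
    rw [h4, addOne, if_neg, add_zero]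
    · exact h3 w hw (hwp.trans hpos)
    · rintro rfl
      exact lt_irrefl _ (hwp.trans hpos)
  -- At the free center no unit is given up, so the promised unit becomes a real one.
  · subst he
    refine ⟨by simpa, h1.congr fun w _ => ?_⟩
    have := hu w
    simp only [hc, false_and, if_false, add_zero] at this
    rw [this, addOne]
    simp only [eq_comm]

/-- A step back over any arc of the search tree. -/
theorem Augmenting.step (h : N.Augmenting k M c pos v M') (hM : N.IsMatching M) (hpk : N.p ≤ k)
    (hgrp : ∀ x < N.n, N.grp x < N.m) (hlu : ∀ g < N.m, N.l g ≤ N.u g) {a x : ℕ}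
    (hr : N.Res k M a v x) (hc : ¬ M c < N.n) (hm : a < k → a ≠ c → M a < N.n)
    (hpos : pos a < pos v) (hvc : v ≠ c) :
    N.Augmenting k M c pos a (if a < k then Function.update M' a x else M') := by
  cases hr with
  | point hx hax =>
    rw [if_pos (by omega)]
    exact h.point hpk hgrp hx hax hc (hm (by omega)) hpos
  | back hj hMj =>
    rw [if_neg (by omega)]
    exact h.back hpk hgrp hj hMj hvc hpos
  | toPool hg hu =>
    rw [if_neg (by omega)]
    exact h.toPool hg hu hpos
  | ofPool hg hl =>
    rw [if_neg (by omega)]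
    exact h.ofPool hg rfl hl hpos
  | toSink hg hl =>
    rw [if_neg (by omega)]
    exact h.toSink hM hlu hg hl hpos
  | poolSink hF =>
    rw [if_neg (by omega)]
    exact h.poolSink hM hF hpos

theorem free_lt_of_augmented (hk : ∀ j < N.p, M j < N.n → M' j < N.n) (hc : c < N.p)
    (hfree : ¬ M c < N.n) (hM' : M' c < N.n) : N.free M' < N.free M := by
  refine Finset.card_lt_card (Finset.ssubset_iff_of_subset ?_ |>.2 ⟨c, ?_, ?_⟩)
  · intro j hj
    simp only [Finset.mem_filter, Finset.mem_range] at hj ⊢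
    exact ⟨hj.1, fun h => hj.2 (hk j hj.1 h)⟩
  · simpa [hc] using hfree
  · simp [hM']

end Network


/-! ### Registers -/

@[simp] abbrev vn : ℕ := 0
@[simp] abbrev vm : ℕ := 1
@[simp] abbrev vk : ℕ := 2
@[simp] abbrev vi : ℕ := 3
@[simp] abbrev vx : ℕ := 4
@[simp] abbrev voff : ℕ := 5
@[simp] abbrev vbest : ℕ := 6
@[simp] abbrev vp : ℕ := 7
@[simp] abbrev vF : ℕ := 8
@[simp] abbrev vE : ℕ := 9
@[simp] abbrev vexc : ℕ := 10
@[simp] abbrev vflag : ℕ := 11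
@[simp] abbrev vc : ℕ := 12
@[simp] abbrev vv : ℕ := 13
@[simp] abbrev ve : ℕ := 14
@[simp] abbrev vhead : ℕ := 15
@[simp] abbrev vtail : ℕ := 16
@[simp] abbrev vw : ℕ := 17
@[simp] abbrev vpos : ℕ := 18
@[simp] abbrev vlen : ℕ := 19
@[simp] abbrev vsrc : ℕ := 23
@[simp] abbrev vdst : ℕ := 24
@[simp] abbrev vlab : ℕ := 25

@[simp] abbrev aGrp : ℕ := 0
@[simp] abbrev aL : ℕ := 1
@[simp] abbrev aU : ℕ := 2
@[simp] abbrev aOut : ℕ := 3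
@[simp] abbrev aCen : ℕ := 4
@[simp] abbrev aTab : ℕ := 5
@[simp] abbrev aNear : ℕ := 6
@[simp] abbrev aAct : ℕ := 7
@[simp] abbrev aM : ℕ := 8
@[simp] abbrev aCnt : ℕ := 9
@[simp] abbrev aSrc : ℕ := 10
@[simp] abbrev aDst : ℕ := 11
@[simp] abbrev aLab : ℕ := 12
@[simp] abbrev aNxt : ℕ := 13
@[simp] abbrev aFirst : ℕ := 14
@[simp] abbrev aQueue : ℕ := 15
@[simp] abbrev aReach : ℕ := 16
@[simp] abbrev aPar : ℕ := 17
@[simp] abbrev aBase : ℕ := 18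
@[simp] abbrev aUsed : ℕ := 19
@[simp] abbrev aRow : ℕ := 20
@[simp] abbrev aPtr : ℕ := 21
@[simp] abbrev aChosen : ℕ := 22

@[simp] abbrev rCur : ℕ := 0
@[simp] abbrev rGap : ℕ := 1
@[simp] abbrev rThr : ℕ := 2

/-- `e < f` -/
abbrev Test.natLt (e f : NatExpr) : Test := .not (.natLe f e)

abbrev Program.when (b : Test) (p : Program) : Program := .ite b p .skip

/-! ### Adjacency lists -/

/-- Arcs `1, …, E` of a graph on the nodes `< V`, with linked lists of the arcs out of each node;
`R` is the set of the triples (source, target, label). -/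
structure Arcs (V E : ℕ) (src dst lab nxt first : ℕ → ℕ) (R : Set (ℕ × ℕ × ℕ)) : Prop where
  rel : ∀ t, t ∈ R ↔ ∃ e, 1 ≤ e ∧ e ≤ E ∧ t = (src e, dst e, lab e)
  first_le : ∀ v < V, first v ≤ E
  first_max : ∀ v < V, ∀ e, first v < e → e ≤ E → src e ≠ v
  first_src : ∀ v < V, first v ≠ 0 → src (first v) = v
  nxt_lt : ∀ e, 1 ≤ e → e ≤ E → nxt e < e
  nxt_max : ∀ e, 1 ≤ e → e ≤ E → ∀ e', nxt e < e' → e' < e → src e' ≠ src e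
  nxt_src : ∀ e, 1 ≤ e → e ≤ E → nxt e ≠ 0 → src (nxt e) = src e

/-- The new arc receives the largest number and becomes the head of the list of its source. Hence
every list runs through decreasing numbers, and `0` can mark its end. -/
theorem Arcs.push {V E : ℕ} {src dst lab nxt first : ℕ → ℕ} {R : Set (ℕ × ℕ × ℕ)}
    (h : Arcs V E src dst lab nxt first R) {a : ℕ} (ha : a < V) (b x : ℕ) :
    Arcs V (E + 1) (Function.update src (E + 1) a) (Function.update dst (E + 1) b)
      (Function.update lab (E + 1) x) (Function.update nxt (E + 1) (first a))
      (Function.update first a (E + 1)) (insert (a, b, x) R) := by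
  have hfa := h.first_le a ha
  refine ⟨fun t => ?_, fun v hv => ?_, fun v hv e he hE => ?_, fun v hv h0 => ?_,
    fun e h1 hE => ?_, fun e h1 hE e' he' hlt => ?_, fun e h1 hE h0 => ?_⟩
  · rw [Set.mem_insert_iff, h.rel]
    constructor
    · rintro (rfl | ⟨e, h1, hE, rfl⟩)
      · exact ⟨E + 1, by omega, le_rfl, by simp⟩
      · refine ⟨e, h1, by omega, ?_⟩
        simp [show e ≠ E + 1 by omega]
    · rintro ⟨e, h1, hE, rfl⟩
      by_cases he : e = E + 1
      · left; simp [he]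
      · right
        refine ⟨e, h1, by omega, ?_⟩
        simp [he]
  · rw [Function.update_apply]
    have := h.first_le v hv
    split_ifs <;> omega
  · rw [Function.update_apply] at he
    split_ifs at he with hva
    · omega
    · by_cases hee : e = E + 1
      · subst hee; simpa using fun h => hva h.symm
      · rw [Function.update_of_ne hee]
        exact h.first_max v hv e he (by omega)
  · rw [Function.update_apply first] at h0 ⊢
    split_ifs at h0 ⊢ with hva
    · simp [hva]
    · have := h.first_le v hv
      rw [Function.update_of_ne (by omega)]
      exact h.first_src v hv h0
  · rw [Function.update_apply]
    split_ifs with hee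
    · omega
    · exact h.nxt_lt e h1 (by omega)
  · rw [Function.update_apply nxt] at he'
    by_cases hee : e = E + 1
    · rw [if_pos hee] at he'
      subst hee
      rw [Function.update_of_ne (by omega), Function.update_self]
      exact h.first_max a ha e' he' (by omega)
    · rw [if_neg hee] at he'
      rw [Function.update_of_ne (by omega), Function.update_of_ne hee]
      exact h.nxt_max e h1 (by omega) e' he' hlt
  · rw [Function.update_apply nxt] at h0 ⊢
    by_cases hee : e = E + 1
    · rw [if_pos hee] at h0 ⊢
      subst hee
      rw [Function.update_of_ne (by omega), Function.update_self]
      exact h.first_src a ha h0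
    · rw [if_neg hee] at h0 ⊢
      have := h.nxt_lt e h1 (by omega)
      rw [Function.update_of_ne (by omega), Function.update_of_ne hee]
      exact h.nxt_src e h1 (by omega) h0

/-- The graph stored in the memory. -/
def HasArcs (V : ℕ) (s : State) (R : Set (ℕ × ℕ × ℕ)) : Prop :=
  Arcs V (s.nat vE) (s.natArr aSrc) (s.natArr aDst) (s.natArr aLab) (s.natArr aNxt)
    (s.natArr aFirst) R

/-- Adds the arc held in the variables `vsrc`, `vdst`, `vlab`. -/
def pushArc : Program :=
  .setNat vE (.plus (.var vE) (.lit 1)) ;;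
  .putNat aSrc (.var vE) (.var vsrc) ;;
  .putNat aDst (.var vE) (.var vdst) ;;
  .putNat aLab (.var vE) (.var vlab) ;;
  .putNat aNxt (.var vE) (.get aFirst (.var vsrc)) ;;
  .putNat aFirst (.var vsrc) (.var vE)

theorem HasArcs.push {V : ℕ} {s : State} {R : Set (ℕ × ℕ × ℕ)} (h : HasArcs V s R)
    (ha : s.nat vsrc < V) (D : ℕ → ℕ → ℝ) :
    HasArcs V (pushArc.run D s) (insert (s.nat vsrc, s.nat vdst, s.nat vlab) R) ∧
      (pushArc.run D s).nat vE = s.nat vE + 1 := by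
  have := Arcs.push h ha (s.nat vdst) (s.nat vlab)
  simpa [HasArcs, pushArc] using this

/-- The triples `f x` for the `x < i` that satisfy `P`. -/
def tripleSet (P : ℕ → Prop) (f : ℕ → ℕ × ℕ × ℕ) (i : ℕ) : Set (ℕ × ℕ × ℕ) :=
  {t | ∃ x < i, P x ∧ t = f x}

theorem tripleSet_zero (P : ℕ → Prop) (f : ℕ → ℕ × ℕ × ℕ) : tripleSet P f 0 = ∅ := by
  simp [tripleSet]

theorem tripleSet_succ_pos {P : ℕ → Prop} {i : ℕ} (h : P i) (f : ℕ → ℕ × ℕ × ℕ) :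
    tripleSet P f (i + 1) = insert (f i) (tripleSet P f i) := by
  ext t
  simp only [tripleSet, Set.mem_ofPred_eq, Set.mem_insert_iff, Nat.lt_succ_iff_lt_or_eq]
  constructor
  · rintro ⟨x, hx | rfl, hP, rfl⟩
    · exact Or.inr ⟨x, hx, hP, rfl⟩
    · exact Or.inl rfl
  · rintro (rfl | ⟨x, hx, hP, rfl⟩)
    · exact ⟨i, Or.inr rfl, h, rfl⟩
    · exact ⟨x, Or.inl hx, hP, rfl⟩

theorem tripleSet_succ_neg {P : ℕ → Prop} {i : ℕ} (h : ¬ P i) (f : ℕ → ℕ × ℕ × ℕ) :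
    tripleSet P f (i + 1) = tripleSet P f i := by
  ext t
  simp only [tripleSet, Set.mem_ofPred_eq, Nat.lt_succ_iff_lt_or_eq]
  constructor
  · rintro ⟨x, hx | rfl, hP, rfl⟩
    · exact ⟨x, hx, hP, rfl⟩
    · exact absurd hP h
  · rintro ⟨x, hx, hP, rfl⟩
    exact ⟨x, Or.inl hx, hP, rfl⟩

/-- For all `x < e` that pass the test, adds the arc from `a` to `b` with label `y`. -/
def pushLoop (e : NatExpr) (t : Test) (a b y : NatExpr) : Program :=
  forUp vx e (.when t (.setNat vsrc a ;; .setNat vdst b ;; .setNat vlab y ;; pushArc))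

theorem pushLoop_runs {D : ℕ → ℕ → ℝ} {e a b y : NatExpr} {t : Test} {s : State} {V Nb T : ℕ}
    {R : Set (ℕ × ℕ × ℕ)} (P : ℕ → Prop) (f : ℕ → ℕ × ℕ × ℕ) (h : HasArcs V s R)
    (he : ∀ s', Same (pushLoop e t a b y) s s' → e.eval s' = Nb)
    (ht : ∀ s', Same (pushLoop e t a b y) s s' → s'.nat vx < Nb → (t.Holds D s' ↔ P (s'.nat vx)))
    (ha : ∀ s', Same (pushLoop e t a b y) s s' → s'.nat vx < Nb → P (s'.nat vx) →
      a.eval s' = (f (s'.nat vx)).1 ∧ b.eval s' = (f (s'.nat vx)).2.1 ∧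
        y.eval s' = (f (s'.nat vx)).2.2 ∧ a.eval s' < V)
    (hT : Nb * (t.cost + a.cost + b.cost + y.cost + e.cost + 40) + e.cost + 8 ≤ T) :
    Runs D (pushLoop e t a b y) s (fun s' => HasArcs V s' (R ∪ tripleSet P f Nb) ∧
      s'.nat vE ≤ s.nat vE + Nb) T := by
  refine Runs.forUp Nb (fun i s' => HasArcs V s' (R ∪ tripleSet P f i) ∧
    s'.nat vE ≤ s.nat vE + i) rfl he ?_ ?_ (c := t.cost + a.cost + b.cost + y.cost + 27)
    (le_trans ?_ hT)
  · simp only [tripleSet_zero, Set.union_empty]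
    exact ⟨h, by simp⟩
  · rintro i s' hi hs rfl ⟨hA, hE⟩
    refine Runs.ite (T₁ := a.cost + b.cost + y.cost + 25) (T₂ := 1) (fun hb => ?_) (fun hb => ?_)
      (by omega)
    · have hP := (ht s' hs hi).1 hb
      -- Target and label are evaluated after `vsrc` and `vdst` have been assigned. The hypothesis
      -- `ha` still applies, because these variables are among those the loop writes.
      have hs1 : ∀ w, Same (pushLoop e t a b y) s' (s'.setNat vsrc w) := fun w => by
        refine ⟨fun z hz => ?_, fun _ _ => rfl, fun _ _ => rfl⟩
        have : z ≠ vsrc := by rintro rfl; simp [pushLoop, forUp, Program.wNat] at hz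
        simp [this]
      have hs2 : ∀ s' w, Same (pushLoop e t a b y) s' (s'.setNat vdst w) := fun s' w => by
        refine ⟨fun z hz => ?_, fun _ _ => rfl, fun _ _ => rfl⟩
        have : z ≠ vdst := by rintro rfl; simp [pushLoop, forUp, Program.wNat] at hz
        simp [this]
      obtain ⟨h1, h2, h3, h4⟩ := ha s' hs hi hP
      obtain ⟨-, h5, -, -⟩ := ha (s'.setNat vsrc (a.eval s')) (hs.trans (hs1 _))
        (by simpa using hi) (by simpa using hP)
      obtain ⟨-, -, h6, -⟩ := ha ((s'.setNat vsrc (a.eval s')).setNat vdst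
        (b.eval (s'.setNat vsrc (a.eval s')))) ((hs.trans (hs1 _)).trans (hs2 _ _))
        (by simpa using hi) (by simpa using hP)
      refine Runs.straight rfl ?_ (by simp [Program.size, pushArc, NatExpr.cost]; omega)
      simp only [Program.run]
      rw [h6, h5, h1]
      set s₁ := ((s'.setNat vsrc (f (s'.nat vx)).1).setNat vdst (f (s'.nat vx)).2.1).setNat vlab
        (f (s'.nat vx)).2.2 with hs₁
      have hA₁ : HasArcs V s₁ (R ∪ tripleSet P f (s'.nat vx)) := by
        simpa [HasArcs, hs₁] using hA
      have hv : (((s'.setNat vsrc (f (s'.nat vx)).1).setNat vdst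
        (f ((s'.setNat vsrc (f (s'.nat vx)).1).nat vx)).2.1).setNat vlab
        (f (((s'.setNat vsrc (f (s'.nat vx)).1).setNat vdst
        (f ((s'.setNat vsrc (f (s'.nat vx)).1).nat vx)).2.1).nat vx)).2.2) = s₁ := by
        simp [hs₁]
      rw [hv]
      obtain ⟨hA₂, hE₂⟩ := hA₁.push (by simpa [hs₁, ← h1] using h4) D
      have hf : (s₁.nat vsrc, s₁.nat vdst, s₁.nat vlab) = f (s'.nat vx) := by simp [hs₁]
      rw [hf, ← Set.union_insert, ← tripleSet_succ_pos hP] at hA₂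
      refine ⟨by simpa [HasArcs] using hA₂, ?_⟩
      have : s₁.nat vE = s'.nat vE := by simp [hs₁]
      simp only [State.nat_setNat] at hE₂ ⊢
      simp only [vE, vx] at hE hE₂ this ⊢
      norm_num
      omega
    · have hP := fun h => hb ((ht s' hs hi).2 h)
      refine Runs.straight rfl ?_ (by simp [Program.size])
      rw [tripleSet_succ_neg hP]
      refine ⟨by simpa [HasArcs] using hA, ?_⟩
      simp at hE ⊢
      omega
  · refine Nat.add_le_add_right (Nat.add_le_add_right (Nat.mul_le_mul_left _ ?_) _) _
    omega


/-! ### Building the residual graph -/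

/-- The matching problem stored in the memory. -/
def net (s : State) : Network where
  n := s.nat vn
  m := s.nat vm
  p := s.nat vp
  F := s.nat vF
  grp := s.natArr aGrp
  l := s.natArr aL
  u := s.natArr aU
  act := s.natArr aAct

theorem Same.net {P : Program} {s s' : State} (h : Same P s s') (h0 : P.wNat vn = false)
    (h1 : P.wNat vm = false) (h2 : P.wNat vp = false) (h3 : P.wNat vF = false)
    (h4 : P.wNatArr aGrp = false) (h5 : P.wNatArr aL = false) (h6 : P.wNatArr aU = false)
    (h7 : P.wNatArr aAct = false) : net s' = net s := by
  simp only [FairKCenter.net, h.nat _ h0, h.nat _ h1, h.nat _ h2, h.nat _ h3, h.natArr _ h4,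
    h.natArr _ h5, h.natArr _ h6, h.natArr _ h7]

/-- The bounds `k ≤ n` and `m ≤ n` keep the residual graph at `O(n)` nodes and arcs, so one search
costs `O(n)`. -/
structure Sane (N : Network) (k : ℕ) : Prop where
  p_le : N.p ≤ k
  k_pos : 1 ≤ k
  k_le : k ≤ N.n
  m_le : N.m ≤ N.n
  grp_lt : ∀ x < N.n, N.grp x < N.m
  l_le_u : ∀ g < N.m, N.l g ≤ N.u g

def countGroups : Program :=
  forUp vx (.var vm) (.putNat aCnt (.var vx) (.lit 0)) ;;
  forUp vx (.var vp) (.when (.natLt (.get aM (.var vx)) (.var vn))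
    (.putNat aCnt (.get aGrp (.get aM (.var vx)))
      (.plus (.get aCnt (.get aGrp (.get aM (.var vx)))) (.lit 1)))) ;;
  .setNat vexc (.lit 0) ;;
  forUp vx (.var vm) (.setNat vexc
    (.plus (.var vexc) (.minus (.get aCnt (.var vx)) (.get aL (.var vx)))))

theorem countGroups_runs {D : ℕ → ℕ → ℝ} {s : State} {N : Network} {M : ℕ → ℕ} {k T : ℕ}
    (hN : net s = N) (hM : s.natArr aM = M) (hs : Sane N k)
    (hT : 100 * N.n ≤ T) :
    Runs D countGroups s (fun s' => (∀ g < N.m, s'.natArr aCnt g = N.cnt M g) ∧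
      s'.nat vexc = N.exc (N.cnt M)) T := by
  have hn : 1 ≤ N.n := hs.k_pos.trans hs.k_le
  have hpn : N.p ≤ N.n := hs.p_le.trans hs.k_le
  have hmn := hs.m_le
  unfold countGroups
  refine Runs.seq (T₁ := 22 * N.n) (T₂ := 78 * N.n)
    (Runs.forUp N.m (fun i s' => ∀ g < i, s'.natArr aCnt g = 0) rfl ?_ ?_ ?_ (c := 3) ?_)
    ?_ (by omega)
  · intro s' h
    have := h.net rfl rfl rfl rfl rfl rfl rfl rfl
    exact congrArg Network.m (this.trans hN)
  · simp
  · intro i s' hi h hx hI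
    refine Runs.straight rfl ?_ (by simp [Program.size, NatExpr.cost])
    intro g hg
    simp only [vx] at hx
    simp [Function.update_apply, hx]
    intro hne
    exact hI g (by omega)
  · simp only [NatExpr.cost]; omega
  intro s1 h1 hI1
  have hN1 : net s1 = N := (h1.net rfl rfl rfl rfl rfl rfl rfl rfl).trans hN
  have hM1 : s1.natArr aM = M := (h1.natArr _ rfl).trans hM
  refine Runs.seq (T₁ := 40 * N.n) (T₂ := 38 * N.n)
    (Runs.forUp N.p (fun i s' => ∀ g < N.m, s'.natArr aCnt g = ((Finset.range i).filter
      fun j => M j < N.n ∧ N.grp (M j) = g).card) rfl ?_ ?_ ?_ (c := 20) ?_) ?_ (by omega)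
  · intro s' h
    have := h.net rfl rfl rfl rfl rfl rfl rfl rfl
    exact congrArg Network.p (this.trans hN1)
  · simpa using hI1
  · intro i s' hi h hx hI
    have hN' : net s' = N := (h.net rfl rfl rfl rfl rfl rfl rfl rfl).trans hN1
    have hM' : s'.natArr aM = M := (h.natArr _ rfl).trans hM1
    refine Runs.straight rfl ?_ (by simp [Program.size, NatExpr.cost, Test.cost])
    intro g hg
    have hcard : ((Finset.range (i + 1)).filter fun j => M j < N.n ∧ N.grp (M j) = g).card =
        ((Finset.range i).filter fun j => M j < N.n ∧ N.grp (M j) = g).card +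
        if M i < N.n ∧ N.grp (M i) = g then 1 else 0 := by
      rw [Finset.range_add_one, Finset.filter_insert]
      split_ifs
      · rw [Finset.card_insert_of_notMem (by simp)]
      · rfl
    rw [hcard, ← hI g hg]
    have hact : s'.natArr 8 = M := hM'
    have hgrp : s'.natArr 0 = N.grp := congrArg Network.grp hN'
    have hnn : s'.nat 0 = N.n := congrArg Network.n hN'
    simp only [vx] at hx
    by_cases hMi : M i < N.n
    · by_cases hgi : N.grp (M i) = g
      · simp [hx, hact, hgrp, hnn, hMi, hgi]
      · simp [hx, hact, hgrp, hnn, hMi, hgi, Ne.symm hgi]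
    · simp [hx, hact, hnn, hMi]
  · simp only [NatExpr.cost]; omega
  intro s2 h2 hI2
  have hN2 : net s2 = N := (h2.net rfl rfl rfl rfl rfl rfl rfl rfl).trans hN1
  refine Runs.straight_seq (T₂ := 36 * N.n) rfl ?_ (by simp [Program.size, NatExpr.cost]; omega)
  refine Runs.mono (Runs.forUp N.m (fun i s' => s'.nat vexc =
    ∑ g ∈ Finset.range i, (N.cnt M g - N.l g)) rfl ?_ ?_ ?_ (c := 10) ?_) ?_ le_rfl
  · intro s' h
    have := h.net rfl rfl rfl rfl rfl rfl rfl rfl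
    exact congrArg Network.m hN2 ▸ congrArg Network.m this
  · simp
  · intro i s' hi h hx hI
    refine Runs.straight rfl ?_ (by simp [Program.size, NatExpr.cost])
    have hc : s'.natArr aCnt i = N.cnt M i := by
      rw [h.natArr _ rfl]
      exact hI2 i hi
    have hl : s'.natArr 1 = N.l := (h.natArr 1 rfl).trans (congrArg Network.l hN2)
    simp only [vx, aCnt, vexc] at hx hc hI
    rw [Finset.sum_range_succ, ← hI]
    simp [hx, hc, hl]
  · simp only [NatExpr.cost]; omega
  intro s' h hI
  refine ⟨fun g hg => ?_, hI⟩
  rw [h.natArr _ rfl]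
  exact hI2 g hg

/-- Builds the residual graph of the current matching. -/
def buildGraph : Program :=
  .setNat vE (.lit 0) ;;
  forUp vx (.plus (.plus (.var vk) (.var vm)) (.lit 2)) (.putNat aFirst (.var vx) (.lit 0)) ;;
  pushLoop (.var vn) (.natLt (.get aAct (.var vx)) (.var vp)) (.get aAct (.var vx))
    (.plus (.var vk) (.get aGrp (.var vx))) (.var vx) ;;
  pushLoop (.var vp) (.natLt (.get aM (.var vx)) (.var vn))
    (.plus (.var vk) (.get aGrp (.get aM (.var vx)))) (.var vx) (.lit 0) ;;
  pushLoop (.var vm) (.natLt (.get aCnt (.var vx)) (.get aU (.var vx)))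
    (.plus (.var vk) (.var vx)) (.plus (.var vk) (.var vm)) (.lit 0) ;;
  pushLoop (.var vm) (.natLt (.get aL (.var vx)) (.get aCnt (.var vx)))
    (.plus (.var vk) (.var vm)) (.plus (.var vk) (.var vx)) (.lit 0) ;;
  pushLoop (.var vm) (.natLt (.get aCnt (.var vx)) (.get aL (.var vx)))
    (.plus (.var vk) (.var vx)) (.plus (.plus (.var vk) (.var vm)) (.lit 1)) (.lit 0) ;;
  pushLoop (.lit 1) (.natLt (.var vexc) (.var vF))
    (.plus (.var vk) (.var vm)) (.plus (.plus (.var vk) (.var vm)) (.lit 1)) (.lit 0)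

/-- The arcs of the residual graph as a set of triples. -/
def resSet (N : Network) (k : ℕ) (M : ℕ → ℕ) : Set (ℕ × ℕ × ℕ) :=
  {t | N.Res k M t.1 t.2.1 t.2.2}

/-- The unions are nested in the order in which `buildGraph` pushes the six families of arcs. -/
theorem resSet_eq (N : Network) (k : ℕ) (M : ℕ → ℕ) : resSet N k M =
    ((((((∅ : Set (ℕ × ℕ × ℕ)) ∪
      tripleSet (fun x => N.act x < N.p) (fun x => (N.act x, k + N.grp x, x)) N.n) ∪
      tripleSet (fun j => M j < N.n) (fun j => (k + N.grp (M j), j, 0)) N.p) ∪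
      tripleSet (fun g => N.cnt M g < N.u g) (fun g => (k + g, k + N.m, 0)) N.m) ∪
      tripleSet (fun g => N.l g < N.cnt M g) (fun g => (k + N.m, k + g, 0)) N.m) ∪
      tripleSet (fun g => N.cnt M g < N.l g) (fun g => (k + g, k + N.m + 1, 0)) N.m) ∪
      tripleSet (fun _ => N.exc (N.cnt M) < N.F) (fun _ => (k + N.m, k + N.m + 1, 0)) 1 := by
  ext ⟨a, b, x⟩
  simp only [resSet, tripleSet, Set.mem_union, Set.mem_ofPred_eq, Set.empty_union, Prod.mk.injEq]
  constructor
  · intro h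
    cases h with
    | point hx ha => exact Or.inl (Or.inl (Or.inl (Or.inl (Or.inl ⟨x, hx, ha, rfl, rfl, rfl⟩))))
    | back hj hM => exact Or.inl (Or.inl (Or.inl (Or.inl (Or.inr ⟨_, hj, hM, rfl, rfl, rfl⟩))))
    | toPool hg h => exact Or.inl (Or.inl (Or.inl (Or.inr ⟨_, hg, h, rfl, rfl, rfl⟩)))
    | ofPool hg h => exact Or.inl (Or.inl (Or.inr ⟨_, hg, h, rfl, rfl, rfl⟩))
    | toSink hg h => exact Or.inl (Or.inr ⟨_, hg, h, rfl, rfl, rfl⟩)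
    | poolSink h => exact Or.inr ⟨0, one_pos, h, rfl, rfl, rfl⟩
  · rintro (((((⟨x, hx, ha, rfl, rfl, rfl⟩ | ⟨j, hj, hM, rfl, rfl, rfl⟩) |
      ⟨g, hg, h, rfl, rfl, rfl⟩) | ⟨g, hg, h, rfl, rfl, rfl⟩) | ⟨g, hg, h, rfl, rfl, rfl⟩) |
      ⟨g, hg, h, rfl, rfl, rfl⟩)
    · exact .point hx ha
    · exact .back hj hM
    · exact .toPool hg h
    · exact .ofPool hg h
    · exact .toSink hg h
    · exact .poolSink h

theorem buildGraph_runs {D : ℕ → ℕ → ℝ} {s : State} {N : Network} {M : ℕ → ℕ} {k T : ℕ}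
    (hN : net s = N) (hM : s.natArr aM = M) (hk : s.nat vk = k) (hs : Sane N k)
    (hcnt : ∀ g < N.m, s.natArr aCnt g = N.cnt M g) (hexc : s.nat vexc = N.exc (N.cnt M))
    (hT : 600 * N.n ≤ T) :
    Runs D buildGraph s (fun s' => HasArcs (k + N.m + 2) s' (resSet N k M) ∧
      s'.nat vE ≤ 6 * N.n) T := by
  have hn : 1 ≤ N.n := hs.k_pos.trans hs.k_le
  have hpn : N.p ≤ N.n := hs.p_le.trans hs.k_le
  have hmn := hs.m_le
  have hkn := hs.k_le
  have hpk := hs.p_le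
  have hgrp := hs.grp_lt
  unfold buildGraph
  rw [resSet_eq]
  refine Runs.straight_seq (T₂ := 590 * N.n) rfl ?_ (by simp [Program.size, NatExpr.cost]; omega)
  -- the invariant part of the state
  let Z : State → Prop := fun s' => net s' = N ∧ s'.natArr aM = M ∧ s'.nat vk = k ∧
    (∀ g < N.m, s'.natArr aCnt g = N.cnt M g) ∧ s'.nat vexc = N.exc (N.cnt M)
  have hZ : ∀ {P : Program} {s s' : State}, Same P s s' → Z s → P.wNat vn = false →
      P.wNat vm = false → P.wNat vp = false → P.wNat vF = false → P.wNat vk = false →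
      P.wNat vexc = false → P.wNatArr aGrp = false → P.wNatArr aL = false →
      P.wNatArr aU = false → P.wNatArr aAct = false → P.wNatArr aM = false →
      P.wNatArr aCnt = false → Z s' := by
    intro P s s' h ⟨z1, z2, z3, z4, z5⟩ h1 h2 h3 h4 h5 h6 h7 h8 h9 h10 h11 h12
    refine ⟨(h.net h1 h2 h3 h4 h7 h8 h9 h10).trans z1, (h.natArr _ h11).trans z2,
      (h.nat _ h5).trans z3, fun g hg => ?_, (h.nat _ h6).trans z5⟩
    rw [h.natArr _ h12]
    exact z4 g hg
  have hZ0 : Z ((Program.setNat vE (.lit 0)).run D s) :=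
    ⟨hN, hM, by simpa using hk, hcnt, by simpa using hexc⟩
  have hE0 : ((Program.setNat vE (.lit 0)).run D s).nat vE = 0 := by simp
  generalize (Program.setNat vE (.lit 0)).run D s = s0 at hZ0 hE0
  refine Runs.seq (T₁ := 100 * N.n) (T₂ := 490 * N.n)
    (Runs.forUp (k + N.m + 2) (fun i s' => ∀ g < i, s'.natArr aFirst g = 0) rfl ?_ ?_ ?_
      (c := 3) ?_) ?_ (by omega)
  · intro s' h
    obtain ⟨rfl, -, rfl, -⟩ := hZ h hZ0 rfl rfl rfl rfl rfl rfl rfl rfl rfl rfl rfl rfl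
    simp [net]
  · simp
  · intro i s' hi h hx hI
    refine Runs.straight rfl ?_ (by simp [Program.size, NatExpr.cost])
    intro g hg
    simp only [vx] at hx
    simp [Function.update_apply, hx]
    intro hne
    exact hI g (by omega)
  · simp only [NatExpr.cost]; omega
  intro s1 h1 hF1
  have hZ1 := hZ h1 hZ0 rfl rfl rfl rfl rfl rfl rfl rfl rfl rfl rfl rfl
  have hE1 : s1.nat vE = 0 := (h1.nat _ rfl).trans hE0
  have hA1 : HasArcs (k + N.m + 2) s1 ∅ := by
    refine ⟨fun t => ?_, fun v hv => ?_, fun v hv e he hE => ?_, fun v hv h0 => ?_,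
      fun e h1 hE => ?_, fun e h1 hE e' he' hlt => ?_, fun e h1 hE h0 => ?_⟩
    · simp only [Set.mem_empty_iff_false, false_iff, not_exists]
      omega
    · rw [hF1 v hv]; omega
    · omega
    · exact absurd (hF1 v hv) h0
    all_goals omega
  refine Runs.seq (T₁ := 80 * N.n) (T₂ := 410 * N.n) (pushLoop_runs (Nb := N.n)
    (fun x => N.act x < N.p) (fun x => (N.act x, k + N.grp x, x)) hA1 ?_ ?_ ?_ ?_) ?_ (by omega)
  · intro s' h
    obtain ⟨rfl, -⟩ := hZ h hZ1 rfl rfl rfl rfl rfl rfl rfl rfl rfl rfl rfl rfl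
    simp [net]
  · intro s' h hlt
    obtain ⟨rfl, -⟩ := hZ h hZ1 rfl rfl rfl rfl rfl rfl rfl rfl rfl rfl rfl rfl
    simp [net]
  · intro s' h hlt hP
    obtain ⟨rfl, -, rfl, -⟩ := hZ h hZ1 rfl rfl rfl rfl rfl rfl rfl rfl rfl rfl rfl rfl
    simp [net] at hP hpk ⊢
    omega
  · simp only [NatExpr.cost, Test.cost]; omega
  intro s2 h2 ⟨hA2, hE2⟩
  have hZ2 := hZ h2 hZ1 rfl rfl rfl rfl rfl rfl rfl rfl rfl rfl rfl rfl
  refine Runs.seq (T₁ := 80 * N.n) (T₂ := 330 * N.n) (pushLoop_runs (Nb := N.p)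
    (fun j => M j < N.n) (fun j => (k + N.grp (M j), j, 0)) hA2 ?_ ?_ ?_ ?_) ?_ (by omega)
  · intro s' h
    obtain ⟨rfl, -⟩ := hZ h hZ2 rfl rfl rfl rfl rfl rfl rfl rfl rfl rfl rfl rfl
    simp [net]
  · intro s' h hlt
    obtain ⟨rfl, rfl, -⟩ := hZ h hZ2 rfl rfl rfl rfl rfl rfl rfl rfl rfl rfl rfl rfl
    simp [net]
  · intro s' h hlt hP
    obtain ⟨rfl, rfl, rfl, -⟩ := hZ h hZ2 rfl rfl rfl rfl rfl rfl rfl rfl rfl rfl rfl rfl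
    have := hgrp _ hP
    simp [net] at this ⊢
    omega
  · simp only [NatExpr.cost, Test.cost]; omega
  intro s3 h3 ⟨hA3, hE3⟩
  have hZ3 := hZ h3 hZ2 rfl rfl rfl rfl rfl rfl rfl rfl rfl rfl rfl rfl
  refine Runs.seq (T₁ := 75 * N.n) (T₂ := 255 * N.n) (pushLoop_runs (Nb := N.m)
    (fun g => N.cnt M g < N.u g) (fun g => (k + g, k + N.m, 0)) hA3 ?_ ?_ ?_ ?_) ?_ (by omega)
  · intro s' h
    obtain ⟨rfl, -⟩ := hZ h hZ3 rfl rfl rfl rfl rfl rfl rfl rfl rfl rfl rfl rfl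
    simp [net]
  · intro s' h hlt
    obtain ⟨rfl, -, -, hc, -⟩ := hZ h hZ3 rfl rfl rfl rfl rfl rfl rfl rfl rfl rfl rfl rfl
    rw [← hc _ hlt]
    simp [net]
  · intro s' h hlt hP
    obtain ⟨rfl, -, rfl, -⟩ := hZ h hZ3 rfl rfl rfl rfl rfl rfl rfl rfl rfl rfl rfl rfl
    simp [net] at hlt ⊢
    omega
  · simp only [NatExpr.cost, Test.cost]; omega
  intro s4 h4 ⟨hA4, hE4⟩
  have hZ4 := hZ h4 hZ3 rfl rfl rfl rfl rfl rfl rfl rfl rfl rfl rfl rfl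
  refine Runs.seq (T₁ := 75 * N.n) (T₂ := 180 * N.n) (pushLoop_runs (Nb := N.m)
    (fun g => N.l g < N.cnt M g) (fun g => (k + N.m, k + g, 0)) hA4 ?_ ?_ ?_ ?_) ?_ (by omega)
  · intro s' h
    obtain ⟨rfl, -⟩ := hZ h hZ4 rfl rfl rfl rfl rfl rfl rfl rfl rfl rfl rfl rfl
    simp [net]
  · intro s' h hlt
    obtain ⟨rfl, -, -, hc, -⟩ := hZ h hZ4 rfl rfl rfl rfl rfl rfl rfl rfl rfl rfl rfl rfl
    rw [← hc _ hlt]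
    simp [net]
  · intro s' h hlt hP
    obtain ⟨rfl, -, rfl, -⟩ := hZ h hZ4 rfl rfl rfl rfl rfl rfl rfl rfl rfl rfl rfl rfl
    simp [net]
  · simp only [NatExpr.cost, Test.cost]; omega
  intro s5 h5 ⟨hA5, hE5⟩
  have hZ5 := hZ h5 hZ4 rfl rfl rfl rfl rfl rfl rfl rfl rfl rfl rfl rfl
  refine Runs.seq (T₁ := 80 * N.n) (T₂ := 100 * N.n) (pushLoop_runs (Nb := N.m)
    (fun g => N.cnt M g < N.l g) (fun g => (k + g, k + N.m + 1, 0)) hA5 ?_ ?_ ?_ ?_) ?_ (by omega)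
  · intro s' h
    obtain ⟨rfl, -⟩ := hZ h hZ5 rfl rfl rfl rfl rfl rfl rfl rfl rfl rfl rfl rfl
    simp [net]
  · intro s' h hlt
    obtain ⟨rfl, -, -, hc, -⟩ := hZ h hZ5 rfl rfl rfl rfl rfl rfl rfl rfl rfl rfl rfl rfl
    rw [← hc _ hlt]
    simp [net]
  · intro s' h hlt hP
    obtain ⟨rfl, -, rfl, -⟩ := hZ h hZ5 rfl rfl rfl rfl rfl rfl rfl rfl rfl rfl rfl rfl
    simp [net] at hlt ⊢
    omega
  · simp only [NatExpr.cost, Test.cost]; omega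
  intro s6 h6 ⟨hA6, hE6⟩
  have hZ6 := hZ h6 hZ5 rfl rfl rfl rfl rfl rfl rfl rfl rfl rfl rfl rfl
  refine Runs.mono (pushLoop_runs (Nb := 1) (fun _ => N.exc (N.cnt M) < N.F)
    (fun _ => (k + N.m, k + N.m + 1, 0)) hA6 ?_ ?_ ?_ le_rfl) ?_ ?_
  · intro s' h
    simp
  · intro s' h hlt
    obtain ⟨rfl, -, -, -, hc⟩ := hZ h hZ6 rfl rfl rfl rfl rfl rfl rfl rfl rfl rfl rfl rfl
    rw [← hc]
    simp [net]
  · intro s' h hlt hP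
    obtain ⟨rfl, -, rfl, -⟩ := hZ h hZ6 rfl rfl rfl rfl rfl rfl rfl rfl rfl rfl rfl rfl
    simp [net]
  · intro s' h ⟨hA, hE⟩
    refine ⟨hA, ?_⟩
    omega
  · simp only [NatExpr.cost, Test.cost]; omega


/-! ### Graph search -/

/-- The state of a breadth-first search from `c`: the queue holds the reached nodes, of which the
first `head` have been taken out; `e` is the next arc of the last of them. -/
structure Search (V E c : ℕ) (src dst : ℕ → ℕ) (queue reach par : ℕ → ℕ) (head tail e : ℕ) :
    Prop where
  root : queue 0 = c
  tail_pos : 0 < tail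
  head_le : head ≤ tail
  inj : ∀ i j, i < tail → j < tail → queue i = queue j → i = j
  lt : ∀ i < tail, queue i < V
  mark : ∀ v < V, reach v ≠ 0 ↔ ∃ i < tail, queue i = v
  parent : ∀ i, 0 < i → i < tail → 1 ≤ par (queue i) ∧ par (queue i) ≤ E ∧
    dst (par (queue i)) = queue i ∧ ∃ j < i, queue j = src (par (queue i))
  arc_le : e ≤ E
  arc_src : e ≠ 0 → 1 ≤ head ∧ src e = queue (head - 1)
  done : ∀ i < head, ∀ e', 1 ≤ e' → e' ≤ E → src e' = queue i →
    (i + 1 = head ∧ e' ≤ e) ∨ reach (dst e') ≠ 0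

open Classical in
/-- The arcs that have not been looked at. -/
noncomputable def todo (E : ℕ) (src queue : ℕ → ℕ) (head e : ℕ) : Finset ℕ :=
  (Finset.Icc 1 E).filter fun e' => (∀ i < head, queue i ≠ src e') ∨
    (1 ≤ head ∧ src e' = queue (head - 1) ∧ e' ≤ e)

/-- The queue holds distinct nodes; this bounds the number of times a node is taken out. -/
theorem Search.tail_le {V E c : ℕ} {src dst queue reach par : ℕ → ℕ} {head tail e : ℕ}
    (h : Search V E c src dst queue reach par head tail e) : tail ≤ V := by
  have := Finset.card_le_card_of_injOn (s := Finset.range tail) (t := Finset.range V) queue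
    (fun i hi => by simpa using h.lt i (by simpa using hi))
    (fun i hi j hj hij => h.inj i j (by simpa using hi) (by simpa using hj) hij)
  simpa using this

section

variable {V E c : ℕ} {src dst lab nxt first queue reach par : ℕ → ℕ} {head tail e : ℕ}
  {R : Set (ℕ × ℕ × ℕ)}

/-- Numbers strictly between `nxt e` and `e` belong to arcs with other sources. Moving on therefore
removes only `e` from the pending arcs of the node, and `e` leads to a reached node. -/
theorem Search.skipArc (h : Search V E c src dst queue reach par head tail e)
    (hA : Arcs V E src dst lab nxt first R) (he : e ≠ 0) (hr : reach (dst e) ≠ 0) :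
    Search V E c src dst queue reach par head tail (nxt e) := by
  have hlt := hA.nxt_lt e (by omega) h.arc_le
  have hle := h.arc_le
  obtain ⟨h1, h2⟩ := h.arc_src he
  refine ⟨h.root, h.tail_pos, h.head_le, h.inj, h.lt, h.mark, h.parent, by omega,
    fun h0 => ⟨h1, ?_⟩, fun i hi e' he1 heE hs => ?_⟩
  · rw [hA.nxt_src e (by omega) hle h0, h2]
  · rcases h.done i hi e' he1 heE hs with ⟨hih, hee⟩ | hd
    · rcases lt_or_eq_of_le hee with hlt' | rfl
      · left
        refine ⟨hih, ?_⟩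
        by_contra! hn
        refine hA.nxt_max e (by omega) hle e' hn hlt' ?_
        rw [hs, h2]
        congr 1
        omega
      · exact Or.inr hr
    · exact Or.inr hd

/-- The arc `e` stays current. Its target is now marked, so `Search.skipArc` can move past it. -/
theorem Search.newNode (h : Search V E c src dst queue reach par head tail e)
    (he : e ≠ 0) (hd : dst e < V) (hr : reach (dst e) = 0) :
    Search V E c src dst (Function.update queue tail (dst e)) (Function.update reach (dst e) 1)
      (Function.update par (dst e) e) head (tail + 1) e := by
  have hq : ∀ i < tail, Function.update queue tail (dst e) i = queue i := fun i hi =>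
    Function.update_of_ne (by omega) _ _
  have hne : ∀ i < tail, queue i ≠ dst e := fun i hi hqe =>
    (h.mark _ hd).2 ⟨i, hi, hqe⟩ hr
  obtain ⟨h1, h2⟩ := h.arc_src he
  have hht := h.head_le
  have hle := h.arc_le
  refine ⟨?_, by omega, by omega, fun i j hi hj hij => ?_, fun i hi => ?_, fun v hv => ?_,
    fun i h0 hi => ?_, hle, fun _ => ⟨h1, ?_⟩, fun i hi e' he1 heE hs => ?_⟩
  · rw [hq 0 h.tail_pos, h.root]
  · rcases Nat.lt_succ_iff_lt_or_eq.1 hi with hi' | rfl <;>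
      rcases Nat.lt_succ_iff_lt_or_eq.1 hj with hj' | rfl
    · rw [hq i hi', hq j hj'] at hij
      exact h.inj i j hi' hj' hij
    · rw [hq i hi', Function.update_self] at hij
      exact absurd hij (hne i hi')
    · rw [hq j hj', Function.update_self] at hij
      exact absurd hij.symm (hne j hj')
    · rfl
  · rcases Nat.lt_succ_iff_lt_or_eq.1 hi with hi' | rfl
    · rw [hq i hi']; exact h.lt i hi'
    · simpa using hd
  · rw [Function.update_apply]
    split_ifs with hvd
    · subst hvd
      simp only [ne_eq, one_ne_zero, not_false_eq_true, true_iff]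
      exact ⟨tail, by omega, by simp⟩
    · rw [h.mark v hv]
      constructor
      · rintro ⟨i, hi, rfl⟩
        exact ⟨i, by omega, hq i hi⟩
      · rintro ⟨i, hi, hqi⟩
        rcases Nat.lt_succ_iff_lt_or_eq.1 hi with hi' | rfl
        · exact ⟨i, hi', (hq i hi').symm.trans hqi⟩
        · rw [Function.update_self] at hqi
          exact absurd hqi.symm hvd
  · rcases Nat.lt_succ_iff_lt_or_eq.1 hi with hi' | rfl
    · rw [hq i hi', Function.update_of_ne (hne i hi')]
      obtain ⟨p1, p2, p3, j, hj, hqj⟩ := h.parent i h0 hi'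
      exact ⟨p1, p2, p3, j, hj, (hq j (by omega)).trans hqj⟩
    · rw [Function.update_self, Function.update_self]
      exact ⟨by omega, hle, rfl, head - 1, by omega, (hq _ (by omega)).trans h2.symm⟩
  · rw [hq _ (by omega), h2]
  · rw [hq i (by omega)] at hs
    rcases h.done i hi e' he1 heE hs with hd | hd
    · exact Or.inl hd
    · right
      rw [Function.update_apply]
      split_ifs <;> simp [hd]

/-- With `e = 0` no arc of the dequeued nodes is pending. The list of the next node is pending in
full, since `first` is the largest number of an arc out of it. -/
theorem Search.pop (h : Search V E c src dst queue reach par head tail 0)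
    (hA : Arcs V E src dst lab nxt first R) (hlt : head < tail) :
    Search V E c src dst queue reach par (head + 1) tail (first (queue head)) := by
  have hV := h.lt head hlt
  refine ⟨h.root, h.tail_pos, hlt, h.inj, h.lt, h.mark, h.parent, hA.first_le _ hV,
    fun h0 => ⟨by omega, by simpa using hA.first_src _ hV h0⟩, fun i hi e' he1 heE hs => ?_⟩
  rcases Nat.lt_succ_iff_lt_or_eq.1 hi with hi' | rfl
  · rcases h.done i hi' e' he1 heE hs with ⟨-, hd⟩ | hd
    · omega
    · exact Or.inr hd
  · left
    refine ⟨rfl, ?_⟩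
    by_contra! hn
    exact hA.first_max _ hV e' hn heE hs

theorem Search.todo_arc (h : Search V E c src dst queue reach par head tail e)
    (hA : Arcs V E src dst lab nxt first R) (he : e ≠ 0) :
    (todo E src queue head (nxt e)).card < (todo E src queue head e).card := by
  classical
  have hlt := hA.nxt_lt e (by omega) h.arc_le
  obtain ⟨h1, h2⟩ := h.arc_src he
  refine Finset.card_lt_card (Finset.ssubset_iff_of_subset ?_ |>.2 ⟨e, ?_, ?_⟩)
  · intro e' he'
    simp only [todo, Finset.mem_filter] at he' ⊢
    refine ⟨he'.1, he'.2.imp_right fun hh => ⟨hh.1, hh.2.1, by omega⟩⟩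
  · simp only [todo, Finset.mem_filter, Finset.mem_Icc]
    exact ⟨⟨by omega, h.arc_le⟩, Or.inr ⟨h1, h2, le_rfl⟩⟩
  · simp only [todo, Finset.mem_filter, not_and, not_or]
    refine fun _ => ⟨fun hh => hh (head - 1) (by omega) h2.symm, fun _ _ => by omega⟩

/-- Arcs of an untouched source merely become pending, so the count does not grow. The strict
progress of this step comes from `head`. -/
theorem Search.todo_pop (h : Search V E c src dst queue reach par head tail 0) (hlt : head < tail)
    (e : ℕ) : (todo E src queue (head + 1) e).card ≤ (todo E src queue head 0).card := by
  classical
  refine Finset.card_le_card fun e' he' => ?_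
  simp only [todo, Finset.mem_filter] at he' ⊢
  refine ⟨he'.1, Or.inl fun i hi hs => ?_⟩
  rcases he'.2 with hh | ⟨-, hh, -⟩
  · exact hh i (by omega) hs
  · rw [← hs] at hh
    have := h.inj i head (by omega) hlt (by simpa using hh)
    omega

theorem todo_congr {queue' : ℕ → ℕ} (h : ∀ i < head, queue' i = queue i) :
    todo E src queue' head e = todo E src queue head e := by
  classical
  refine Finset.filter_congr fun e' _ => ?_
  refine or_congr (forall₂_congr fun i hi => by rw [h i hi])
    (and_congr_right fun h1 => by rw [h (head - 1) (by omega)])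

theorem card_todo_le : (todo E src queue head e).card ≤ E := by
  classical
  exact (Finset.card_filter_le _ _).trans (by simp)

end

/-- The result of a graph search: the set `S` of the nodes reachable from `c`, with a tree. -/
structure SearchTree (V E c : ℕ) (src dst lab reach par : ℕ → ℕ) (R : Set (ℕ × ℕ × ℕ))
    (S : Set ℕ) (pos : ℕ → ℕ) : Prop where
  root : c ∈ S
  lt : ∀ v ∈ S, v < V
  closed : ∀ t ∈ R, t.1 ∈ S → t.2.1 ∈ S
  mark : ∀ v < V, reach v ≠ 0 ↔ v ∈ S
  pos_lt : ∀ v ∈ S, pos v < V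
  parent : ∀ v ∈ S, v ≠ c → (src (par v), v, lab (par v)) ∈ R ∧ src (par v) ∈ S ∧
    pos (src (par v)) < pos v

theorem Search.tree {V E c : ℕ} {src dst lab nxt first queue reach par : ℕ → ℕ} {head tail : ℕ}
    {R : Set (ℕ × ℕ × ℕ)} (h : Search V E c src dst queue reach par head tail 0)
    (hA : Arcs V E src dst lab nxt first R) (hR : ∀ t ∈ R, t.2.1 < V) (hht : tail ≤ head) :
    ∃ S pos, SearchTree V E c src dst lab reach par R S pos := by
  classical
  have hlt := h.tail_le
  have heq : head = tail := le_antisymm h.head_le hht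
  subst heq
  -- The position in the queue: a parent is enqueued before its children, so positions increase
  -- along tree paths.
  let pos : ℕ → ℕ := fun v => if hv : ∃ i < head, queue i = v then hv.choose else 0
  have hpos : ∀ i < head, pos (queue i) = i := by
    intro i hi
    have hv : ∃ j < head, queue j = queue i := ⟨i, hi, rfl⟩
    simp only [pos, dif_pos hv]
    exact h.inj _ _ hv.choose_spec.1 hi hv.choose_spec.2
  refine ⟨{v | ∃ i < head, queue i = v}, pos, ⟨0, h.tail_pos, h.root⟩, ?_, ?_, fun v hv => ?_,
    ?_, ?_⟩
  · rintro v ⟨i, hi, rfl⟩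
    exact h.lt i hi
  · rintro t ht ⟨i, hi, hqi⟩
    have htV := hR t ht
    obtain ⟨e, he1, heE, rfl⟩ := (hA.rel t).1 ht
    rcases h.done i hi e he1 heE hqi.symm with ⟨-, hd⟩ | hd
    · omega
    · exact (h.mark _ htV).1 hd
  · exact h.mark v hv
  · rintro v ⟨i, hi, rfl⟩
    rw [hpos i hi]
    omega
  · rintro v ⟨i, hi, rfl⟩ hc
    have h0 : 0 < i := by
      rcases Nat.eq_zero_or_pos i with rfl | h0
      · exact absurd h.root hc
      · exact h0
    obtain ⟨h1, h2, h3, j, hj, hqj⟩ := h.parent i h0 hi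
    refine ⟨(hA.rel _).2 ⟨_, h1, h2, ?_⟩, ⟨j, by omega, hqj⟩, ?_⟩
    · rw [h3]
    · rw [← hqj, hpos j (by omega), hpos i hi]
      exact hj

/-- Breadth-first search from the node `vc`, on the nodes `< e`. -/
def bfs (e : NatExpr) : Program :=
  forUp vx e (.putNat aReach (.var vx) (.lit 0)) ;;
  (.putNat aReach (.var vc) (.lit 1) ;;
    .putNat aQueue (.lit 0) (.var vc) ;;
    .setNat vhead (.lit 0) ;;
    .setNat vtail (.lit 1) ;;
    .setNat ve (.lit 0)) ;;
  .loop (.or (.natLe (.lit 1) (.var ve)) (.natLt (.var vhead) (.var vtail)))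
    (.ite (.natLe (.lit 1) (.var ve))
      (.when (.natLe (.get aReach (.get aDst (.var ve))) (.lit 0))
        (.putNat aQueue (.var vtail) (.get aDst (.var ve)) ;;
          .setNat vtail (.plus (.var vtail) (.lit 1)) ;;
          .putNat aReach (.get aDst (.var ve)) (.lit 1) ;;
          .putNat aPar (.get aDst (.var ve)) (.var ve)) ;;
        .setNat ve (.get aNxt (.var ve)))
      (.setNat ve (.get aFirst (.get aQueue (.var vhead))) ;;
        .setNat vhead (.plus (.var vhead) (.lit 1))))

def SearchState (V E c : ℕ) (src dst : ℕ → ℕ) (s : State) : Prop :=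
  Search V E c src dst (s.natArr aQueue) (s.natArr aReach) (s.natArr aPar) (s.nat vhead)
    (s.nat vtail) (s.nat ve)

theorem bfs_runs {D : ℕ → ℕ → ℝ} {e : NatExpr} {s : State} {V T : ℕ} {R : Set (ℕ × ℕ × ℕ)}
    (he : ∀ s', Same (bfs e) s s' → e.eval s' = V) (hA : HasArcs V s R)
    (hR : ∀ t ∈ R, t.2.1 < V) (hc : s.nat vc < V)
    (hT : V * (e.cost + 11) + e.cost + (s.nat vE + V) * 50 + 50 ≤ T) :
    Runs D (bfs e) s (fun s' => ∃ S pos, SearchTree V (s.nat vE) (s.nat vc) (s.natArr aSrc)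
      (s.natArr aDst) (s.natArr aLab) (s'.natArr aReach) (s'.natArr aPar) R S pos) T := by
  classical
  refine Runs.seq (T₁ := V * (e.cost + 11) + e.cost + 8) (T₂ := (s.nat vE + V) * 50 + 42)
    (Runs.forUp V (fun i s' => ∀ g < i, s'.natArr aReach g = 0) rfl (fun s' h => he s' h.seq_left)
      ?_ ?_ (c := 3) (by ring_nf; rfl)) ?_ (by omega)
  · simp
  · intro i s' hi h hx hI
    refine Runs.straight rfl ?_ (by simp [Program.size, NatExpr.cost])
    intro g hg
    simp only [vx] at hx
    simp [Function.update_apply, hx]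
    intro hne
    exact hI g (by omega)
  intro s1 h1 hF1
  set E := s.nat vE
  set src := s.natArr aSrc
  set dst := s.natArr aDst
  set lab := s.natArr aLab
  set nxt := s.natArr aNxt
  set first := s.natArr aFirst
  have hA' : Arcs V E src dst lab nxt first R := hA
  have hc1 : s1.nat 12 = s.nat vc := h1.nat _ rfl
  have hd1 : s1.natArr 11 = dst := h1.natArr _ rfl
  have hn1 : s1.natArr 13 = nxt := h1.natArr _ rfl
  have hf1 : s1.natArr 14 = first := h1.natArr _ rfl
  clear_value E src dst lab nxt first
  set c := s.nat vc
  refine Runs.straight_seq (T₂ := (E + V) * 50 + 26) rfl ?_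
    (by simp only [Program.size, NatExpr.cost]; omega)
  simp only [vc, vhead, vtail, ve, aQueue, aReach] at *
  simp only [Program.run, NatExpr.eval]
  generalize hs2 : State.setNat _ 14 0 = s2
  have hd2 : s2.natArr 11 = dst := by rw [← hs2]; simpa using hd1
  have hn2 : s2.natArr 13 = nxt := by rw [← hs2]; simpa using hn1
  have hf2 : s2.natArr 14 = first := by rw [← hs2]; simpa using hf1
  have hhead : s2.nat 15 = 0 := by rw [← hs2]; simp
  have htail : s2.nat 16 = 1 := by rw [← hs2]; simp
  have he2 : s2.nat 14 = 0 := by rw [← hs2]; simp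
  have hq2 : s2.natArr 15 0 = c := by rw [← hs2]; simp [hc1]
  have hr2 : ∀ v < V, s2.natArr 16 v = if v = c then 1 else 0 := by
    intro v hv
    rw [← hs2]
    simp [hc1, Function.update_apply, hF1 v hv]
  have hS : SearchState V E c src dst s2 := by
    simp only [SearchState, vhead, vtail, ve, hhead, htail, he2]
    refine ⟨hq2, one_pos, by omega, fun i j hi hj _ => by omega, fun i hi => ?_, fun v hv => ?_,
      fun i h0 hi => by omega, by omega, by omega, by omega⟩
    · obtain rfl : i = 0 := by omega
      exact hq2 ▸ hc
    · simp only [aReach, hr2 v hv]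
      constructor
      · intro h
        exact ⟨0, one_pos, by by_contra hne; simp [show v ≠ c from fun h => hne (hq2.trans h.symm)] at h⟩
      · rintro ⟨i, hi, rfl⟩
        obtain rfl : i = 0 := by omega
        simp [hq2]
  -- An iteration either disposes of an arc or takes out a node, and at most `V` nodes are taken
  -- out.
  refine Runs.mono (Runs.loop (c := 37) (SearchState V E c src dst)
    (fun s' => (todo E src (s'.natArr 15) (s'.nat 15) (s'.nat 14)).card + (V - s'.nat 15))
    hS ?_ le_rfl) ?_ ?_
  · intro s' h hI hb
    have hd' : s'.natArr 11 = dst := (h.natArr _ rfl).trans hd2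
    have hn' : s'.natArr 13 = nxt := (h.natArr _ rfl).trans hn2
    have hf' : s'.natArr 14 = first := (h.natArr _ rfl).trans hf2
    simp only [SearchState, vhead, vtail, ve, aQueue, aReach] at hI ⊢
    simp only [Test.Holds, NatExpr.eval, not_le] at hb
    have htV := hI.tail_le
    refine Runs.straight rfl ?_ (by simp [Program.size, NatExpr.cost, Test.cost])
    by_cases he0 : s'.nat 14 = 0
    · have hlt : s'.nat 15 < s'.nat 16 := by omega
      have hI0 := hI
      rw [he0] at hI0
      have h3 := hI0.pop hA' hlt
      have h4 := hI0.todo_pop hlt (first (s'.natArr 15 (s'.nat 15)))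
      simp [he0, hf']
      refine ⟨h3, ?_⟩
      omega
    · have he1 : 1 ≤ s'.nat 14 := by omega
      by_cases hr : s'.natArr 16 (dst (s'.nat 14)) = 0
      · have hdV : dst (s'.nat 14) < V :=
          hR _ ((hA'.rel _).2 ⟨s'.nat 14, he1, hI.arc_le, rfl⟩)
        have h3 := hI.newNode he0 hdV hr
        have h4 := h3.skipArc hA' he0 (by simp)
        have h5 := hI.todo_arc hA' he0
        have h6 : todo E src (Function.update (s'.natArr 15) (s'.nat 16) (dst (s'.nat 14)))
            (s'.nat 15) (nxt (s'.nat 14)) =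
            todo E src (s'.natArr 15) (s'.nat 15) (nxt (s'.nat 14)) :=
          todo_congr fun i hi => Function.update_of_ne (by have := hI.head_le; omega) _ _
        simp [he1, hd', hn', hr]
        refine ⟨h4, ?_⟩
        rw [h6]
        omega
      · have h4 := hI.skipArc hA' he0 hr
        have h5 := hI.todo_arc hA' he0
        simp [he1, hd', hn', hr]
        refine ⟨h4, ?_⟩
        omega
  · intro s' h ⟨hI, hb⟩
    simp only [Test.Holds, NatExpr.eval, not_or, not_le, not_lt] at hb
    simp only [SearchState, vhead, vtail, ve] at hI
    have he0 : s'.nat 14 = 0 := by omega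
    rw [he0] at hI
    exact hI.tree hA' hR (by omega)
  · have : (todo E src (s2.natArr 15) (s2.nat 15) (s2.nat 14)).card ≤ E := card_todo_le
    have : ((todo E src (s2.natArr 15) (s2.nat 15) (s2.nat 14)).card + (V - s2.nat 15)) * 50
      ≤ (E + V) * 50 := Nat.mul_le_mul_right _ (by omega)
    simp only [Test.cost, NatExpr.cost]
    omega


/-- The loop rule with a rank that need not be a function of the state. -/
theorem Runs.loopRank {D : ℕ → ℕ → ℝ} {p : Program} {s : State} {b : Test} {c r T : ℕ}
    (Inv : ℕ → State → Prop) (h0 : Inv r s)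
    (step : ∀ r s', Same p s s' → Inv r s' → b.Holds D s' →
      Runs D p s' (fun s'' => ∃ r' < r, Inv r' s'') c)
    (hT : r * (c + b.cost + 1) + b.cost + 1 ≤ T) :
    Runs D (.loop b p) s (fun s' => (∃ r, Inv r s') ∧ ¬ b.Holds D s') T := by
  suffices H : ∀ r s', Same p s s' → Inv r s' →
      Runs D (.loop b p) s' (fun s' => (∃ r, Inv r s') ∧ ¬ b.Holds D s')
        (r * (c + b.cost + 1) + b.cost + 1) from
    (H r s (.refl _ _) h0).mono (fun _ _ h => h) hT
  intro r
  induction r using Nat.strong_induction_on with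
  | _ r ih =>
    intro s' hs hI
    by_cases hb : b.Holds D s'
    · obtain ⟨s₁, t, h, ht, r', hr, hI₁⟩ := step r s' hs hI hb
      obtain ⟨s₂, t', h', ht', hq⟩ := ih r' hr s₁ (hs.trans h.same) hI₁
      refine ⟨s₂, _, .loopTrue hb h h', ?_, hq⟩
      have : (r' + 1) * (c + b.cost + 1) ≤ r * (c + b.cost + 1) :=
        Nat.mul_le_mul_right _ (by omega)
      rw [Nat.add_mul] at this
      omega
    · exact ⟨s', _, .loopFalse hb, by omega, ⟨r, hI⟩, hb⟩

/-! ### One augmentation -/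

/-- Follows the search tree from the sink back to `vc` and changes the matching on the way. -/
def walk : Program :=
  .setNat vv (.plus (.plus (.var vk) (.var vm)) (.lit 1)) ;;
  .loop (.not (.and (.natLe (.var vv) (.var vc)) (.natLe (.var vc) (.var vv))))
    (.setNat vw (.get aPar (.var vv)) ;;
      .setNat vv (.get aSrc (.var vw)) ;;
      .when (.natLt (.var vv) (.var vk)) (.putNat aM (.var vv) (.get aLab (.var vw))))

/-- Nodes below `k` are entered by back arcs only. So every center on a tree path except the root is
matched, as `Augmenting.step` requires. -/
theorem Network.Res.matched {N : Network} {k : ℕ} {M : ℕ → ℕ} {a b x : ℕ}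
    (h : N.Res k M a b x) (hb : b < k) : M b < N.n := by
  cases h with
  | back _ h => exact h
  | _ => omega

theorem walk_runs {D : ℕ → ℕ → ℝ} {s : State} {N : Network} {M : ℕ → ℕ} {k c V E T : ℕ}
    {S : Set ℕ} {pos : ℕ → ℕ}
    (hN : net s = N) (hM : s.natArr aM = M) (hk : s.nat vk = k) (hvc : s.nat vc = c)
    (hs : Sane N k) (hm : N.IsMatching M) (hc : c < N.p) (hfree : ¬ M c < N.n)
    (ht : SearchTree V E c (s.natArr aSrc) (s.natArr aDst) (s.natArr aLab) (s.natArr aReach)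
      (s.natArr aPar) (resSet N k M) S pos) (hsink : k + N.m + 1 ∈ S)
    (hT : V * 30 + 30 ≤ T) :
    Runs D walk s (fun s' => N.IsMatching (s'.natArr aM) ∧
      N.free (s'.natArr aM) < N.free M) T := by
  have hpk := hs.p_le
  refine Runs.straight_seq (T₂ := V * 30 + 10) rfl ?_
    (by simp only [Program.size, NatExpr.cost]; omega)
  have hm1 : s.nat 1 = N.m := congrArg Network.m hN
  simp only [Program.run, NatExpr.eval]
  -- Queue positions decrease on the way back and are below `V`, which bounds the length of the
  -- walk.
  refine Runs.mono (Runs.loop (c := 20) (fun s' => s'.nat vv ∈ S ∧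
    N.Augmenting k M c pos (s'.nat vv) (s'.natArr aM)) (fun s' => pos (s'.nat vv)) ?_ ?_ le_rfl)
    ?_ ?_
  · simp only [vk] at hk
    simp [hk, hm1, hsink]
    simp only [aM] at hM
    rw [hM]
    exact hm.augmenting_sink
  · intro s' h ⟨hv, hI⟩ hb
    have hc' : s'.nat 12 = c := (h.nat _ rfl).trans (by simpa using hvc)
    have hk' : s'.nat 2 = k := (h.nat _ rfl).trans (by simpa using hk)
    have hsrc : s'.natArr 10 = s.natArr 10 := (h.natArr _ rfl).trans (by simp)
    have hlab : s'.natArr 12 = s.natArr 12 := (h.natArr _ rfl).trans (by simp)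
    have hpar : s'.natArr 17 = s.natArr 17 := (h.natArr _ rfl).trans (by simp)
    simp only [vv, aM, vc, Test.Holds, NatExpr.eval, hc'] at hv hI hb ⊢
    simp only [aSrc, aLab, aPar] at ht
    have hne : s'.nat 13 ≠ c := by rintro h; apply hb; omega
    obtain ⟨h1, h2, h3⟩ := ht.parent _ hv hne
    refine Runs.straight rfl ?_ (by simp [Program.size, NatExpr.cost, Test.cost])
    have h4 := hI.step hm hpk hs.grp_lt hs.l_le_u h1 hfree (fun ha hac => by
      obtain ⟨h5, -, -⟩ := ht.parent _ h2 hac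
      exact Network.Res.matched h5 ha) h3 hne
    by_cases ha : s.natArr 10 (s.natArr 17 (s'.nat 13)) < k
    · rw [if_pos ha] at h4
      simp [hk', hsrc, hlab, hpar, ha]
      exact ⟨⟨h2, h4⟩, h3⟩
    · rw [if_neg ha] at h4
      simp [hk', hsrc, hpar, ha]
      exact ⟨⟨h2, h4⟩, h3⟩
  · intro s' h ⟨⟨hv, hI⟩, hb⟩
    have hc' : s'.nat 12 = c := (h.nat 12 rfl).trans (by simpa using hvc)
    simp only [vv, aM, vc, Test.Holds, NatExpr.eval, hc', not_not] at hv hI hb ⊢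
    have he : s'.nat 13 = c := by omega
    rw [he] at hI
    obtain ⟨h1, h2⟩ := hI.isMatching (by omega)
    exact ⟨h1, Network.free_lt_of_augmented hI.keep hc hfree h2⟩
  · have hp := ht.pos_lt _ hsink
    simp only [vk] at hk
    simp [hk, hm1, Test.cost, NatExpr.cost]
    have : pos (k + N.m + 1) * 28 ≤ V * 28 := Nat.mul_le_mul_right _ hp.le
    omega

/-- Sets `vflag` to `0` if there is no free center; otherwise matches one more center (`1`) or
detects that this is impossible (`2`). -/
def attempt : Program :=
  .setNat vc (.var vp) ;;
  forUp vx (.var vp) (.when (.natLe (.var vn) (.get aM (.var vx))) (.setNat vc (.var vx))) ;;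
  .ite (.natLe (.var vp) (.var vc)) (.setNat vflag (.lit 0))
    (countGroups ;; buildGraph ;; bfs (.plus (.plus (.var vk) (.var vm)) (.lit 2)) ;;
      .ite (.natLe (.lit 1) (.get aReach (.plus (.plus (.var vk) (.var vm)) (.lit 1))))
        (walk ;; .setNat vflag (.lit 1)) (.setNat vflag (.lit 2)))

theorem resSet_lt {N : Network} {k : ℕ} {M : ℕ → ℕ} (hs : Sane N k) :
    ∀ t ∈ resSet N k M, t.2.1 < k + N.m + 2 := by
  rintro ⟨a, b, x⟩ h
  simp only [resSet, Set.mem_ofPred_eq] at h ⊢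
  have := hs.p_le
  cases h with
  | point hx _ => have := hs.grp_lt _ hx; omega
  | _ => omega

theorem attempt_runs {D : ℕ → ℕ → ℝ} {s : State} {N : Network} {M : ℕ → ℕ} {k T : ℕ}
    (hN : net s = N) (hM : s.natArr aM = M) (hk : s.nat vk = k) (hs : Sane N k)
    (hm : N.IsMatching M) (hT : 2000 * N.n ≤ T) :
    Runs D attempt s (fun s' => (s'.nat vflag = 0 ∧ s'.natArr aM = M ∧ N.Full M) ∨
      (s'.nat vflag = 1 ∧ N.IsMatching (s'.natArr aM) ∧ N.free (s'.natArr aM) < N.free M) ∨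
      (s'.nat vflag = 2 ∧ s'.natArr aM = M ∧ ¬ N.Feasible)) T := by
  have hn : 1 ≤ N.n := hs.k_pos.trans hs.k_le
  have hpn : N.p ≤ N.n := hs.p_le.trans hs.k_le
  have hmn := hs.m_le
  have hkn := hs.k_le
  have hpk := hs.p_le
  have hp0 : s.nat 7 = N.p := congrArg Network.p hN
  refine Runs.straight_seq (T₂ := 1998 * N.n) rfl ?_
    (by simp only [Program.size, NatExpr.cost]; omega)
  -- `vc` keeps the value `p`, which is no center, until a free center is seen.
  refine Runs.seq (T₁ := 38 * N.n) (T₂ := 1960 * N.n) (Runs.forUp N.p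
    (fun i s' => s'.nat vc ≤ N.p ∧ (s'.nat vc < N.p → ¬ M (s'.nat vc) < N.n) ∧
      (s'.nat vc = N.p → ∀ j < i, M j < N.n)) rfl ?_ ?_ ?_ (c := 10) ?_) ?_ (by omega)
  · intro s' h
    exact (h.nat 7 rfl).trans (by simpa using hp0)
  · simp [hp0]
  · rintro i s' hi h hx ⟨h1, h2, h3⟩
    refine Runs.straight rfl ?_ (by simp [Program.size, NatExpr.cost, Test.cost])
    have hn' : s'.nat 0 = N.n := (h.nat 0 rfl).trans (congrArg Network.n hN)
    have hM' : s'.natArr 8 = M := (h.natArr 8 rfl).trans hM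
    simp only [vx, vc] at hx h1 h2 h3
    by_cases hMi : M i < N.n
    · simp [hx, hn', hM', not_le.2 hMi]
      refine ⟨h1, fun h => not_lt.1 (h2 h), fun he j hj => ?_⟩
      rcases lt_or_eq_of_le hj with hj' | rfl
      · exact h3 he j hj'
      · exact hMi
    · simp [hx, hn', hM', not_lt.1 hMi]
      omega
  · simp only [NatExpr.cost]; omega
  rintro s1 h1 ⟨hc1, hc2, hc3⟩
  have hN1 : net s1 = N := (h1.net rfl rfl rfl rfl rfl rfl rfl rfl).trans hN
  have hM1 : s1.natArr aM = M := (h1.natArr _ rfl).trans hM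
  have hk1 : s1.nat vk = k := (h1.nat _ rfl).trans hk
  have hp1 : s1.nat vp = N.p := congrArg Network.p hN1
  refine Runs.ite (T₁ := 2) (T₂ := 1950 * N.n) (fun hb => ?_) (fun hb => ?_)
    (by simp only [Test.cost, NatExpr.cost]; omega)
  · simp only [Test.Holds, NatExpr.eval, hp1] at hb
    refine Runs.straight rfl (Or.inl ?_) (by simp [Program.size, NatExpr.cost])
    refine ⟨by simp, by simpa using hM1, ?_⟩
    exact hc3 (le_antisymm hc1 hb)
  simp only [Test.Holds, NatExpr.eval, hp1, not_le] at hb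
  have hfree := hc2 hb
  generalize hc : s1.nat vc = c at hb hfree
  refine Runs.seq (T₁ := 100 * N.n) (T₂ := 1850 * N.n) (countGroups_runs hN1 hM1 hs le_rfl) ?_
    (by omega)
  rintro s2 h2 ⟨hcnt, hexc⟩
  have hN2 : net s2 = N := (h2.net rfl rfl rfl rfl rfl rfl rfl rfl).trans hN1
  have hM2 : s2.natArr aM = M := (h2.natArr _ rfl).trans hM1
  have hk2 : s2.nat vk = k := (h2.nat _ rfl).trans hk1
  have hcc2 : s2.nat vc = c := (h2.nat _ rfl).trans hc
  refine Runs.seq (T₁ := 600 * N.n) (T₂ := 1250 * N.n)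
    (buildGraph_runs hN2 hM2 hk2 hs hcnt hexc le_rfl) ?_ (by omega)
  rintro s3 h3 ⟨hA, hE⟩
  have hN3 : net s3 = N := (h3.net rfl rfl rfl rfl rfl rfl rfl rfl).trans hN2
  have hM3 : s3.natArr aM = M := (h3.natArr _ rfl).trans hM2
  have hk3 : s3.nat vk = k := (h3.nat _ rfl).trans hk2
  have hcc3 : s3.nat vc = c := (h3.nat _ rfl).trans hcc2
  refine Runs.seq (T₁ := 800 * N.n) (T₂ := 450 * N.n)
    (bfs_runs (V := k + N.m + 2) ?_ hA (resSet_lt hs) (by omega) ?_) ?_ (by omega)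
  · intro s' h
    have e1 : s'.nat 1 = N.m := (h.nat 1 rfl).trans (congrArg Network.m hN3)
    have e2 : s'.nat 2 = k := (h.nat 2 rfl).trans hk3
    simp [e1, e2]
  · simp only [NatExpr.cost]; omega
  rintro s4 h4 ⟨S, pos, ht⟩
  have hN4 : net s4 = N := (h4.net rfl rfl rfl rfl rfl rfl rfl rfl).trans hN3
  have hM4 : s4.natArr aM = M := (h4.natArr _ rfl).trans hM3
  have hk4 : s4.nat vk = k := (h4.nat _ rfl).trans hk3
  have hcc4 : s4.nat vc = c := (h4.nat _ rfl).trans hcc3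
  have hm4 : s4.nat vm = N.m := congrArg Network.m hN4
  rw [hcc3] at ht
  have hmark := ht.mark (k + N.m + 1) (by omega)
  refine Runs.ite (T₁ := 400 * N.n) (T₂ := 2) (fun hb => ?_) (fun hb => ?_)
    (by simp only [Test.cost, NatExpr.cost]; omega)
  · simp only [Test.Holds, NatExpr.eval, hk4, hm4, Nat.one_le_iff_ne_zero] at hb
    rw [hmark] at hb
    have ht' : SearchTree (k + N.m + 2) (s3.nat vE) c (s4.natArr aSrc) (s4.natArr aDst)
        (s4.natArr aLab) (s4.natArr aReach) (s4.natArr aPar) (resSet N k M) S pos := by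
      rw [h4.natArr aSrc rfl, h4.natArr aDst rfl, h4.natArr aLab rfl]
      exact ht
    refine Runs.seq (T₁ := 398 * N.n) (T₂ := 2)
      (walk_runs hN4 hM4 hk4 hcc4 hs hm (by omega) hfree ht' hb (by omega)) ?_ (by omega)
    rintro s5 h5 ⟨h6, h7⟩
    refine Runs.straight rfl (Or.inr (Or.inl ?_)) (by simp [Program.size, NatExpr.cost])
    refine ⟨by simp, by simpa using h6, by simpa using h7⟩
  · simp only [Test.Holds, NatExpr.eval, hk4, hm4, Nat.one_le_iff_ne_zero] at hb
    rw [hmark] at hb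
    refine Runs.straight rfl (Or.inr (Or.inr ?_)) (by simp [Program.size, NatExpr.cost])
    refine ⟨by simp, by simpa using hM4, ?_⟩
    exact Network.not_feasible_of_closed hs.grp_lt S (by omega) hfree ht.root
      (fun a b x ha hr => ht.closed (a, b, x) hr ha) hb

/-! ### Matching along a sequence of growing networks -/

namespace Network

/-- Every matching of `N` is a matching of `N'`, in which centers may be missing. -/
structure Grows (N N' : Network) : Prop where
  n_eq : N'.n = N.n
  m_eq : N'.m = N.m
  F_eq : N'.F = N.F
  grp_eq : N'.grp = N.grp
  l_eq : N'.l = N.l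
  u_eq : N'.u = N.u
  p_le : N'.p ≤ N.p
  act_eq : ∀ x < N.n, N.act x < N'.p → N'.act x = N.act x

/-- Dropping centers only lowers the counts, and both capacity conditions are monotone. The cells of
dropped centers are no longer read. -/
theorem Grows.isMatching {N N' : Network} (h : N.Grows N') {M : ℕ → ℕ} (hM : N.IsMatching M) :
    N'.IsMatching M := by
  obtain ⟨n, m, p, F, grp, l, u, act⟩ := N
  obtain ⟨n', m', p', F', grp', l', u', act'⟩ := N'
  obtain ⟨rfl, rfl, rfl, rfl, rfl, rfl, h1, h2⟩ := h
  simp only at h1 h2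
  refine ⟨fun j hj hn => ?_, ?_⟩
  · simp only at hj hn ⊢
    have h3 := hM.edge j (hj.trans_le h1) hn
    simp only at h3
    rw [h2 _ hn (by omega), h3]
  · exact Fits.mono (N := ⟨n', m', p', F', grp', l', u', act'⟩) (T := cnt _ M) (hM.fits)
      fun g _ => Finset.card_le_card (Finset.filter_subset_filter _ (by simpa using h1))

theorem Grows.free_le {N N' : Network} (h : N.Grows N') (M : ℕ → ℕ) : N'.free M ≤ N.free M := by
  unfold free
  rw [h.n_eq]
  exact Finset.card_le_card (Finset.filter_subset_filter _ (by simpa using h.p_le))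

theorem free_le (N : Network) (M : ℕ → ℕ) : N.free M ≤ N.p :=
  (Finset.card_filter_le _ _).trans (by simp)

theorem isMatching_of_forall_free {N : Network} {M : ℕ → ℕ} (h : ∀ j < N.p, N.n ≤ M j) :
    N.IsMatching M := by
  have h0 : ∀ g, N.cnt M g = 0 := fun g => by
    rw [cnt, Finset.card_eq_zero, Finset.filter_eq_empty_iff]
    intro j hj
    have := h j (Finset.mem_range.1 hj)
    omega
  refine ⟨fun j hj hn => absurd hn (not_lt.2 (h j hj)), fun g _ => by simp [h0], ?_⟩
  simp [exc, h0]

end Network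

/-- Starting from the empty matching, goes to the next network whenever the current one (set up by
`build`) has no full matching. -/
def chain (build adv : Program) : Program :=
  forUp vx (.var vk) (.putNat aM (.var vx) (.var vn)) ;;
  .setNat vflag (.lit 1) ;;
  .loop (.natLe (.lit 1) (.var vflag))
    (build ;; attempt ;; .when (.natLe (.lit 2) (.var vflag)) adv)

/-- Amortization: a round matches one more center or moves to the next network, and moving on
creates no free center. So `τe - τ` plus the number of free centers drops each time, and one last
round notices that no center is free. Each round costs `O(n)`. -/
theorem chain_runs {D : ℕ → ℕ → ℝ} {build adv : Program} {s : State} {n k τe B T : ℕ}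
    (St : ℕ → State → Prop) (Nt : ℕ → Network) (h0 : St 0 s)
    (hst : ∀ τ s s', St τ s → Same attempt s s' → St τ s')
    (hn : ∀ τ s, St τ s → s.nat vn = n ∧ s.nat vk = k)
    (hbuild : ∀ τ s, St τ s → τ ≤ τe → Runs D build s (fun s' => St τ s' ∧ net s' = Nt τ ∧
      s'.natArr aM = s.natArr aM) (B * n))
    (hadv : ∀ τ s, St τ s → τ < τe → Runs D adv s (fun s' => St (τ + 1) s' ∧
      s'.natArr aM = s.natArr aM ∧ s'.nat vflag = s.nat vflag) (B * n))
    (hsane : ∀ τ ≤ τe, Sane (Nt τ) k ∧ (Nt τ).n = n)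
    (hgrow : ∀ τ < τe, (Nt τ).Grows (Nt (τ + 1)))
    (hfeas : (Nt τe).Feasible)
    (hT : (τe + k + 2) * ((2 * B + 2040) * n) ≤ T) :
    Runs D (chain build adv) s (fun s' => ∃ τ ≤ τe, St τ s' ∧ net s' = Nt τ ∧
      (Nt τ).IsMatching (s'.natArr aM) ∧ (Nt τ).Full (s'.natArr aM) ∧
      ∀ τ' < τ, ¬ (Nt τ').Feasible) T := by
  have hs0 := (hsane 0 (Nat.zero_le _)).1
  have hn0 := (hsane 0 (Nat.zero_le _)).2
  have hn1 : 1 ≤ n := hn0 ▸ hs0.k_pos.trans hs0.k_le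
  have hkn : k ≤ n := hn0 ▸ hs0.k_le
  have hinit : ∀ y, attempt.wNat y = false → y ≠ vx ∧ y ≠ vflag := by
    intro y hy
    constructor <;> rintro rfl <;> exact absurd hy (by decide)
  have hinitA : ∀ y, attempt.wNatArr y = false → y ≠ aM := by
    rintro y hy rfl
    exact absurd hy (by decide)
  obtain ⟨hvn, hvk⟩ := hn 0 s h0
  refine Runs.seq (T₁ := 30 * n) (T₂ := (τe + k + 1) * ((2 * B + 2040) * n) + 1000 * n)
    (Runs.forUp k (fun i s' => ∀ j < i, n ≤ s'.natArr aM j) rfl ?_ ?_ ?_ (c := 3) ?_) ?_ ?_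
  · intro s' h
    exact (h.nat 2 rfl).trans hvk
  · simp
  · intro i s' hi h hx hI
    refine Runs.straight rfl ?_ (by simp [Program.size, NatExpr.cost])
    have hn' : s'.nat 0 = n := (h.nat 0 rfl).trans hvn
    simp only [vx] at hx
    intro j hj
    rcases Nat.lt_succ_iff_lt_or_eq.1 hj with hj' | rfl
    · simp only [Program.run, NatExpr.eval, State.natArr_setNat, State.natArr_putNat, if_true, hx]
      rw [Function.update_of_ne (by omega)]
      exact hI j hj'
    · simp [hx, hn']
  · simp only [NatExpr.cost]; omega
  · intro s1 h1 hI
    have hS1 : St 0 s1 := by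
      refine hst 0 s s1 h0 (h1.mono (fun y hy => ?_) (fun y hy => ?_) fun y hy => ?_)
      · simp [forUp, Program.wNat]
        exact (hinit y hy).1
      · simp [forUp, Program.wNatArr]
        exact hinitA y hy
      · simp [forUp, Program.wRealArr]
    refine Runs.straight_seq (T₂ := (τe + k + 1) * ((2 * B + 2040) * n) + 998 * n) rfl ?_
      (by simp only [Program.size, NatExpr.cost]; omega)
    have hS2 : St 0 (s1.setNat vflag 1) := by
      refine hst 0 s1 _ hS1 ⟨fun y hy => ?_, fun _ _ => rfl, fun _ _ => rfl⟩
      simp [show y ≠ 11 from (hinit y hy).2]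
    refine Runs.mono (Runs.loopRank (r := τe + k + 1) (c := (2 * B + 2030) * n)
      (fun r s' => ∃ τ ≤ τe, St τ s' ∧ (Nt τ).IsMatching (s'.natArr aM) ∧
        (∀ τ' < τ, ¬ (Nt τ').Feasible) ∧
        (s'.nat vflag = 0 → net s' = Nt τ ∧ (Nt τ).Full (s'.natArr aM)) ∧
        (s'.nat vflag ≠ 0 → τe - τ + (Nt τ).free (s'.natArr aM) + 1 ≤ r)) ?_ ?_ le_rfl) ?_ ?_
    · refine ⟨0, Nat.zero_le _, hS2, ?_, by omega, by simp, fun _ => ?_⟩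
      · refine Network.isMatching_of_forall_free fun j hj => ?_
        rw [hn0]
        exact hI j (hj.trans_le hs0.p_le)
      · have h3 := Network.free_le (Nt 0) (((Program.setNat vflag (.lit 1)).run D s1).natArr aM)
        have := hs0.p_le
        omega
    · rintro r s' h ⟨τ, hτ, hS, hm, hinf, -, hr⟩ hb
      simp only [Test.Holds, NatExpr.eval] at hb
      have hr' := hr (by omega)
      obtain ⟨hsa, hnn⟩ := hsane τ hτ
      refine Runs.seq (hbuild τ s' hS hτ) (T₂ := (B + 2030) * n) ?_ (by
        rw [← Nat.add_mul]; exact Nat.mul_le_mul_right _ (by omega))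
      rintro s2 - ⟨hS2, hN2, hM2⟩
      rw [← hM2] at hm hr'
      refine Runs.seq (T₁ := 2000 * n) (T₂ := (B + 30) * n)
        (attempt_runs hN2 rfl (hn τ s2 hS2).2 hsa hm (by rw [hnn])) ?_ (by
        rw [← Nat.add_mul]; exact Nat.mul_le_mul_right _ (by omega))
      rintro s3 h3 h4
      have hS3 := hst τ s2 s3 hS2 h3
      have hN3 : net s3 = Nt τ := (h3.net rfl rfl rfl rfl rfl rfl rfl rfl).trans hN2
      refine Runs.ite (T₁ := B * n) (T₂ := 1) (fun hb => ?_) (fun hb => ?_) ?_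
      · simp only [Test.Holds, NatExpr.eval] at hb
        rcases h4 with ⟨h5, -⟩ | ⟨h5, -⟩ | ⟨h5, h6, h7⟩
        · omega
        · omega
        -- The last network is feasible, so a verdict of infeasibility leaves a next network to go
        -- to.
        have hτlt : τ < τe := by
          rcases lt_or_eq_of_le hτ with h | rfl
          · exact h
          · exact absurd hfeas h7
        refine (hadv τ s3 hS3 hτlt).mono ?_ le_rfl
        rintro s4 - ⟨hS4, hM4, hf4⟩
        have hg := hgrow τ hτlt
        have hfr := hg.free_le (s2.natArr aM)
        refine ⟨r - 1, by omega, τ + 1, hτlt, hS4, ?_, fun τ' hτ' => ?_, fun h0 => ?_,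
          fun _ => ?_⟩
        · rw [hM4, h6]
          exact hg.isMatching hm
        · rcases Nat.lt_succ_iff_lt_or_eq.1 hτ' with hlt | rfl
          · exact hinf τ' hlt
          · exact h7
        · rw [hf4, h5] at h0
          exact absurd h0 (by omega)
        · rw [hM4, h6]
          omega
      · simp only [Test.Holds, NatExpr.eval] at hb
        refine Runs.straight rfl ?_ (by simp [Program.size])
        simp only [Program.run]
        rcases h4 with ⟨h5, h6, h7⟩ | ⟨h5, h6, h7⟩ | ⟨h5, -⟩
        · exact ⟨r - 1, by omega, τ, hτ, hS3, h6 ▸ hm, hinf, fun _ => ⟨hN3, h6 ▸ h7⟩,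
            fun h => absurd h5 h⟩
        · refine ⟨r - 1, by omega, τ, hτ, hS3, h6, hinf, fun h => absurd h (by omega),
            fun _ => by omega⟩
        · omega
      · have : (B + 30) * n = B * n + 30 * n := by ring
        simp only [Test.cost, NatExpr.cost]
        omega
    · rintro s' - ⟨⟨r, τ, hτ, hS, hm, hinf, h1, -⟩, hb⟩
      simp only [Test.Holds, NatExpr.eval] at hb
      obtain ⟨h2, h3⟩ := h1 (by omega)
      exact ⟨τ, hτ, hS, h2, hm, h3, hinf⟩
    · have : (2 * B + 2030) * n + Test.cost (.natLe (.lit 1) (.var vflag)) + 1 ≤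
          (2 * B + 2040) * n := by
        simp only [Test.cost, NatExpr.cost]
        have e1 : (2 * B + 2030) * n = 2 * B * n + 2030 * n := by ring
        have e2 : (2 * B + 2040) * n = 2 * B * n + 2040 * n := by ring
        omega
      have := Nat.mul_le_mul_left (τe + k + 1) this
      simp only [Test.cost, NatExpr.cost] at this ⊢
      omega
  · have e1 : (τe + k + 2) * ((2 * B + 2040) * n) = (τe + k + 1) * ((2 * B + 2040) * n) +
        (2 * B * n + 2040 * n) := by ring
    omega


/-! ### The greedy sequence -/

/-- `cen 0, …, cen t` is a greedy sequence with gaps `gap 1, …, gap t`, and row `i` of `tab` lists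
the closest one of `cen 0, …, cen i` for every point. -/
structure GreedyUpTo (D : ℕ → ℕ → ℝ) (n t : ℕ) (cen tab : ℕ → ℕ) (gap : ℕ → ℝ) : Prop where
  cen_lt : ∀ i ≤ t, cen i < n
  tab_le : ∀ i ≤ t, ∀ x < n, tab (i * n + x) ≤ i
  tab_min : ∀ i ≤ t, ∀ x < n, ∀ j ≤ i, D x (cen (tab (i * n + x))) ≤ D x (cen j)
  gap_eq : ∀ i < t, gap (i + 1) = D (cen (i + 1)) (cen (tab (i * n + cen (i + 1))))
  far : ∀ i < t, ∀ x < n, D x (cen (tab (i * n + x))) ≤ gap (i + 1)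

theorem row_lt {n t i x : ℕ} (hi : i ≤ t) (hx : x < n) : i * n + x < (t + 1) * n := by
  have : i * n ≤ t * n := Nat.mul_le_mul_right _ hi
  rw [Nat.add_mul]
  omega

/-- Only the new center can improve on the stored minimum, and an entry changes only when the
improvement is strict. The maximum of the old distances is both the choice of the new center and its
gap. -/
theorem GreedyUpTo.succ {D : ℕ → ℕ → ℝ} {n t b : ℕ} {cen tab near tab' : ℕ → ℕ}
    {cur gap : ℕ → ℝ}
    (h : GreedyUpTo D n t cen tab gap) (hnear : ∀ x < n, near x = tab (t * n + x))
    (hcur : ∀ x < n, cur x = D x (cen (near x))) (hb : b < n) (hmax : ∀ x < n, cur x ≤ cur b)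
    (htab : ∀ i < (t + 1) * n, tab' i = tab i)
    (htab' : ∀ x < n, tab' ((t + 1) * n + x) = if D x b < cur x then t + 1 else near x) :
    GreedyUpTo D n (t + 1) (Function.update cen (t + 1) b) tab'
      (Function.update gap (t + 1) (cur b)) := by
  have hc : ∀ i ≤ t, Function.update cen (t + 1) b i = cen i := fun i hi =>
    Function.update_of_ne (by omega) _ _
  have hg : ∀ i < t, Function.update gap (t + 1) (cur b) (i + 1) = gap (i + 1) := fun i hi =>
    Function.update_of_ne (by omega) _ _
  have ht : ∀ i ≤ t, ∀ x < n, tab' (i * n + x) = tab (i * n + x) := fun i hi x hx =>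
    htab _ (row_lt hi hx)
  refine ⟨fun i hi => ?_, fun i hi x hx => ?_, fun i hi x hx j hj => ?_, fun i hi => ?_,
    fun i hi x hx => ?_⟩
  · rcases Nat.le_succ_iff.1 hi with hi' | rfl
    · rw [hc i hi']; exact h.cen_lt i hi'
    · simpa using hb
  · rcases Nat.le_succ_iff.1 hi with hi' | rfl
    · rw [ht i hi' x hx]; exact h.tab_le i hi' x hx
    · rw [htab' x hx]
      split_ifs
      · exact le_rfl
      · rw [hnear x hx]
        exact (h.tab_le t le_rfl x hx).trans (Nat.le_succ t)
  · rcases Nat.le_succ_iff.1 hi with hi' | rfl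
    · rw [ht i hi' x hx, hc j (hj.trans hi'), hc _ ((h.tab_le i hi' x hx).trans hi')]
      exact h.tab_min i hi' x hx j hj
    · have hold : near x ≤ t := by rw [hnear x hx]; exact h.tab_le t le_rfl x hx
      have hmin : ∀ j ≤ t, cur x ≤ D x (cen j) := fun j hj => by
        rw [hcur x hx, hnear x hx]
        exact h.tab_min t le_rfl x hx j hj
      rw [htab' x hx]
      split_ifs with hlt
      · rw [Function.update_self]
        rcases Nat.le_succ_iff.1 hj with hj' | rfl
        · rw [hc j hj']
          exact hlt.le.trans (hmin j hj')
        · rw [Function.update_self]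
      · rw [hc _ hold, ← hcur x hx]
        rcases Nat.le_succ_iff.1 hj with hj' | rfl
        · rw [hc j hj']
          exact hmin j hj'
        · rw [Function.update_self]
          exact not_lt.1 hlt
  · rcases Nat.lt_succ_iff_lt_or_eq.1 hi with hi' | rfl
    · rw [hg i hi', hc (i + 1) hi', ht i (by omega) _ (h.cen_lt _ hi'),
        hc _ ((h.tab_le i hi'.le _ (h.cen_lt _ hi')).trans hi'.le)]
      exact h.gap_eq i hi'
    · rw [Function.update_self, Function.update_self, ht i le_rfl b hb,
        hc _ (h.tab_le i le_rfl b hb), hcur b hb, hnear b hb]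
  · rcases Nat.lt_succ_iff_lt_or_eq.1 hi with hi' | rfl
    · rw [hg i hi', ht i (by omega) _ hx, hc _ ((h.tab_le i hi'.le _ hx).trans hi'.le)]
      exact h.far i hi' x hx
    · rw [Function.update_self, ht i le_rfl x hx, hc _ (h.tab_le i le_rfl x hx), ← hnear x hx,
        ← hcur x hx]
      exact hmax x hx

/-- Step 1 of the algorithm. -/
def greedy : Program :=
  .putNat aCen (.lit 0) (.lit 0) ;;
  .setNat voff (.lit 0) ;;
  forUp vx (.var vn) (.putReal rCur (.var vx) (.dist (.var vx) (.lit 0)) ;;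
    .putNat aNear (.var vx) (.lit 0) ;; .putNat aTab (.var vx) (.lit 0)) ;;
  forUp vi (.minus (.var vk) (.lit 1))
    (.setNat vbest (.lit 0) ;;
      forUp vx (.var vn) (.when
        (.not (.realLe (.get rCur (.var vx)) (.get rCur (.var vbest)))) (.setNat vbest (.var vx))) ;;
      (.putNat aCen (.plus (.var vi) (.lit 1)) (.var vbest) ;;
        .putReal rGap (.plus (.var vi) (.lit 1)) (.get rCur (.var vbest)) ;;
        .setNat voff (.plus (.var voff) (.var vn))) ;;
      forUp vx (.var vn) (.when
        (.not (.realLe (.get rCur (.var vx)) (.dist (.var vx) (.var vbest))))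
          (.putReal rCur (.var vx) (.dist (.var vx) (.var vbest)) ;;
            .putNat aNear (.var vx) (.plus (.var vi) (.lit 1))) ;;
        .putNat aTab (.plus (.var voff) (.var vx)) (.get aNear (.var vx))))

theorem greedy_runs {D : ℕ → ℕ → ℝ} {s : State} {n k T : ℕ} (hn : s.nat vn = n)
    (hk : s.nat vk = k) (hk1 : 1 ≤ k) (hkn : k ≤ n) (hT : 200 * (n * k) ≤ T) :
    Runs D greedy s (fun s' => GreedyUpTo D n (k - 1) (s'.natArr aCen) (s'.natArr aTab)
      (s'.realArr rGap) ∧ s'.nat voff = (k - 1) * n) T := by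
  have hnk : n ≤ n * k := Nat.le_mul_of_pos_right n hk1
  refine Runs.straight_seq (T₂ := 190 * (n * k)) rfl ?_
    (by simp only [Program.size, NatExpr.cost]; omega)
  refine Runs.straight_seq (T₂ := 180 * (n * k)) rfl ?_
    (by simp only [Program.size, NatExpr.cost]; omega)
  simp only [Program.run, NatExpr.eval]
  refine Runs.seq (T₁ := 50 * n) (T₂ := 130 * (n * k)) (Runs.forUp n (fun i s' => ∀ x < i,
    s'.natArr aTab x = 0 ∧ s'.natArr aNear x = 0 ∧ s'.realArr rCur x = D x 0) rfl ?_ ?_ ?_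
    (c := 12) ?_) ?_ (by omega)
  · intro s' h
    exact (h.nat 0 rfl).trans (by simpa using hn)
  · simp
  · intro i s' hi h hx hI
    refine Runs.straight rfl ?_ (by simp [Program.size, NatExpr.cost, RealExpr.cost])
    intro x hxi
    simp only [vx] at hx
    rcases Nat.lt_succ_iff_lt_or_eq.1 hxi with hlt | rfl
    · simpa [hx, Function.update_apply, hlt.ne] using hI x hlt
    · simp [hx]
  · simp only [NatExpr.cost]; omega
  intro s1 h1 hI1
  have hn1 : s1.nat 0 = n := (h1.nat 0 rfl).trans (by simpa using hn)
  have hk1' : s1.nat 2 = k := (h1.nat 2 rfl).trans (by simpa using hk)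
  have hcen1 : s1.natArr 4 0 = 0 := by rw [h1.natArr 4 rfl]; simp
  have hoff1 : s1.nat 5 = 0 := by rw [h1.nat 5 rfl]; simp
  -- `aNear` mirrors the current row of the table and `rCur` its distances, so a new center takes a
  -- constant number of passes over the points.
  refine Runs.mono (Runs.forUp (k - 1) (fun t s' => GreedyUpTo D n t (s'.natArr aCen)
    (s'.natArr aTab) (s'.realArr rGap) ∧ s'.nat voff = t * n ∧
    ∀ x < n, s'.natArr aNear x = s'.natArr aTab (t * n + x) ∧
      s'.realArr rCur x = D x (s'.natArr aCen (s'.natArr aNear x))) rfl ?_ ?_ ?_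
      (c := 100 * n) le_rfl) ?_ ?_
  · intro s' h
    have e1 : s'.nat 2 = k := (h.nat 2 rfl).trans hk1'
    simp [e1]
  · refine ⟨⟨fun i hi => ?_, fun i hi x hx => ?_, fun i hi x hx j hj => ?_, by omega, by omega⟩,
      ?_, fun x hx => ?_⟩
    · obtain rfl : i = 0 := by omega
      simp [hcen1]; omega
    · obtain rfl : i = 0 := by omega
      simp [(hI1 x hx).1]
    · obtain rfl : i = 0 := by omega
      obtain rfl : j = 0 := by omega
      simp [(hI1 x hx).1]
    · simp [hoff1]
    · obtain ⟨e1, e2, e3⟩ := hI1 x hx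
      simp only [aTab, aNear, rCur] at e1 e2 e3
      simp [e1, e2, e3, hcen1]
  · rintro t s' ht h hx ⟨hG, hoff, hrow⟩
    have hn' : s'.nat 0 = n := (h.nat 0 rfl).trans hn1
    simp only [vi] at hx
    refine Runs.straight_seq (T₂ := 98 * n) rfl ?_
      (by simp only [Program.size, NatExpr.cost]; omega)
    simp only [Program.run, NatExpr.eval]
    refine Runs.seq (T₁ := 35 * n) (T₂ := 63 * n) (Runs.forUp n (fun i s'' =>
      s''.nat vbest < n ∧ ∀ x < i, s'.realArr rCur x ≤ s'.realArr rCur (s''.nat vbest)) rfl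
      ?_ ?_ ?_ (c := 10) ?_) ?_ (by omega)
    · intro s'' h
      exact (h.nat 0 rfl).trans (by simpa using hn')
    · simp; omega
    · rintro i s'' hi h hx ⟨hI1, hI2⟩
      have hcur : s''.realArr 0 = s'.realArr 0 := (h.realArr 0 rfl).trans (by simp)
      refine Runs.straight rfl ?_ (by simp [Program.size, NatExpr.cost, RealExpr.cost, Test.cost])
      simp only [vx, vbest, rCur] at hx hI1 hI2
      by_cases hle : s'.realArr 0 i ≤ s'.realArr 0 (s''.nat 6)
      · simp [hx, hcur, hle]
        refine ⟨hI1, fun x hxi => ?_⟩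
        rcases lt_or_eq_of_le hxi with hlt | rfl
        · exact hI2 x hlt
        · exact hle
      · simp [hx, hcur, hle]
        refine ⟨hi, fun x hxi => ?_⟩
        rcases lt_or_eq_of_le hxi with hlt | rfl
        · exact (hI2 x hlt).trans (not_le.1 hle).le
        · exact le_rfl
    · simp only [NatExpr.cost]; omega
    rintro s2 h2 ⟨hb, hmax⟩
    have hn2 : s2.nat 0 = n := (h2.nat 0 rfl).trans (by simpa using hn')
    have hi2 : s2.nat 3 = t := (h2.nat 3 rfl).trans (by simpa using hx)
    have hoff2 : s2.nat 5 = t * n := (h2.nat 5 rfl).trans (by simpa using hoff)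
    have hcen2 : s2.natArr 4 = s'.natArr 4 := (h2.natArr 4 rfl).trans (by simp)
    have htab2 : s2.natArr 5 = s'.natArr 5 := (h2.natArr 5 rfl).trans (by simp)
    have hnear2 : s2.natArr 6 = s'.natArr 6 := (h2.natArr 6 rfl).trans (by simp)
    have hcur2 : s2.realArr 0 = s'.realArr 0 := (h2.realArr 0 rfl).trans (by simp)
    have hgap2 : s2.realArr 1 = s'.realArr 1 := (h2.realArr 1 rfl).trans (by simp)
    simp only [vbest, rCur] at hb hmax
    generalize hbb : s2.nat 6 = b at hb hmax
    simp only [aCen, aTab, rGap, aNear, rCur] at hG hrow ⊢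
    have hmul : (t + 1) * n = t * n + n := by ring
    refine Runs.straight_seq (T₂ := 48 * n) rfl ?_
      (by simp only [Program.size, NatExpr.cost, RealExpr.cost]; omega)
    simp only [Program.run, NatExpr.eval, RealExpr.eval]
    generalize hs3 : State.setNat _ voff _ = s3
    have hn3 : s3.nat 0 = n := by rw [← hs3]; simpa using hn2
    have hi3 : s3.nat 3 = t := by rw [← hs3]; simpa using hi2
    have hb3 : s3.nat 6 = b := by rw [← hs3]; simpa using hbb
    have hoff3 : s3.nat 5 = (t + 1) * n := by rw [← hs3]; simp [hoff2, hn2, hmul]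
    have hcen3 : s3.natArr 4 = Function.update (s'.natArr 4) (t + 1) b := by
      rw [← hs3]; simp [hcen2, hi2, hbb]
    have htab3 : s3.natArr 5 = s'.natArr 5 := by rw [← hs3]; simpa using htab2
    have hnear3 : s3.natArr 6 = s'.natArr 6 := by rw [← hs3]; simpa using hnear2
    have hcur3 : s3.realArr 0 = s'.realArr 0 := by rw [← hs3]; simpa using hcur2
    have hgap3 : s3.realArr 1 = Function.update (s'.realArr 1) (t + 1) (s'.realArr 0 b) := by
      rw [← hs3]; simp [hgap2, hcur2, hi2, hbb]
    clear hs3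
    refine Runs.mono (Runs.forUp n (fun i s'' =>
      (∀ j < (t + 1) * n, s''.natArr 5 j = s'.natArr 5 j) ∧
      (∀ x < i, s''.natArr 5 ((t + 1) * n + x) = s''.natArr 6 x) ∧
      (∀ x < n, s''.natArr 6 x = if x < i ∧ D x b < s'.realArr 0 x then t + 1
        else s'.natArr 6 x) ∧
      (∀ x < n, s''.realArr 0 x = if x < i ∧ D x b < s'.realArr 0 x then D x b
        else s'.realArr 0 x)) rfl ?_ ?_ ?_ (c := 26) le_rfl) ?_ ?_
    · intro s'' h
      exact (h.nat 0 rfl).trans hn3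
    · simp [htab3, hnear3, hcur3]
    · rintro i s'' hi h hx ⟨I1, I2, I3, I4⟩
      have hi4 : s''.nat 3 = t := (h.nat 3 rfl).trans hi3
      have hb4 : s''.nat 6 = b := (h.nat 6 rfl).trans hb3
      have hoff4 : s''.nat 5 = (t + 1) * n := (h.nat 5 rfl).trans hoff3
      have hci : s''.realArr 0 i = s'.realArr 0 i := by rw [I4 i hi]; simp
      have hni : s''.natArr 6 i = s'.natArr 6 i := by rw [I3 i hi]; simp
      simp only [vx] at hx
      refine Runs.straight rfl ?_ (by simp [Program.size, NatExpr.cost, RealExpr.cost, Test.cost])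
      generalize hs4 : Program.run D _ s'' = s4
      have e5 : s4.natArr 5 = Function.update (s''.natArr 5) ((t + 1) * n + i)
          (if D i b < s'.realArr 0 i then t + 1 else s'.natArr 6 i) := by
        rw [← hs4]
        by_cases hle : s'.realArr 0 i ≤ D i b
        · simp [hx, hb4, hci, hni, hle, hoff4, not_lt.2 hle]
        · simp [hx, hb4, hci, hi4, hle, hoff4, not_le.1 hle]
      have e6 : s4.natArr 6 = Function.update (s''.natArr 6) i
          (if D i b < s'.realArr 0 i then t + 1 else s'.natArr 6 i) := by
        rw [← hs4]
        by_cases hle : s'.realArr 0 i ≤ D i b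
        · simp [hx, hb4, hci, ← hni, hle, not_lt.2 hle]
        · simp [hx, hb4, hci, hi4, hle, not_le.1 hle]
      have e0 : s4.realArr 0 = Function.update (s''.realArr 0) i
          (if D i b < s'.realArr 0 i then D i b else s'.realArr 0 i) := by
        rw [← hs4]
        by_cases hle : s'.realArr 0 i ≤ D i b
        · simp only [not_lt.2 hle, if_false]
          rw [← hci, Function.update_eq_self]
          simp [hx, hb4, hci, hle]
        · simp [hx, hb4, hci, hle, not_le.1 hle]
      simp only [State.natArr_setNat, State.realArr_setNat, e5, e6, e0]
      refine ⟨fun j hj => ?_, fun x hxi => ?_, fun x hx' => ?_, fun x hx' => ?_⟩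
      · rw [Function.update_of_ne (by omega)]
        exact I1 j hj
      · rcases Nat.lt_succ_iff_lt_or_eq.1 hxi with hlt | rfl
        · rw [Function.update_of_ne (by omega), Function.update_of_ne hlt.ne]
          exact I2 x hlt
        · simp
      · rcases eq_or_ne x i with rfl | hne
        · simp
        · rw [Function.update_of_ne hne, I3 x hx']
          have : x < i + 1 ↔ x < i := by omega
          simp only [this]
      · rcases eq_or_ne x i with rfl | hne
        · simp
        · rw [Function.update_of_ne hne, I4 x hx']
          have : x < i + 1 ↔ x < i := by omega
          simp only [this]
    · rintro s4 h4 ⟨I1, I2, I3, I4⟩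
      have hcen4 : s4.natArr 4 = Function.update (s'.natArr 4) (t + 1) b :=
        (h4.natArr 4 rfl).trans hcen3
      have hgap4 : s4.realArr 1 = Function.update (s'.realArr 1) (t + 1) (s'.realArr 0 b) :=
        (h4.realArr 1 rfl).trans hgap3
      have hoff4 : s4.nat 5 = (t + 1) * n := (h4.nat 5 rfl).trans hoff3
      have hG' := hG.succ (cur := s'.realArr 0) (tab' := s4.natArr 5) (fun x hx => (hrow x hx).1)
        (fun x hx => (hrow x hx).2) hb hmax I1 (fun x hx => by
          rw [I2 x hx, I3 x hx]
          simp only [hx, true_and])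
      simp only [State.natArr_setNat, State.realArr_setNat, State.nat_setNat, hcen4, hgap4]
      refine ⟨hG', by simpa using hoff4, fun x hx => ⟨(I2 x hx).symm, ?_⟩⟩
      rw [I4 x hx, I3 x hx]
      by_cases hlt : D x b < s'.realArr 0 x
      · simp [hx, hlt]
      · simp only [hlt, and_false, if_false]
        have hle : s'.natArr 6 x ≤ t := by
          rw [(hrow x hx).1]
          exact hG.tab_le t le_rfl x hx
        rw [Function.update_of_ne (by omega)]
        exact (hrow x hx).2
    · simp only [NatExpr.cost]; omega
  · rintro s' - ⟨h1, h2, -⟩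
    exact ⟨h1, h2⟩
  · simp only [NatExpr.cost]
    have h3 : (k - 1) * (100 * n + (1 + 1 + 1) + 8) ≤ k * (111 * n) :=
      Nat.mul_le_mul (by omega) (by omega)
    have h4 : k * (111 * n) = 111 * (n * k) := by ring
    omega


/-! ### Candidates for the bottleneck distance -/

/-- The point `x` may be put into row `q` for center `j`: its group has a lower bound, or `q < k`
and its group has room, and it does not occur in an earlier row for `j`. -/
def Eligible (N : Network) (k : ℕ) (row : ℕ → ℕ) (q j x : ℕ) : Prop :=
  x < N.n ∧ N.act x = j ∧ (1 ≤ N.l (N.grp x) ∨ (q < k ∧ 1 ≤ N.u (N.grp x))) ∧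
    ∀ q' < q, row (q' * k + j) < N.n → N.grp (row (q' * k + j)) ≠ N.grp x

/-- Entry `j` of row `q` is the closest eligible point, if there is one. -/
structure RowEntry (D : ℕ → ℕ → ℝ) (cen : ℕ → ℕ) (N : Network) (k : ℕ) (row : ℕ → ℕ) (q j : ℕ) :
    Prop where
  eligible : row (q * k + j) < N.n → Eligible N k row q j (row (q * k + j))
  closest : row (q * k + j) < N.n → ∀ x, Eligible N k row q j x →
    D (row (q * k + j)) (cen j) ≤ D x (cen j)
  none : ¬ row (q * k + j) < N.n → ∀ x, ¬ Eligible N k row q j x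

/-- Eligibility in row `q` reads only cells below `q * k`, so it is not disturbed while row `q` is
being filled. -/
theorem eligible_congr {N : Network} {k : ℕ} {row row' : ℕ → ℕ} {q j x : ℕ} (hj : j < k)
    (h : ∀ i < q * k, row' i = row i) : Eligible N k row' q j x ↔ Eligible N k row q j x := by
  refine and_congr_right fun _ => and_congr_right fun _ => and_congr_right fun _ =>
    forall₂_congr fun q' hq' => ?_
  have : (q' + 1) * k ≤ q * k := Nat.mul_le_mul_right _ hq'
  rw [Nat.add_mul] at this
  rw [h _ (by omega)]

theorem RowEntry.congr {D : ℕ → ℕ → ℝ} {cen : ℕ → ℕ} {N : Network} {k : ℕ} {row row' : ℕ → ℕ}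
    {q j : ℕ} (hr : RowEntry D cen N k row q j) (hj : j < k)
    (h : ∀ i < (q + 1) * k, row' i = row i) : RowEntry D cen N k row' q j := by
  have hmul : (q + 1) * k = q * k + k := by ring
  have he : row' (q * k + j) = row (q * k + j) := h _ (by omega)
  have hc : ∀ x, Eligible N k row' q j x ↔ Eligible N k row q j x := fun x =>
    eligible_congr hj fun i hi => h i (by omega)
  refine ⟨fun h1 => ?_, fun h1 x hx => ?_, fun h1 x hx => ?_⟩
  · rw [hc, he]; exact hr.eligible (he ▸ h1)
  · rw [he]; exact hr.closest (he ▸ h1) x ((hc x).1 hx)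
  · exact hr.none (he ▸ h1) x ((hc x).1 hx)

def fillRow : Program :=
  forUp vx (.var vk) (.putNat aRow (.plus (.var voff) (.var vx)) (.var vn)) ;;
  forUp vx (.var vn) (.when
    (.and (.natLt (.get aBase (.var vx)) (.var vp)) (.and (.natLe (.get aUsed (.var vx)) (.lit 0))
      (.and (.or (.natLe (.lit 1) (.get aL (.get aGrp (.var vx))))
          (.and (.natLt (.var vi) (.var vk)) (.natLe (.lit 1) (.get aU (.get aGrp (.var vx))))))
        (.or (.natLe (.var vn) (.get aRow (.plus (.var voff) (.get aBase (.var vx)))))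
          (.not (.realLe
            (.dist (.get aRow (.plus (.var voff) (.get aBase (.var vx))))
              (.get aCen (.get aBase (.var vx))))
            (.dist (.var vx) (.get aCen (.get aBase (.var vx))))))))))
    (.putNat aRow (.plus (.var voff) (.get aBase (.var vx))) (.var vx))) ;;
  forUp vx (.var vn) (.when
    (.and (.natLt (.get aBase (.var vx)) (.var vp))
      (.and (.natLt (.get aRow (.plus (.var voff) (.get aBase (.var vx)))) (.var vn))
        (.and (.natLe (.get aGrp (.get aRow (.plus (.var voff) (.get aBase (.var vx)))))
            (.get aGrp (.var vx)))
          (.natLe (.get aGrp (.var vx))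
            (.get aGrp (.get aRow (.plus (.var voff) (.get aBase (.var vx)))))))))
    (.putNat aUsed (.var vx) (.lit 1)))

/-- The network of the points in the balls, before thresholds are applied. -/
def baseNet (s : State) : Network := { net s with act := s.natArr aBase }

theorem Same.baseNet {P : Program} {s s' : State} (h : Same P s s') (h0 : P.wNat vn = false)
    (h1 : P.wNat vm = false) (h2 : P.wNat vp = false) (h3 : P.wNat vF = false)
    (h4 : P.wNatArr aGrp = false) (h5 : P.wNatArr aL = false) (h6 : P.wNatArr aU = false)
    (h7 : P.wNatArr aBase = false) : baseNet s' = baseNet s := by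
  simp only [FairKCenter.baseNet, FairKCenter.net, h.nat _ h0, h.nat _ h1, h.nat _ h2, h.nat _ h3,
    h.natArr _ h4, h.natArr _ h5, h.natArr _ h6, h.natArr _ h7]

/-- The flags of the points whose group occurs in the first `q` rows. -/
def UsedFlags (N : Network) (k : ℕ) (row used : ℕ → ℕ) (q : ℕ) : Prop :=
  ∀ x < N.n, N.act x < N.p → (used x ≠ 0 ↔ ∃ q' < q, row (q' * k + N.act x) < N.n ∧
    N.grp (row (q' * k + N.act x)) = N.grp x)

/-- One flag per point summarizes all earlier rows. This is what lets a row be filled in `O(n)`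
rather than `O(nk)` time. -/
theorem UsedFlags.eligible_iff {N : Network} {k : ℕ} {row used : ℕ → ℕ} {q x : ℕ}
    (h : UsedFlags N k row used q) (hx : x < N.n) (hp : N.act x < N.p) :
    Eligible N k row q (N.act x) x ↔
      used x = 0 ∧ (1 ≤ N.l (N.grp x) ∨ (q < k ∧ 1 ≤ N.u (N.grp x))) := by
  have := (not_congr (h x hx hp))
  simp only [not_exists, not_and, ne_eq, not_not] at this
  unfold Eligible
  rw [this]
  simp only [hx, true_and]
  exact and_comm

theorem fillRow_runs {D : ℕ → ℕ → ℝ} {s : State} {N : Network} {k q T : ℕ} {cen : ℕ → ℕ}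
    (hN : baseNet s = N) (hk : s.nat vk = k) (hcen : s.natArr aCen = cen) (hs : Sane N k)
    (hq : s.nat vi = q) (hoff : s.nat voff = q * k)
    (hused : UsedFlags N k (s.natArr aRow) (s.natArr aUsed) q) (hT : 200 * N.n ≤ T) :
    Runs D fillRow s (fun s' => (∀ i < q * k, s'.natArr aRow i = s.natArr aRow i) ∧
      (∀ j < N.p, RowEntry D cen N k (s'.natArr aRow) q j) ∧
      UsedFlags N k (s'.natArr aRow) (s'.natArr aUsed) (q + 1)) T := by
  have hn : 1 ≤ N.n := hs.k_pos.trans hs.k_le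
  have hkn := hs.k_le
  have hpk := hs.p_le
  set row0 := s.natArr aRow with hrow0
  -- clearing
  refine Runs.seq (T₁ := 25 * N.n) (T₂ := 170 * N.n) (Runs.forUp k (fun i s' =>
    (∀ j < q * k, s'.natArr aRow j = row0 j) ∧ ∀ j < i, s'.natArr aRow (q * k + j) = N.n) rfl
    ?_ ?_ ?_ (c := 5) ?_) ?_ (by omega)
  · intro s' h
    exact (h.nat 2 rfl).trans hk
  · exact ⟨fun _ _ => rfl, by omega⟩
  · rintro i s' hi h hx ⟨h1, h2⟩
    refine Runs.straight rfl ?_ (by simp [Program.size, NatExpr.cost])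
    have hn' : s'.nat 0 = N.n := (h.nat 0 rfl).trans (congrArg Network.n hN)
    have hoff' : s'.nat 5 = q * k := (h.nat 5 rfl).trans hoff
    simp only [vx, aRow] at hx h1 h2
    simp only [Program.run, NatExpr.eval, State.natArr_setNat, State.natArr_putNat, if_true,
      voff, vx, vn, aRow, hx, hn', hoff']
    refine ⟨fun j hj => ?_, fun j hj => ?_⟩
    · rw [Function.update_of_ne (by omega)]
      exact h1 j hj
    · rcases Nat.lt_succ_iff_lt_or_eq.1 hj with hlt | rfl
      · rw [Function.update_of_ne (by omega)]
        exact h2 j hlt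
      · rw [Function.update_self]
  · simp only [NatExpr.cost]; omega
  rintro s1 h1 ⟨hr1, hz1⟩
  have hN1 : baseNet s1 = N := (h1.baseNet rfl rfl rfl rfl rfl rfl rfl rfl).trans hN
  have hk1 : s1.nat vk = k := (h1.nat _ rfl).trans hk
  have hq1 : s1.nat vi = q := (h1.nat _ rfl).trans hq
  have hcen1 : s1.natArr aCen = cen := (h1.natArr _ rfl).trans hcen
  have hoff1 : s1.nat voff = q * k := (h1.nat _ rfl).trans hoff
  have hused1 : s1.natArr aUsed = s.natArr aUsed := h1.natArr _ rfl
  set used0 := s.natArr aUsed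
  -- scanning
  refine Runs.seq (T₁ := 90 * N.n) (T₂ := 80 * N.n) (Runs.forUp N.n (fun i s' =>
    (∀ j < q * k, s'.natArr aRow j = row0 j) ∧
    ∀ j < N.p, (s'.natArr aRow (q * k + j) < N.n →
        Eligible N k row0 q j (s'.natArr aRow (q * k + j)) ∧
        ∀ x < i, Eligible N k row0 q j x →
          D (s'.natArr aRow (q * k + j)) (cen j) ≤ D x (cen j)) ∧
      (¬ s'.natArr aRow (q * k + j) < N.n → ∀ x < i, ¬ Eligible N k row0 q j x)) rfl
    ?_ ?_ ?_ (c := 60) ?_) ?_ (by omega)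
  · intro s' h
    exact (h.nat 0 rfl).trans (congrArg Network.n hN1)
  · refine ⟨hr1, fun j hj => ⟨fun h => ?_, fun _ => by omega⟩⟩
    have := hz1 j (by omega)
    simp only [aRow, State.natArr_setNat] at this h
    omega
  · rintro i s' hi h hx ⟨I1, I2⟩
    have hN' : baseNet s' = N := (h.baseNet rfl rfl rfl rfl rfl rfl rfl rfl).trans hN1
    have en : s'.nat 0 = N.n := congrArg Network.n hN'
    have ep : s'.nat 7 = N.p := congrArg Network.p hN'
    have egrp : s'.natArr 0 = N.grp := congrArg Network.grp hN'
    have el : s'.natArr 1 = N.l := congrArg Network.l hN'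
    have eu : s'.natArr 2 = N.u := congrArg Network.u hN'
    have ea : s'.natArr 18 = N.act := congrArg Network.act hN'
    have ek : s'.nat 2 = k := (h.nat 2 rfl).trans hk1
    have eq : s'.nat 3 = q := (h.nat 3 rfl).trans hq1
    have eoff : s'.nat 5 = q * k := (h.nat 5 rfl).trans hoff1
    have ecen : s'.natArr 4 = cen := (h.natArr 4 rfl).trans hcen1
    have eused : s'.natArr 19 = used0 := (h.natArr 19 rfl).trans hused1
    simp only [vx] at hx
    refine Runs.ite (T₁ := 6) (T₂ := 1) (fun hb => ?_) (fun hb => ?_)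
      (by simp [Test.cost, NatExpr.cost, RealExpr.cost])
    · simp only [Test.Holds, NatExpr.eval, RealExpr.eval, vx, vp, vn, vi, vk, voff, aBase, aUsed,
        aL, aU, aGrp, aRow, aCen, en, ep, egrp, el, eu, ea, ek, eq, eoff, ecen, eused, hx,
        not_le, Nat.le_zero] at hb
      obtain ⟨b1, b2, b3, b4⟩ := hb
      have hel : Eligible N k row0 q (N.act i) i := (hused.eligible_iff hi b1).2 ⟨b2, b3⟩
      refine Runs.straight rfl ?_ (by simp [Program.size, NatExpr.cost])
      simp only [aRow] at I1 I2
      simp only [Program.run, NatExpr.eval, State.natArr_setNat, State.natArr_putNat, if_true,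
        voff, vx, aBase, aRow, hx, eoff, ea]
      refine ⟨fun j hj => ?_, fun j hj => ?_⟩
      · rw [Function.update_of_ne (by omega)]
        exact I1 j hj
      · rcases eq_or_ne j (N.act i) with rfl | hne
        · rw [Function.update_self]
          refine ⟨fun _ => ⟨hel, fun x hxi hxe => ?_⟩, fun h => absurd hi h⟩
          rcases Nat.lt_succ_iff_lt_or_eq.1 hxi with hlt | rfl
          · obtain ⟨I3, I4⟩ := I2 _ b1
            rcases b4 with b4 | b4
            · exact absurd hxe (I4 (not_lt.2 b4) x hlt)
            · by_cases hv : s'.natArr 20 (q * k + N.act i) < N.n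
              · exact b4.le.trans ((I3 hv).2 x hlt hxe)
              · exact absurd hxe (I4 hv x hlt)
          · exact le_rfl
        · rw [Function.update_of_ne (by omega)]
          obtain ⟨I3, I4⟩ := I2 j hj
          refine ⟨fun hv => ⟨(I3 hv).1, fun x hxi hxe => ?_⟩, fun hv x hxi hxe => ?_⟩
          · rcases Nat.lt_succ_iff_lt_or_eq.1 hxi with hlt | rfl
            · exact (I3 hv).2 x hlt hxe
            · exact absurd hxe.2.1.symm hne
          · rcases Nat.lt_succ_iff_lt_or_eq.1 hxi with hlt | rfl
            · exact I4 hv x hlt hxe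
            · exact absurd hxe.2.1.symm hne
    · simp only [Test.Holds, NatExpr.eval, RealExpr.eval, vx, vp, vn, vi, vk, voff, aBase, aUsed,
        aL, aU, aGrp, aRow, aCen, en, ep, egrp, el, eu, ea, ek, eq, eoff, ecen, eused, hx,
        not_le, Nat.le_zero] at hb
      refine Runs.straight rfl ?_ (by simp [Program.size])
      simp only [aRow] at I1 I2
      simp only [Program.run, State.natArr_setNat, aRow]
      refine ⟨I1, fun j hj => ?_⟩
      obtain ⟨I3, I4⟩ := I2 j hj
      refine ⟨fun hv => ⟨(I3 hv).1, fun x hxi hxe => ?_⟩, fun hv x hxi hxe => ?_⟩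
      · rcases Nat.lt_succ_iff_lt_or_eq.1 hxi with hlt | rfl
        · exact (I3 hv).2 x hlt hxe
        · obtain rfl := hxe.2.1
          obtain ⟨b2, b3⟩ := (hused.eligible_iff hi hj).1 hxe
          by_contra! hc
          exact hb ⟨hj, b2, b3, Or.inr hc⟩
      · rcases Nat.lt_succ_iff_lt_or_eq.1 hxi with hlt | rfl
        · exact I4 hv x hlt hxe
        · obtain rfl := hxe.2.1
          obtain ⟨b2, b3⟩ := (hused.eligible_iff hi hj).1 hxe
          exact hb ⟨hj, b2, b3, Or.inl (not_lt.1 hv)⟩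
  · simp only [NatExpr.cost]; omega
  rintro s2 h2 ⟨hr2, hE2⟩
  have hN2 : baseNet s2 = N := (h2.baseNet rfl rfl rfl rfl rfl rfl rfl rfl).trans hN1
  have hoff2 : s2.nat voff = q * k := (h2.nat _ rfl).trans hoff1
  have hused2 : s2.natArr aUsed = used0 := (h2.natArr _ rfl).trans hused1
  have hentry : ∀ j < N.p, RowEntry D cen N k (s2.natArr aRow) q j := by
    intro j hj
    obtain ⟨I3, I4⟩ := hE2 j hj
    have hc : ∀ x, Eligible N k (s2.natArr aRow) q j x ↔ Eligible N k row0 q j x := fun x =>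
      eligible_congr (by omega) hr2
    exact ⟨fun hv => (hc _).2 (I3 hv).1, fun hv x hx => (I3 hv).2 x hx.1 ((hc x).1 hx),
      fun hv x hx => I4 hv x hx.1 ((hc x).1 hx)⟩
  generalize hrow2 : s2.natArr aRow = row2 at hr2 hentry
  -- marking
  refine Runs.mono (Runs.forUp N.n (fun i s' => ∀ x < N.n, N.act x < N.p →
    (s'.natArr aUsed x ≠ 0 ↔ used0 x ≠ 0 ∨ (x < i ∧ row2 (q * k + N.act x) < N.n ∧
      N.grp (row2 (q * k + N.act x)) = N.grp x))) rfl ?_ ?_ ?_ (c := 50) le_rfl) ?_ ?_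
  · intro s' h
    exact (h.nat 0 rfl).trans (congrArg Network.n hN2)
  · intro x hx hp
    simp only [aUsed] at hused2
    simp [hused2]
  · intro i s' hi h hx hI
    have hN' : baseNet s' = N := (h.baseNet rfl rfl rfl rfl rfl rfl rfl rfl).trans hN2
    have en : s'.nat 0 = N.n := congrArg Network.n hN'
    have ep : s'.nat 7 = N.p := congrArg Network.p hN'
    have egrp : s'.natArr 0 = N.grp := congrArg Network.grp hN'
    have ea : s'.natArr 18 = N.act := congrArg Network.act hN'
    have eoff : s'.nat 5 = q * k := (h.nat 5 rfl).trans hoff2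
    have erow : s'.natArr 20 = row2 := (h.natArr 20 rfl).trans hrow2
    simp only [vx, aUsed] at hx hI
    refine Runs.ite (T₁ := 3) (T₂ := 1) (fun hb => ?_) (fun hb => ?_)
      (by simp [Test.cost, NatExpr.cost])
    · simp only [Test.Holds, NatExpr.eval, vx, vp, vn, voff, aBase, aGrp, aRow, en, ep, egrp, ea,
        eoff, erow, hx, not_le] at hb
      obtain ⟨b1, b2, b3, b4⟩ := hb
      refine Runs.straight rfl ?_ (by simp [Program.size, NatExpr.cost])
      intro x hxn hxp
      simp only [Program.run, NatExpr.eval, State.natArr_setNat, State.natArr_putNat, if_true,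
        vx, aUsed, hx]
      rcases eq_or_ne x i with rfl | hne
      · rw [Function.update_self]
        simp only [ne_eq, one_ne_zero, not_false_eq_true, true_iff]
        exact Or.inr ⟨by omega, b2, le_antisymm b3 b4⟩
      · rw [Function.update_of_ne hne, hI x hxn hxp]
        have : x < i + 1 ↔ x < i := by omega
        rw [this]
    · simp only [Test.Holds, NatExpr.eval, vx, vp, vn, voff, aBase, aGrp, aRow, en, ep, egrp, ea,
        eoff, erow, hx, not_le] at hb
      refine Runs.straight rfl ?_ (by simp [Program.size])
      intro x hxn hxp
      simp only [Program.run, State.natArr_setNat, aUsed]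
      rcases eq_or_ne x i with rfl | hne
      · rw [hI x hxn hxp]
        refine or_congr_right ⟨fun h => absurd h.1 (lt_irrefl _), fun h => ?_⟩
        exact absurd ⟨hxp, h.2.1, h.2.2.le, h.2.2.ge⟩ hb
      · rw [hI x hxn hxp]
        have : x < i + 1 ↔ x < i := by omega
        rw [this]
  · intro s3 h3 hI
    have hrow3 : s3.natArr aRow = row2 := (h3.natArr _ rfl).trans hrow2
    rw [hrow3]
    refine ⟨hr2, hentry, fun x hx hxp => ?_⟩
    rw [hI x hx hxp, hused x hx hxp]
    have hrows : ∀ q' < q, row2 (q' * k + N.act x) = row0 (q' * k + N.act x) := fun q' hq' => by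
      have : (q' + 1) * k ≤ q * k := Nat.mul_le_mul_right _ hq'
      rw [Nat.add_mul] at this
      exact hr2 _ (by omega)
    constructor
    · rintro (⟨q', hq', h1, h2⟩ | ⟨-, h1, h2⟩)
      · exact ⟨q', by omega, by rw [hrows q' hq']; exact ⟨h1, h2⟩⟩
      · exact ⟨q, by omega, h1, h2⟩
    · rintro ⟨q', hq', h1, h2⟩
      rcases Nat.lt_succ_iff_lt_or_eq.1 hq' with hlt | rfl
      · rw [hrows q' hlt] at h1 h2
        exact Or.inl ⟨q', hlt, h1, h2⟩
      · exact Or.inr ⟨hx, h1, h2⟩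
  · simp only [NatExpr.cost]; omega

/-- Fills `2 * k` rows and marks their end. -/
def fillRows : Program :=
  .setNat voff (.lit 0) ;;
  forUp vx (.var vn) (.putNat aUsed (.var vx) (.lit 0)) ;;
  forUp vi (.plus (.var vk) (.var vk)) (fillRow ;; .setNat voff (.plus (.var voff) (.var vk))) ;;
  forUp vx (.var vk) (.putNat aRow (.plus (.var voff) (.var vx)) (.var vn))

theorem fillRows_runs {D : ℕ → ℕ → ℝ} {s : State} {N : Network} {k T : ℕ} {cen : ℕ → ℕ}
    (hN : baseNet s = N) (hk : s.nat vk = k) (hcen : s.natArr aCen = cen) (hs : Sane N k)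
    (hT : 500 * (N.n * k) ≤ T) :
    Runs D fillRows s (fun s' => (∀ q < 2 * k, ∀ j < N.p, RowEntry D cen N k (s'.natArr aRow) q j) ∧
      ∀ j < N.p, s'.natArr aRow (2 * k * k + j) = N.n) T := by
  have hn : 1 ≤ N.n := hs.k_pos.trans hs.k_le
  have hkn := hs.k_le
  have hpk := hs.p_le
  have hnk : N.n ≤ N.n * k := Nat.le_mul_of_pos_right _ hs.k_pos
  refine Runs.straight_seq (T₂ := 495 * (N.n * k)) rfl ?_
    (by simp only [Program.size, NatExpr.cost]; omega)
  simp only [Program.run, NatExpr.eval]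
  have hN0 : baseNet (s.setNat voff 0) = N := by rw [← hN]; simp [baseNet, net]
  have hk0 : (s.setNat voff 0).nat vk = k := by simpa using hk
  have hcen0 : (s.setNat voff 0).natArr aCen = cen := by simpa using hcen
  have hoff0 : (s.setNat voff 0).nat voff = 0 := by simp
  generalize s.setNat voff 0 = s0 at hN0 hk0 hcen0 hoff0
  refine Runs.seq (T₁ := 25 * N.n) (T₂ := 468 * (N.n * k)) (Runs.forUp N.n
    (fun i s' => ∀ x < i, s'.natArr aUsed x = 0) rfl ?_ ?_ ?_ (c := 3) ?_) ?_ (by omega)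
  · intro s' h
    exact (h.nat 0 rfl).trans (congrArg Network.n hN0)
  · simp
  · intro i s' hi h hx hI
    refine Runs.straight rfl ?_ (by simp [Program.size, NatExpr.cost])
    intro x hxi
    simp only [vx, aUsed] at hx hI
    rcases Nat.lt_succ_iff_lt_or_eq.1 hxi with hlt | rfl
    · simp [hx, hlt.ne, hI x hlt]
    · simp [hx]
  · simp only [NatExpr.cost]; omega
  intro s1 h1 hu1
  have hN1 : baseNet s1 = N := (h1.baseNet rfl rfl rfl rfl rfl rfl rfl rfl).trans hN0
  have hk1 : s1.nat vk = k := (h1.nat _ rfl).trans hk0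
  have hcen1 : s1.natArr aCen = cen := (h1.natArr _ rfl).trans hcen0
  have hoff1 : s1.nat voff = 0 := (h1.nat _ rfl).trans hoff0
  refine Runs.seq (T₁ := 442 * (N.n * k)) (T₂ := 25 * N.n) (Runs.forUp (2 * k)
    (fun q s' => s'.nat voff = q * k ∧ UsedFlags N k (s'.natArr aRow) (s'.natArr aUsed) q ∧
      ∀ q' < q, ∀ j < N.p, RowEntry D cen N k (s'.natArr aRow) q' j) rfl ?_ ?_ ?_
    (c := 204 * N.n) ?_) ?_ (by omega)
  · intro s' h
    have ek : s'.nat 2 = k := (h.nat 2 rfl).trans hk1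
    simp [ek]; omega
  · refine ⟨by simpa using hoff1, fun x hx hp => ?_, by omega⟩
    have := hu1 x hx
    simp only [aUsed] at this
    simp [this]
  · rintro q s' hq h hx ⟨I1, I2, I3⟩
    have hN' : baseNet s' = N := (h.baseNet rfl rfl rfl rfl rfl rfl rfl rfl).trans hN1
    have hk' : s'.nat vk = k := (h.nat _ rfl).trans hk1
    have hcen' : s'.natArr aCen = cen := (h.natArr _ rfl).trans hcen1
    refine Runs.seq (T₁ := 200 * N.n) (T₂ := 4) (fillRow_runs hN' hk' hcen' hs hx I1 I2 le_rfl) ?_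
      (by omega)
    rintro s2 h2 ⟨J1, J2, J3⟩
    have hk2 : s2.nat 2 = k := (h2.nat _ rfl).trans hk'
    have hoff2 : s2.nat 5 = q * k := (h2.nat _ rfl).trans I1
    refine Runs.straight rfl ?_ (by simp [Program.size, NatExpr.cost])
    refine ⟨by simp [hk2, hoff2]; ring, by simpa using J3, fun q' hq' j hj => ?_⟩
    have : RowEntry D cen N k (s2.natArr aRow) q' j := by
      rcases Nat.lt_succ_iff_lt_or_eq.1 hq' with hlt | rfl
      · refine (I3 q' hlt j hj).congr (by omega) fun i hi => J1 i (hi.trans_le ?_)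
        exact Nat.mul_le_mul_right _ hlt
      · exact J2 j hj
    simpa using this
  · simp only [NatExpr.cost]
    have e1 : 2 * k * (204 * N.n + (1 + 1 + 1) + 8) ≤ 2 * k * (215 * N.n) :=
      Nat.mul_le_mul_left _ (by omega)
    have e2 : 2 * k * (215 * N.n) = 430 * (N.n * k) := by ring
    omega
  rintro s2 h2 ⟨I1, -, I3⟩
  have hN2 : baseNet s2 = N := (h2.baseNet rfl rfl rfl rfl rfl rfl rfl rfl).trans hN1
  have hk2 : s2.nat vk = k := (h2.nat _ rfl).trans hk1
  refine Runs.mono (Runs.forUp k (fun i s' =>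
    (∀ j < 2 * k * k, s'.natArr aRow j = s2.natArr aRow j) ∧
      ∀ j < i, s'.natArr aRow (2 * k * k + j) = N.n) rfl ?_ ?_ ?_ (c := 5) le_rfl) ?_ ?_
  · intro s' h
    exact (h.nat 2 rfl).trans hk2
  · exact ⟨fun _ _ => rfl, by omega⟩
  · rintro i s' hi h hx ⟨h1, h2⟩
    refine Runs.straight rfl ?_ (by simp [Program.size, NatExpr.cost])
    have hn' : s'.nat 0 = N.n := (h.nat 0 rfl).trans (congrArg Network.n hN2)
    have hoff' : s'.nat 5 = 2 * k * k := (h.nat 5 rfl).trans I1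
    simp only [vx, aRow] at hx h1 h2
    simp only [Program.run, NatExpr.eval, State.natArr_setNat, State.natArr_putNat, if_true,
      voff, vx, vn, aRow, hx, hn', hoff']
    refine ⟨fun j hj => ?_, fun j hj => ?_⟩
    · rw [Function.update_of_ne (by omega)]
      exact h1 j hj
    · rcases Nat.lt_succ_iff_lt_or_eq.1 hj with hlt | rfl
      · rw [Function.update_of_ne (by omega)]
        exact h2 j hlt
      · rw [Function.update_self]
  · rintro s3 - ⟨h1, h2⟩
    refine ⟨fun q hq j hj => ?_, fun j hj => h2 j (by omega)⟩
    refine (I3 q hq j hj).congr (by omega) fun i hi => h1 i (hi.trans_le ?_)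
    exact Nat.mul_le_mul_right _ hq
  · simp only [NatExpr.cost]; omega


/-! ### Sorting the candidates -/

/-- `2 * k` rows of candidates, followed by an empty one. -/
structure Rows (D : ℕ → ℕ → ℝ) (cen : ℕ → ℕ) (N : Network) (k : ℕ) (row : ℕ → ℕ) : Prop where
  entry : ∀ q < 2 * k, ∀ j < N.p, RowEntry D cen N k row q j
  last : ∀ j < N.p, row (2 * k * k + j) = N.n

theorem Eligible.anti {N : Network} {k : ℕ} {row : ℕ → ℕ} {q q' j x : ℕ} (hq : q ≤ q')
    (h : Eligible N k row q' j x) : Eligible N k row q j x :=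
  ⟨h.1, h.2.1, h.2.2.1.imp_right fun h => ⟨by omega, h.2⟩,
    fun r hr => h.2.2.2 r (by omega)⟩

section Rows

variable {D : ℕ → ℕ → ℝ} {cen : ℕ → ℕ} {N : Network} {k : ℕ} {row : ℕ → ℕ}

/-- The row `2 * k` is an empty sentinel, so the merge needs no bounds test. -/
theorem Rows.lt_of_valid (h : Rows D cen N k row) {q j : ℕ} (hj : j < N.p) (hq : q ≤ 2 * k)
    (hv : row (q * k + j) < N.n) : q < 2 * k := by
  refine lt_of_le_of_ne hq ?_
  rintro rfl
  rw [h.last j hj] at hv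
  exact lt_irrefl _ hv

/-- What row `q'` holds was eligible in row `q` already, so that row is not empty there and its
entry is no farther. The columns are thus sorted by construction. -/
theorem Rows.valid_anti (h : Rows D cen N k row) {q q' j : ℕ} (hj : j < N.p) (hqq : q ≤ q')
    (hq : q' < 2 * k) (hv : row (q' * k + j) < N.n) :
    row (q * k + j) < N.n ∧ D (row (q * k + j)) (cen j) ≤ D (row (q' * k + j)) (cen j) := by
  have h1 := ((h.entry q' hq j hj).eligible hv).anti hqq
  have h2 : row (q * k + j) < N.n := by
    by_contra hn
    exact (h.entry q (by omega) j hj).none hn _ h1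
  exact ⟨h2, (h.entry q (by omega) j hj).closest h2 _ h1⟩

/-- A point is available to one center only, and the entries of one column have different groups.
Hence all candidates are distinct points. -/
theorem Rows.inj (h : Rows D cen N k row) {q q' j j' : ℕ} (hj : j < N.p) (hj' : j' < N.p)
    (hq : q < 2 * k) (hq' : q' < 2 * k) (hv : row (q * k + j) < N.n)
    (he : row (q * k + j) = row (q' * k + j')) : j = j' ∧ q = q' := by
  have h1 := (h.entry q hq j hj).eligible hv
  have h2 := (h.entry q' hq' j' hj').eligible (he ▸ hv)
  have hjj : j = j' := by rw [← h1.2.1, ← h2.2.1, he]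
  subst hjj
  refine ⟨rfl, ?_⟩
  rcases lt_trichotomy q q' with hlt | heq | hgt
  · exact absurd (congrArg N.grp he) (h2.2.2.2 q hlt hv)
  · exact heq
  · exact absurd (congrArg N.grp he.symm) (h1.2.2.2 q' hgt (he ▸ hv))

/-- The progress of the merge: `ρ j` entries of column `j` have been moved to the sorted list. -/
structure Merging (D : ℕ → ℕ → ℝ) (cen : ℕ → ℕ) (N : Network) (k : ℕ) (row ptr : ℕ → ℕ)
    (thr : ℕ → ℝ) (len : ℕ) (ρ : ℕ → ℕ) : Prop where
  ptr_eq : ∀ j < N.p, ptr j = ρ j * k + j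
  le : ∀ j < N.p, ρ j ≤ 2 * k
  valid : ∀ j < N.p, ∀ q < ρ j, row (q * k + j) < N.n
  len_eq : len = ∑ j ∈ Finset.range N.p, ρ j
  sorted : ∀ i i', i ≤ i' → i' < len → thr i ≤ thr i'
  head : ∀ i < len, ∀ j < N.p, row (ρ j * k + j) < N.n → thr i ≤ D (row (ρ j * k + j)) (cen j)
  cover : ∀ j < N.p, ∀ q < ρ j, ∃ i < len, thr i = D (row (q * k + j)) (cen j)

variable {ptr ρ : ℕ → ℕ} {thr : ℕ → ℝ} {len : ℕ}

/-- The merged entries are distinct points. With `O(k)` work per entry, the merge stays within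
`O(nk)`. -/
theorem Merging.len_le (h : Merging D cen N k row ptr thr len ρ) (hr : Rows D cen N k row) :
    len ≤ N.n := by
  have := Finset.card_le_card_of_injOn
    (s := (Finset.range N.p).sigma fun j => Finset.range (ρ j)) (t := Finset.range N.n)
    (fun t => row (t.2 * k + t.1)) (fun t ht => by
      simp only [Finset.coe_sigma, Set.mem_sigma_iff, Finset.mem_coe, Finset.mem_range] at ht ⊢
      exact h.valid _ ht.1 _ ht.2) (fun t ht t' ht' he => by
      obtain ⟨j, q⟩ := t
      obtain ⟨j', q'⟩ := t'
      simp only [Finset.coe_sigma, Set.mem_sigma_iff, Finset.mem_coe, Finset.mem_range] at ht ht' he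
      have h1 := h.le _ ht.1
      have h2 := h.le _ ht'.1
      obtain ⟨rfl, rfl⟩ := hr.inj ht.1 ht'.1 (by omega) (by omega) (h.valid _ ht.1 _ ht.2) he
      rfl)
  rw [Finset.card_sigma] at this
  simpa [h.len_eq] using this

/-- This second bound serves the search over thresholds: `2 * k` strides of length `k` reach the end
of the list. -/
theorem Merging.len_le' (h : Merging D cen N k row ptr thr len ρ) (hp : N.p ≤ k) :
    len ≤ 2 * k * k := by
  rw [h.len_eq]
  refine (Finset.sum_le_card_nsmul _ _ (2 * k) fun j hj => h.le j (Finset.mem_range.1 hj)).trans ?_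
  rw [Finset.card_range, smul_eq_mul, mul_comm]
  exact Nat.mul_le_mul_left _ hp

/-- The least head is at least every threshold listed so far and, since columns are sorted, at most
everything that remains. -/
theorem Merging.succ (h : Merging D cen N k row ptr thr len ρ) (hr : Rows D cen N k row) {b : ℕ}
    (hb : b < N.p) (hv : row (ρ b * k + b) < N.n)
    (hmin : ∀ j < N.p, row (ρ j * k + j) < N.n →
      D (row (ρ b * k + b)) (cen b) ≤ D (row (ρ j * k + j)) (cen j)) :
    Merging D cen N k row (Function.update ptr b (ptr b + k))
      (Function.update thr len (D (row (ρ b * k + b)) (cen b))) (len + 1)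
      (Function.update ρ b (ρ b + 1)) := by
  have hlt := hr.lt_of_valid hb (h.le b hb) hv
  have hthr : ∀ i < len, Function.update thr len (D (row (ρ b * k + b)) (cen b)) i = thr i :=
    fun i hi => Function.update_of_ne hi.ne _ _
  refine ⟨fun j hj => ?_, fun j hj => ?_, fun j hj q hq => ?_, ?_, fun i i' hi hi' => ?_,
    fun i hi j hj hvj => ?_, fun j hj q hq => ?_⟩
  · rcases eq_or_ne j b with rfl | hne
    · rw [Function.update_self, Function.update_self, h.ptr_eq j hj]; ring
    · rw [Function.update_of_ne hne, Function.update_of_ne hne, h.ptr_eq j hj]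
  · rcases eq_or_ne j b with rfl | hne
    · rw [Function.update_self]; exact hlt
    · rw [Function.update_of_ne hne]; exact h.le j hj
  · rcases eq_or_ne j b with rfl | hne
    · rw [Function.update_self] at hq
      rcases Nat.lt_succ_iff_lt_or_eq.1 hq with hq' | rfl
      · exact h.valid j hj q hq'
      · exact hv
    · rw [Function.update_of_ne hne] at hq
      exact h.valid j hj q hq
  · rw [h.len_eq, ← Finset.add_sum_erase _ _ (Finset.mem_range.2 hb),
      ← Finset.add_sum_erase _ (Function.update ρ b (ρ b + 1)) (Finset.mem_range.2 hb),
      Function.update_self, Finset.sum_congr rfl fun j hj =>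
        Function.update_of_ne (Finset.ne_of_mem_erase hj) _ _]
    ring
  · rcases Nat.lt_succ_iff_lt_or_eq.1 hi' with hlt' | rfl
    · rw [hthr i (by omega), hthr i' hlt']
      exact h.sorted i i' hi hlt'
    · rcases lt_or_eq_of_le hi with hlt' | rfl
      · rw [hthr i hlt', Function.update_self]
        exact h.head i hlt' b hb hv
      · exact le_rfl
  · have hrow : ∀ i < len, thr i ≤ D (row (Function.update ρ b (ρ b + 1) j * k + j)) (cen j) ∧
        D (row (ρ b * k + b)) (cen b) ≤
          D (row (Function.update ρ b (ρ b + 1) j * k + j)) (cen j) := by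
      intro i hi
      rcases eq_or_ne j b with rfl | hne
      · rw [Function.update_self] at hvj ⊢
        have h1 := hr.valid_anti hj (Nat.le_succ (ρ j)) (hr.lt_of_valid hj hlt hvj) hvj
        exact ⟨(h.head i hi j hj hv).trans h1.2, h1.2⟩
      · rw [Function.update_of_ne hne] at hvj ⊢
        exact ⟨h.head i hi j hj hvj, hmin j hj hvj⟩
    rcases Nat.lt_succ_iff_lt_or_eq.1 hi with hlt' | rfl
    · rw [hthr i hlt']
      exact (hrow i hlt').1
    · rw [Function.update_self]
      rcases eq_or_ne j b with rfl | hne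
      · rw [Function.update_self] at hvj ⊢
        exact (hr.valid_anti hj (Nat.le_succ (ρ j)) (hr.lt_of_valid hj hlt hvj) hvj).2
      · rw [Function.update_of_ne hne] at hvj ⊢
        exact hmin j hj hvj
  · have hold : q < ρ j → ∃ i < len + 1, Function.update thr len
        (D (row (ρ b * k + b)) (cen b)) i = D (row (q * k + j)) (cen j) := fun hq => by
      obtain ⟨i, hi, he⟩ := h.cover j hj q hq
      exact ⟨i, by omega, (hthr i hi).trans he⟩
    rcases eq_or_ne j b with rfl | hne
    · rw [Function.update_self] at hq
      rcases Nat.lt_succ_iff_lt_or_eq.1 hq with hq' | rfl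
      · exact hold hq'
      · exact ⟨len, by omega, Function.update_self _ _ _⟩
    · rw [Function.update_of_ne hne] at hq
      exact hold hq

end Rows

/-- Merges the columns of the rows into a sorted list of `vlen` thresholds. -/
def mergeRows : Program :=
  forUp vx (.var vp) (.putNat aPtr (.var vx) (.var vx)) ;;
  (.setNat vlen (.lit 0) ;; .setNat vflag (.lit 1)) ;;
  .loop (.natLe (.lit 1) (.var vflag))
    (.setNat vbest (.var vp) ;;
      forUp vx (.var vp) (.when
        (.and (.natLt (.get aRow (.get aPtr (.var vx))) (.var vn))
          (.or (.natLe (.var vp) (.var vbest))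
            (.not (.realLe (.dist (.get aRow (.get aPtr (.var vbest))) (.get aCen (.var vbest)))
              (.dist (.get aRow (.get aPtr (.var vx))) (.get aCen (.var vx)))))))
        (.setNat vbest (.var vx))) ;;
      .ite (.natLt (.var vbest) (.var vp))
        (.putReal rThr (.var vlen)
            (.dist (.get aRow (.get aPtr (.var vbest))) (.get aCen (.var vbest))) ;;
          .setNat vlen (.plus (.var vlen) (.lit 1)) ;;
          .putNat aPtr (.var vbest) (.plus (.get aPtr (.var vbest)) (.var vk)))
        (.setNat vflag (.lit 0)))

theorem mergeRows_runs {D : ℕ → ℕ → ℝ} {s : State} {N : Network} {k T : ℕ} {cen row : ℕ → ℕ}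
    (hN : baseNet s = N) (hk : s.nat vk = k) (hcen : s.natArr aCen = cen)
    (hrow : s.natArr aRow = row) (hs : Sane N k) (hr : Rows D cen N k row)
    (hT : 300 * (N.n * k) ≤ T) :
    Runs D mergeRows s (fun s' => s'.nat vlen ≤ 2 * k * k ∧
      (∀ i i', i ≤ i' → i' < s'.nat vlen → s'.realArr rThr i ≤ s'.realArr rThr i') ∧
      ∀ q < 2 * k, ∀ j < N.p, row (q * k + j) < N.n →
        ∃ i < s'.nat vlen, s'.realArr rThr i = D (row (q * k + j)) (cen j)) T := by
  have hn : 1 ≤ N.n := hs.k_pos.trans hs.k_le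
  have hk1 := hs.k_pos
  have hkn := hs.k_le
  have hpk := hs.p_le
  have hnk : N.n ≤ N.n * k := Nat.le_mul_of_pos_right _ hs.k_pos
  refine Runs.seq (T₁ := 25 * N.n) (T₂ := 275 * (N.n * k)) (Runs.forUp N.p
    (fun i s' => ∀ x < i, s'.natArr aPtr x = x) rfl ?_ ?_ ?_ (c := 3) ?_) ?_ (by omega)
  · intro s' h
    exact (h.nat 7 rfl).trans (congrArg Network.p hN)
  · simp
  · intro i s' hi h hx hI
    refine Runs.straight rfl ?_ (by simp [Program.size, NatExpr.cost])
    intro x hxi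
    simp only [vx, aPtr] at hx hI
    rcases Nat.lt_succ_iff_lt_or_eq.1 hxi with hlt | rfl
    · simp [hx, hlt.ne, hI x hlt]
    · simp [hx]
  · simp only [NatExpr.cost]; omega
  intro s1 h1 hp1
  have hN1 : baseNet s1 = N := (h1.baseNet rfl rfl rfl rfl rfl rfl rfl rfl).trans hN
  have hk1' : s1.nat vk = k := (h1.nat _ rfl).trans hk
  have hcen1 : s1.natArr aCen = cen := (h1.natArr _ rfl).trans hcen
  have hrow1 : s1.natArr aRow = row := (h1.natArr _ rfl).trans hrow
  refine Runs.straight_seq (T₂ := 270 * (N.n * k)) rfl ?_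
    (by simp only [Program.size, NatExpr.cost]; omega)
  simp only [Program.run, NatExpr.eval]
  -- At most `n` entries are moved, and one further round finds all columns empty.
  refine Runs.mono (Runs.loopRank (r := N.n + 1) (c := 100 * k) (fun r s' =>
    (∃ ρ, Merging D cen N k row (s'.natArr aPtr) (s'.realArr rThr) (s'.nat vlen) ρ ∧
      (s'.nat vflag = 0 → ∀ j < N.p, ¬ row (ρ j * k + j) < N.n)) ∧
    (s'.nat vflag ≠ 0 → N.n + 1 - s'.nat vlen ≤ r)) ?_ ?_ le_rfl) ?_ ?_
  · refine ⟨⟨fun _ => 0, ⟨fun j hj => ?_, by omega, by omega, by simp, by simp, by simp,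
      by omega⟩, by simp⟩, by simp⟩
    have := hp1 j hj
    simp only [aPtr] at this
    simp [this]
  · rintro r s' h ⟨⟨ρ, hM, -⟩, hr'⟩ hb
    simp only [Test.Holds, NatExpr.eval] at hb
    have hrr := hr' (by omega)
    have hN' : baseNet s' = N := (h.baseNet rfl rfl rfl rfl rfl rfl rfl rfl).trans (by
      rw [← hN1]; simp [baseNet, net])
    have ek : s'.nat 2 = k := (h.nat 2 rfl).trans (by simpa using hk1')
    have en : s'.nat 0 = N.n := congrArg Network.n hN'
    have ep : s'.nat 7 = N.p := congrArg Network.p hN'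
    have ecen : s'.natArr 4 = cen := (h.natArr 4 rfl).trans (by simpa using hcen1)
    have erow : s'.natArr 20 = row := (h.natArr 20 rfl).trans (by simpa using hrow1)
    refine Runs.straight_seq (T₂ := 98 * k) rfl ?_
      (by simp only [Program.size, NatExpr.cost]; omega)
    simp only [Program.run, NatExpr.eval]
    refine Runs.seq (T₁ := 60 * k) (T₂ := 38 * k) (Runs.forUp N.p (fun i s'' =>
      (s''.nat vbest < N.p → row (ρ (s''.nat vbest) * k + s''.nat vbest) < N.n ∧
        ∀ j < i, row (ρ j * k + j) < N.n →
          D (row (ρ (s''.nat vbest) * k + s''.nat vbest)) (cen (s''.nat vbest)) ≤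
            D (row (ρ j * k + j)) (cen j)) ∧
      (¬ s''.nat vbest < N.p → ∀ j < i, ¬ row (ρ j * k + j) < N.n)) rfl ?_ ?_ ?_ (c := 35) ?_) ?_
      (by omega)
    · intro s'' h
      exact (h.nat 7 rfl).trans (by simpa using ep)
    · simp [ep]
    · rintro i s'' hi h hx ⟨I1, I2⟩
      have en2 : s''.nat 0 = N.n := (h.nat 0 rfl).trans (by simpa using en)
      have ep2 : s''.nat 7 = N.p := (h.nat 7 rfl).trans (by simpa using ep)
      have ecen2 : s''.natArr 4 = cen := (h.natArr 4 rfl).trans (by simpa using ecen)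
      have erow2 : s''.natArr 20 = row := (h.natArr 20 rfl).trans (by simpa using erow)
      have eptr2 : s''.natArr 21 = s'.natArr 21 := (h.natArr 21 rfl).trans (by simp)
      have hpi := hM.ptr_eq i hi
      simp only [vx, vbest, aPtr] at hx I1 I2 hpi
      refine Runs.ite (T₁ := 2) (T₂ := 1) (fun hb => ?_) (fun hb => ?_)
        (by simp [Test.cost, NatExpr.cost, RealExpr.cost])
      · simp only [Test.Holds, NatExpr.eval, RealExpr.eval, vx, vn, vp, vbest, aRow, aPtr, aCen, hx,
          en2, ep2, ecen2, erow2, eptr2, hpi, not_le] at hb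
        obtain ⟨b1, b2⟩ := hb
        refine Runs.straight rfl ?_ (by simp [Program.size, NatExpr.cost])
        simp [hx, hi]
        refine ⟨b1, fun j hj hv => ?_⟩
        rcases lt_or_eq_of_le hj with hlt | rfl
        · by_cases hbp : s''.nat 6 < N.p
          · rcases b2 with b2 | b2
            · omega
            · rw [hM.ptr_eq _ hbp] at b2
              exact b2.le.trans ((I1 hbp).2 j hlt hv)
          · exact absurd hv (I2 hbp j hlt)
        · exact le_rfl
      · simp only [Test.Holds, NatExpr.eval, RealExpr.eval, vx, vn, vp, vbest, aRow, aPtr, aCen, hx,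
          en2, ep2, ecen2, erow2, eptr2, hpi, not_le] at hb
        refine Runs.straight rfl ?_ (by simp [Program.size])
        simp only [Program.run, State.nat_setNat, vbest, vx]
        norm_num
        refine ⟨fun hbp => ⟨(I1 hbp).1, fun j hj hv => ?_⟩, fun hbp j hj => ?_⟩
        · rcases lt_or_eq_of_le hj with hlt | rfl
          · exact (I1 hbp).2 j hlt hv
          · by_contra! hc
            rw [hM.ptr_eq _ hbp] at hb
            exact hb ⟨hv, Or.inr hc⟩
        · rcases lt_or_eq_of_le hj with hlt | rfl
          · exact not_lt.1 (I2 (not_lt.2 hbp) j hlt)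
          · by_contra! hc
            exact hb ⟨hc, Or.inl hbp⟩
    · simp only [NatExpr.cost]
      have : N.p * (35 + 1 + 8) ≤ k * 44 := Nat.mul_le_mul hpk (by omega)
      omega
    rintro s2 h2 ⟨I1, I2⟩
    have ek2 : s2.nat 2 = k := (h2.nat 2 rfl).trans (by simpa using ek)
    have ep2 : s2.nat 7 = N.p := (h2.nat 7 rfl).trans (by simpa using ep)
    have ecen2 : s2.natArr 4 = cen := (h2.natArr 4 rfl).trans (by simpa using ecen)
    have erow2 : s2.natArr 20 = row := (h2.natArr 20 rfl).trans (by simpa using erow)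
    have eptr2 : s2.natArr 21 = s'.natArr 21 := (h2.natArr 21 rfl).trans (by simp)
    have elen2 : s2.nat 19 = s'.nat 19 := (h2.nat 19 rfl).trans (by simp)
    have eflag2 : s2.nat 11 = s'.nat 11 := (h2.nat 11 rfl).trans (by simp)
    have ethr2 : s2.realArr 2 = s'.realArr 2 := (h2.realArr 2 rfl).trans (by simp)
    simp only [vbest, aPtr, rThr, vlen, vflag] at I1 I2 hM hb hrr ⊢
    refine Runs.straight rfl ?_
      (by simp [Program.size, NatExpr.cost, RealExpr.cost, Test.cost]; omega)
    by_cases hbp : s2.nat 6 < N.p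
    · obtain ⟨J1, J2⟩ := I1 hbp
      have hM' := hM.succ hr hbp J1 J2
      have hlen' := hM'.len_le hr
      simp [hbp, ep2, ek2, ecen2, erow2, eptr2, elen2, eflag2, ethr2, hM.ptr_eq _ hbp]
      rw [hM.ptr_eq _ hbp] at hM'
      refine ⟨r - 1, by omega, ⟨_, hM', by omega⟩, by omega⟩
    · have hlen' := hM.len_le hr
      simp [hbp, ep2, eptr2, elen2, ethr2]
      refine ⟨⟨r - 1, by omega⟩, ρ, hM, fun j hj => ?_⟩
      exact not_lt.1 (I2 hbp j hj)
  · rintro s' - ⟨⟨r, ⟨ρ, hM, h0⟩, -⟩, hb⟩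
    simp only [Test.Holds, NatExpr.eval] at hb
    have hdone := h0 (by omega)
    refine ⟨hM.len_le' hpk, hM.sorted, fun q hq j hj hv => ?_⟩
    refine hM.cover j hj q ?_
    by_contra! hle
    exact hdone j hj (hr.valid_anti hj hle hq hv).1
  · simp only [Test.cost, NatExpr.cost]
    have e1 : (N.n + 1) * (100 * k + (1 + 1 + 1) + 1) ≤ (2 * N.n) * (104 * k) :=
      Nat.mul_le_mul (by omega) (by omega)
    have e2 : (2 * N.n) * (104 * k) = 208 * (N.n * k) := by ring
    omega


/-! ### Candidates suffice -/

section Candidates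

variable {D : ℕ → ℕ → ℝ} {cen : ℕ → ℕ} {N : Network} {k : ℕ} {row : ℕ → ℕ} {M : ℕ → ℕ}

theorem Network.IsMatching.one_le_u (hM : N.IsMatching M) (hs : Sane N k) {i : ℕ} (hi : i < N.p)
    (hn : M i < N.n) : 1 ≤ N.u (N.grp (M i)) := by
  refine le_trans ?_ (hM.fits.1 _ (hs.grp_lt _ hn))
  exact Finset.card_pos.2 ⟨i, by simp [hi, hn]⟩

/-- Replacing a matched point by another one of the same group, or by one of an unused group if the
old group has no lower bound. -/
theorem Network.IsMatching.replace (hM : N.IsMatching M) (hs : Sane N k) {i y : ℕ} (hi : i < N.p)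
    (hn : M i < N.n) (hy : y < N.n) (hact : N.act y = i)
    (h : N.grp y = N.grp (M i) ∨ (N.l (N.grp (M i)) = 0 ∧ N.cnt M (N.grp y) = 0 ∧
      1 ≤ N.u (N.grp y))) : N.IsMatching (Function.update M i y) := by
  have hc : ∀ w, addOne (N.cnt (Function.update M i y)) (N.grp (M i)) w =
      addOne (N.cnt M) (N.grp y) w := by
    intro w
    have := cnt_update (N := N) M hi hy w
    simp only [hn, true_and] at this
    simp only [addOne, eq_comm (a := w)]
    exact this
  refine ⟨fun j hj hjn => ?_, ?_⟩
  · rcases eq_or_ne j i with rfl | hne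
    · simpa using hact
    · rw [Function.update_of_ne hne] at hjn ⊢
      exact hM.edge j hj hjn
  · rcases h with h | ⟨h1, h2, h3⟩
    · rw [h] at hc
      refine hM.fits.congr fun w _ => ?_
      have := hc w
      simpa [addOne] using this
    · refine ⟨fun w hw => ?_, ?_⟩
      · have h4 := hc w
        have h5 := hM.fits.1 w hw
        unfold addOne at h4
        by_cases hwy : w = N.grp y
        · subst hwy
          simp only [if_true] at h4
          split_ifs at h4 <;> omega
        · rw [if_neg hwy] at h4
          omega
      -- The old group has lower bound `0`, so leaving it lowers the excess by exactly one; the new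
      -- group raises it by at most one.
      · have h4 := exc_congr (N := N) fun w _ => hc w
        rw [exc_addOne _ (hs.grp_lt _ hn), exc_addOne _ (hs.grp_lt _ hy), if_pos (by omega)] at h4
        have h5 := hM.fits.2
        split_ifs at h4 <;> omega

/-- If the group of `M i` occurs in column `i`, its entry is no farther and keeps all counts.
Otherwise `M i` was eligible in each of the first `k` rows, whose entries are then present, no
farther and of `k` distinct groups. The other centers use fewer than `k` groups, so one of these is
fresh. Moving there is harmless because the old group has no lower bound, which is what the second
block of `k` rows is for. -/
theorem exists_candidate_step (hr : Rows D cen N k row) (hs : Sane N k)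
    (hl : ∑ g ∈ Finset.range N.m, N.l g ≤ k) (hM : N.IsMatching M) (hf : N.Full M) {i : ℕ}
    (hi : i < N.p) : ∃ q < 2 * k, row (q * k + i) < N.n ∧
      D (row (q * k + i)) (cen i) ≤ D (M i) (cen i) ∧
      N.IsMatching (Function.update M i (row (q * k + i))) := by
  classical
  have hn := hf i hi
  have hu := hM.one_le_u hs hi hn
  have hact := hM.edge i hi hn
  by_cases hA : ∃ q, q < 2 * k ∧ row (q * k + i) < N.n ∧ N.grp (row (q * k + i)) = N.grp (M i)
  · obtain ⟨h1, h2, h3⟩ := Nat.find_spec hA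
    have hmin : ∀ q' < Nat.find hA, _ := fun q' hq' => Nat.find_min hA hq'
    generalize Nat.find hA = q at h1 h2 h3 hmin
    have he := (hr.entry q h1 i hi).eligible h2
    refine ⟨q, h1, h2, (hr.entry q h1 i hi).closest h2 _ ⟨hn, hact, h3 ▸ he.2.2.1,
      fun q' hq' hv hg => hmin q' hq' ⟨by omega, hv, hg⟩⟩, ?_⟩
    exact hM.replace hs hi hn h2 he.2.1 (Or.inl h3)
  · push Not at hA
    have hel : ∀ q < 2 * k, (1 ≤ N.l (N.grp (M i)) ∨ q < k) → Eligible N k row q i (M i) :=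
      fun q hq hc => ⟨hn, hact, hc.imp_right fun h => ⟨h, hu⟩,
        fun q' hq' hv => hA q' (by omega) hv⟩
    have hval : ∀ q < 2 * k, (1 ≤ N.l (N.grp (M i)) ∨ q < k) → row (q * k + i) < N.n := by
      intro q hq hc
      by_contra hv
      exact (hr.entry q hq i hi).none hv _ (hel q hq hc)
    have hinj : ∀ q q', q < 2 * k → q' < 2 * k → row (q * k + i) < N.n → row (q' * k + i) < N.n →
        N.grp (row (q * k + i)) = N.grp (row (q' * k + i)) → q = q' := by
      intro q q' hq hq' hv hv' hg
      rcases lt_trichotomy q q' with hlt | heq | hgt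
      · exact absurd hg (((hr.entry q' hq' i hi).eligible hv').2.2.2 q hlt hv)
      · exact heq
      · exact absurd hg.symm (((hr.entry q hq i hi).eligible hv).2.2.2 q' hgt hv')
    -- Otherwise rows `k` to `2 * k - 1` hold `k` further groups with positive lower bound, and
    -- together with the group of `M i` they contradict `∑ l ≤ k`.
    have hl0 : N.l (N.grp (M i)) = 0 := by
      by_contra hne
      have h1 : 1 ≤ N.l (N.grp (M i)) := by omega
      have hcard : (insert (N.grp (M i)) ((Finset.Ico k (2 * k)).image fun q =>
          N.grp (row (q * k + i)))).card = k + 1 := by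
        rw [Finset.card_insert_of_notMem, Finset.card_image_of_injOn]
        · simp; omega
        · intro q hq q' hq' hg
          simp only [Finset.coe_Ico, Set.mem_Ico] at hq hq'
          exact hinj q q' hq.2 hq'.2 (hval q hq.2 (Or.inl h1)) (hval q' hq'.2 (Or.inl h1)) hg
        · simp only [Finset.mem_image, Finset.mem_Ico, not_exists, not_and]
          rintro q ⟨-, hq⟩
          exact hA q hq (hval q hq (Or.inl h1))
      have hsub : insert (N.grp (M i)) ((Finset.Ico k (2 * k)).image fun q =>
          N.grp (row (q * k + i))) ⊆ Finset.range N.m := by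
        intro g hg
        simp only [Finset.mem_insert, Finset.mem_image, Finset.mem_Ico] at hg
        rw [Finset.mem_range]
        rcases hg with rfl | ⟨q, ⟨-, hq⟩, rfl⟩
        · exact hs.grp_lt _ hn
        · exact hs.grp_lt _ (hval q hq (Or.inl h1))
      have h2 := Finset.card_nsmul_le_sum (insert (N.grp (M i)) ((Finset.Ico k (2 * k)).image
        fun q => N.grp (row (q * k + i)))) N.l 1 (by
          intro g hg
          simp only [Finset.mem_insert, Finset.mem_image, Finset.mem_Ico] at hg
          rcases hg with rfl | ⟨q, ⟨hq1, hq⟩, rfl⟩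
          · exact h1
          · rcases ((hr.entry q hq i hi).eligible (hval q hq (Or.inl h1))).2.2.1 with h | h
            · exact h
            · omega)
      have h3 := Finset.sum_le_sum_of_subset (f := N.l) hsub
      rw [hcard, smul_eq_mul, mul_one] at h2
      have h4 := h2.trans (h3.trans hl)
      omega
    -- There are `k` distinct groups in these rows against at most `p - 1 < k` other centers.
    obtain ⟨q, hq, hfresh⟩ : ∃ q < k, ∀ j < N.p, j ≠ i → N.grp (M j) ≠ N.grp (row (q * k + i)) := by
      by_contra! hc
      have hle : ((Finset.range k).image fun q => N.grp (row (q * k + i))).card ≤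
          (((Finset.range N.p).erase i).image fun j => N.grp (M j)).card := by
        refine Finset.card_le_card fun g hg => ?_
        simp only [Finset.mem_image, Finset.mem_range, Finset.mem_erase] at hg ⊢
        obtain ⟨q, hq, rfl⟩ := hg
        obtain ⟨j, hj, hji, he⟩ := hc q hq
        exact ⟨j, ⟨hji, hj⟩, he⟩
      rw [Finset.card_image_of_injOn] at hle
      · have h2 := Finset.card_image_le (s := (Finset.range N.p).erase i) (f := fun j => N.grp (M j))
        rw [Finset.card_erase_of_mem (Finset.mem_range.2 hi), Finset.card_range] at h2
        rw [Finset.card_range] at hle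
        have := hs.p_le
        have := hs.k_pos
        omega
      · intro q hq q' hq' hg
        simp only [Finset.coe_range, Set.mem_Iio] at hq hq'
        exact hinj q q' (by omega) (by omega) (hval q (by omega) (Or.inr hq))
          (hval q' (by omega) (Or.inr hq')) hg
    have hq2 : q < 2 * k := by omega
    have hv := hval q hq2 (Or.inr hq)
    have he := (hr.entry q hq2 i hi).eligible hv
    refine ⟨q, hq2, hv, (hr.entry q hq2 i hi).closest hv _ (hel q hq2 (Or.inr hq)), ?_⟩
    refine hM.replace hs hi hn hv he.2.1 (Or.inr ⟨hl0, ?_, ?_⟩)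
    · rw [Network.cnt, Finset.card_eq_zero, Finset.filter_eq_empty_iff]
      rintro j hj ⟨-, hg⟩
      rcases eq_or_ne j i with rfl | hne
      · exact hA q hq2 hv hg.symm
      · exact hfresh j (Finset.mem_range.1 hj) hne hg
    · rcases he.2.2.1 with h | h
      · exact h.trans (hs.l_le_u _ (hs.grp_lt _ hv))
      · exact h.2

/-- Every full matching can be changed into one that uses candidates only, without increasing any
distance. -/
theorem exists_candidate_matching (hr : Rows D cen N k row) (hs : Sane N k)
    (hl : ∑ g ∈ Finset.range N.m, N.l g ≤ k) (hM : N.IsMatching M) (hf : N.Full M) :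
    ∃ M', N.IsMatching M' ∧ N.Full M' ∧ ∀ j < N.p, D (M' j) (cen j) ≤ D (M j) (cen j) ∧
      ∃ q < 2 * k, row (q * k + j) < N.n ∧ M' j = row (q * k + j) := by
  suffices H : ∀ i ≤ N.p, ∃ M', N.IsMatching M' ∧ N.Full M' ∧
      (∀ j < N.p, D (M' j) (cen j) ≤ D (M j) (cen j)) ∧
      ∀ j < i, ∃ q < 2 * k, row (q * k + j) < N.n ∧ M' j = row (q * k + j) by
    obtain ⟨M', h1, h2, h3, h4⟩ := H N.p le_rfl
    exact ⟨M', h1, h2, fun j hj => ⟨h3 j hj, h4 j hj⟩⟩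
  intro i
  induction i with
  | zero => exact fun _ => ⟨M, hM, hf, fun _ _ => le_rfl, by omega⟩
  | succ i ih =>
    intro hi
    obtain ⟨M', h1, h2, h3, h4⟩ := ih (by omega)
    obtain ⟨q, hq, hv, hd, hm⟩ := exists_candidate_step hr hs hl h1 h2 (i := i) hi
    refine ⟨_, hm, fun j hj => ?_, fun j hj => ?_, fun j hj => ?_⟩
    · rcases eq_or_ne j i with rfl | hne
      · simpa using hv
      · rw [Function.update_of_ne hne]; exact h2 j hj
    · rcases eq_or_ne j i with rfl | hne
      · rw [Function.update_self]; exact hd.trans (h3 j hj)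
      · rw [Function.update_of_ne hne]; exact h3 j hj
    · rcases eq_or_ne j i with rfl | hne
      · exact ⟨q, hq, hv, by simp⟩
      · rw [Function.update_of_ne hne]
        exact h4 j (by omega)

/-! ### Thresholds -/

/-- The points within the threshold number `pos`; a position after the end of the list means that
there is no restriction. -/
noncomputable def thrAct (D : ℕ → ℕ → ℝ) (cen : ℕ → ℕ) (N : Network) (k : ℕ) (thr : ℕ → ℝ)
    (len pos x : ℕ) : ℕ :=
  open Classical in
  if N.act x < N.p ∧ (len ≤ pos ∨ D x (cen (N.act x)) ≤ thr pos) then N.act x else k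

noncomputable def thrNet (D : ℕ → ℕ → ℝ) (cen : ℕ → ℕ) (N : Network) (k : ℕ) (thr : ℕ → ℝ)
    (len pos : ℕ) : Network := { N with act := thrAct D cen N k thr len pos }

variable {thr : ℕ → ℝ} {len : ℕ}

theorem thrAct_lt_iff (hs : Sane N k) {pos x : ℕ} :
    thrAct D cen N k thr len pos x < N.p ↔
      N.act x < N.p ∧ (len ≤ pos ∨ D x (cen (N.act x)) ≤ thr pos) := by
  have := hs.p_le
  unfold thrAct
  split_ifs with h
  · simp [h]
  · constructor
    · intro h'; omega
    · exact fun h' => absurd h' h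

theorem thrAct_eq (hs : Sane N k) {pos x : ℕ} (h : thrAct D cen N k thr len pos x < N.p) :
    thrAct D cen N k thr len pos x = N.act x := if_pos ((thrAct_lt_iff hs).1 h)

theorem Sane.thrNet (hs : Sane N k) (pos : ℕ) : Sane (thrNet D cen N k thr len pos) k :=
  ⟨hs.p_le, hs.k_pos, hs.k_le, hs.m_le, hs.grp_lt, hs.l_le_u⟩

/-- Thresholds increase along the list, and positions from `len` on impose no restriction at all. -/
theorem thrNet_grows (hs : Sane N k) (hthr : ∀ i i', i ≤ i' → i' < len → thr i ≤ thr i')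
    {pos pos' : ℕ} (h : pos ≤ pos') :
    (thrNet D cen N k thr len pos).Grows (thrNet D cen N k thr len pos') := by
  refine ⟨rfl, rfl, rfl, rfl, rfl, rfl, le_rfl, fun x _ hx => ?_⟩
  change thrAct D cen N k thr len pos x < N.p at hx
  change thrAct D cen N k thr len pos' x = thrAct D cen N k thr len pos x
  rw [thrAct_eq hs hx]
  obtain ⟨h1, h2⟩ := (thrAct_lt_iff hs).1 hx
  refine thrAct_eq hs ((thrAct_lt_iff hs).2 ⟨h1, ?_⟩)
  rcases le_or_gt len pos' with hl | hl
  · exact Or.inl hl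
  · rcases h2 with h2 | h2
    · omega
    · exact Or.inr (h2.trans (hthr pos pos' h hl))

theorem Network.Grows.feasible {N' : Network} (h : N.Grows N') (hf : N.Feasible) : N'.Feasible := by
  obtain ⟨M, hM, hfull⟩ := hf
  refine ⟨M, h.isMatching hM, fun j hj => ?_⟩
  rw [h.n_eq]
  exact hfull j (hj.trans_le h.p_le)

theorem grows_thrNet_of_le (hs : Sane N k) {pos : ℕ} (h : len ≤ pos) :
    N.Grows (thrNet D cen N k thr len pos) := by
  refine ⟨rfl, rfl, rfl, rfl, rfl, rfl, le_rfl, fun x _ hx => ?_⟩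
  exact thrAct_eq hs ((thrAct_lt_iff hs).2 ⟨hx, Or.inl h⟩)

theorem thrNet_grows_base (hs : Sane N k) (pos : ℕ) : (thrNet D cen N k thr len pos).Grows N :=
  ⟨rfl, rfl, rfl, rfl, rfl, rfl, le_rfl, fun _ _ hx => (thrAct_eq hs hx).symm⟩

theorem thrNet_isMatching (hM : N.IsMatching M) {pos : ℕ} (hs : Sane N k)
    (h : ∀ j < N.p, M j < N.n → D (M j) (cen j) ≤ thr pos) :
    (thrNet D cen N k thr len pos).IsMatching M := by
  refine ⟨fun j hj hn => ?_, hM.fits⟩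
  have he := hM.edge j hj hn
  have hj' : N.act (M j) < N.p := he.symm ▸ hj
  change thrAct D cen N k thr len pos (M j) = j
  rw [thrAct_eq hs ((thrAct_lt_iff hs).2 ⟨hj', Or.inr (by rw [he]; exact h j hj hn)⟩), he]

/-- A matching that is full at the first feasible threshold has the least bottleneck. -/
theorem le_of_first_feasible (hr : Rows D cen N k row) (hs : Sane N k) (hp : 0 < N.p)
    (hl : ∑ g ∈ Finset.range N.m, N.l g ≤ k)
    (hthr : ∀ i i', i ≤ i' → i' < len → thr i ≤ thr i')
    (hcover : ∀ q < 2 * k, ∀ j < N.p, row (q * k + j) < N.n →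
      ∃ i < len, thr i = D (row (q * k + j)) (cen j)) {pos : ℕ}
    (hM : (thrNet D cen N k thr len pos).IsMatching M) (hf : N.Full M)
    (hpos : 0 < pos → ¬ (thrNet D cen N k thr len (pos - 1)).Feasible)
    {M' : ℕ → ℕ} (hM' : N.IsMatching M') (hf' : N.Full M') :
    ∃ j' < N.p, ∀ j < N.p, D (M j) (cen j) ≤ D (M' j') (cen j') := by
  -- It suffices to compete with a matching that uses candidates only, since its bottleneck occurs
  -- in the list of thresholds.
  obtain ⟨M₂, h1, h2, h3⟩ := exists_candidate_matching hr hs hl hM' hf'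
  obtain ⟨j', hj', hmax⟩ := (Finset.range N.p).exists_max_image (fun j => D (M₂ j) (cen j))
    ⟨0, Finset.mem_range.2 hp⟩
  rw [Finset.mem_range] at hj'
  obtain ⟨hle, q, hq, hv, he⟩ := h3 j' hj'
  obtain ⟨i, hi, hthri⟩ := hcover q hq j' hj' hv
  rw [← he] at hthri
  have hfi : (thrNet D cen N k thr len i).Feasible := by
    refine ⟨M₂, thrNet_isMatching h1 hs fun j hj _ => ?_, h2⟩
    rw [hthri]
    exact hmax j (Finset.mem_range.2 hj)
  -- Feasibility is inherited by later positions, so infeasibility at `pos - 1` excludes every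
  -- position before `pos`.
  have hpi : pos ≤ i := by
    by_contra! hlt
    exact hpos (by omega) ((thrNet_grows hs hthr (show i ≤ pos - 1 by omega)).feasible hfi)
  refine ⟨j', hj', fun j hj => le_trans ?_ hle⟩
  rw [← hthri]
  refine le_trans ?_ (hthr pos i hpi hi)
  have hedge := hM.edge j hj (hf j hj)
  change thrAct D cen N k thr len pos (M j) = j at hedge
  have hlt : thrAct D cen N k thr len pos (M j) < N.p := hedge.symm ▸ hj
  obtain ⟨-, h4⟩ := (thrAct_lt_iff hs).1 hlt
  rw [← thrAct_eq hs hlt, hedge] at h4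
  -- An unrestricted position is impossible here, because `pos ≤ i < len`.
  rcases h4 with h4 | h4
  · omega
  · exact h4

end Candidates


/-! ### Fair shifts are matchings -/

namespace Instance

variable (I : Instance)

@[simp] theorem oracle_val (x y : Fin I.n) : I.oracle x y = I.d x y := by
  simp [oracle]

/-- The problem of matching the first `p` centers to points of an instance. -/
noncomputable def network (p : ℕ) (act : ℕ → ℕ) : Network where
  n := I.n
  m := I.m
  p := p
  F := I.k - ∑ i, I.l i
  grp := I.input.natArr 0
  l := I.input.natArr 1
  u := I.input.natArr 2
  act := act

variable {I}

theorem input_group (x : Fin I.n) : I.input.natArr 0 x = I.group x := by simp [input]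

theorem input_l (i : Fin I.m) : I.input.natArr 1 i = I.l i := by simp [input]

theorem input_u (i : Fin I.m) : I.input.natArr 2 i = I.u i := by simp [input]

theorem network_sane (hm : I.m ≤ I.n) {p : ℕ} (hp : p ≤ I.k) (act : ℕ → ℕ) :
    Sane (I.network p act) I.k where
  p_le := hp
  k_pos := I.k_pos
  k_le := I.k_le_n
  m_le := hm
  grp_lt x hx := (input_group ⟨x, hx⟩).trans_lt (I.group ⟨x, hx⟩).isLt
  l_le_u g hg := by
    have := I.l_le_u ⟨g, hg⟩
    rwa [← input_l, ← input_u] at this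

theorem sum_input_l : ∑ g ∈ Finset.range I.m, I.input.natArr 1 g = ∑ i, I.l i := by
  rw [Finset.sum_range]
  exact Finset.sum_congr rfl fun i _ => input_l i

theorem count_image_eq_cnt {a : Fin I.k → Fin I.n} (ha : Function.Injective a) {h : Fin I.k}
    {g : Fin I.n → Fin I.n} (hg : Set.InjOn g (I.upTo a h)) {M : ℕ → ℕ}
    (hM : ∀ j : Fin I.k, j ≤ h → M j = g (a j)) (act : ℕ → ℕ) (i : Fin I.m) :
    I.count ((I.upTo a h).image g) i = (I.network (h + 1) act).cnt M i := by
  unfold count Network.cnt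
  rw [Finset.filter_image, Finset.card_image_of_injOn (hg.mono (Finset.coe_subset.2
    (Finset.filter_subset _ _))), upTo, Finset.filter_image, Finset.card_image_of_injective _ ha]
  refine Finset.card_nbij Fin.val ?_ Fin.val_injective.injOn ?_
  · intro j hj
    simp only [Finset.mem_coe, Finset.mem_filter, Finset.mem_Iic, Finset.mem_range] at hj ⊢
    refine ⟨Nat.lt_succ_of_le hj.1, ?_, ?_⟩
    · rw [hM j hj.1]; exact (g (a j)).isLt
    · rw [hM j hj.1]
      exact (input_group _).trans (congrArg Fin.val hj.2)
  · intro j hj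
    simp only [Finset.coe_filter, Set.mem_ofPred_eq, Finset.mem_range] at hj
    have hjk : j < I.k := hj.1.trans_le h.isLt
    have hjh : (⟨j, hjk⟩ : Fin I.k) ≤ h := Nat.lt_succ_iff.1 hj.1
    refine ⟨⟨j, hjk⟩, ?_, rfl⟩
    simp only [Finset.coe_filter, Set.mem_ofPred_eq, Finset.mem_Iic]
    refine ⟨hjh, Fin.ext ?_⟩
    have h2 := hj.2.2
    have h3 := hM ⟨j, hjk⟩ hjh
    dsimp only at h3
    rw [h3] at h2
    exact (input_group _).symm.trans h2

/-- From `(l - c) + c = l + (c - l)` with truncated differences, summed over the groups with `∑ c =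
|A|`. This turns the deficit condition into the capacity of the pool. -/
theorem lower_iff {a : Fin I.k → Fin I.n} {h : Fin I.k}
    {g : Fin I.n → Fin I.n} (hg : Set.InjOn g (I.upTo a h)) {T : ℕ → ℕ}
    (hT : ∀ i : Fin I.m, I.count ((I.upTo a h).image g) i = T i) {p : ℕ} (act : ℕ → ℕ) :
    ∑ i, (I.l i - I.count ((I.upTo a h).image g) i) + (I.upTo a h).card ≤ I.k ↔
      (I.network p act).exc T ≤ I.k - ∑ i, I.l i := by
  have h1 : (I.upTo a h).card = ∑ i, I.count ((I.upTo a h).image g) i := by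
    rw [← card_eq_sum_count, Finset.card_image_of_injOn hg]
  have h2 : (I.network p act).exc T = ∑ i, (I.count ((I.upTo a h).image g) i - I.l i) := by
    unfold Network.exc
    rw [show (I.network p act).m = I.m from rfl, Finset.sum_range]
    refine Finset.sum_congr rfl fun i _ => ?_
    rw [hT i, show (I.network p act).l i = I.l i from input_l i]
  have h3 : ∑ i, (I.l i - I.count ((I.upTo a h).image g) i) +
      ∑ i, I.count ((I.upTo a h).image g) i =
      ∑ i, I.l i + ∑ i, (I.count ((I.upTo a h).image g) i - I.l i) := by
    rw [← Finset.sum_add_distrib, ← Finset.sum_add_distrib]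
    exact Finset.sum_congr rfl fun i _ => by omega
  have := I.sum_l_le
  rw [h1, h2]
  omega

end Instance

/-- The machine cannot halve a real number, so it doubles the distance instead. -/
theorem ofReal_lt_half_iff {d G : ℝ} (hd : 0 ≤ d) :
    ENNReal.ofReal d < ENNReal.ofReal G / 2 ↔ ¬ G ≤ d + d := by
  rw [ENNReal.lt_div_iff_mul_lt (Or.inl two_ne_zero) (Or.inl ENNReal.ofNat_ne_top), mul_two,
    ← ENNReal.ofReal_add hd hd, ENNReal.ofReal_lt_ofReal_iff_of_nonneg (add_nonneg hd hd), not_le]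

/-- The center among `cen 0, …, cen h` whose open ball of radius `gap h / 2` contains `x`, or `k`. -/
noncomputable def levelAct (D : ℕ → ℕ → ℝ) (n k : ℕ) (cen tab : ℕ → ℕ) (gap : ℕ → ℝ)
    (h x : ℕ) : ℕ :=
  open Classical in
  if h = 0 ∨ ¬ gap h ≤ D x (cen (tab (h * n + x))) + D x (cen (tab (h * n + x))) then
    tab (h * n + x) else k

/-! ### Disjoint balls around the greedy centers -/

namespace GreedyUpTo

variable {I : Instance} {cen tab : ℕ → ℕ} {gap : ℕ → ℝ}
  (G : GreedyUpTo I.oracle I.n (I.k - 1) cen tab gap)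

include G

/-- The greedy sequence as points of the instance. -/
def seq (i : Fin I.k) : Fin I.n := ⟨cen i, G.cen_lt i (by omega)⟩

theorem tab_lt {i : ℕ} (hi : i < I.k) (x : Fin I.n) : tab (i * I.n + x) < I.k :=
  (G.tab_le i (by omega) x x.isLt).trans_lt hi

theorem oracle_cen (x : Fin I.n) {j : ℕ} (hj : j < I.k) : I.oracle x (cen j) =
    I.d x (G.seq ⟨j, hj⟩) := I.oracle_val x (G.seq ⟨j, hj⟩)

theorem distTo_before {i : ℕ} (hi : i + 1 < I.k) (x : Fin I.n) :
    I.distTo (I.before G.seq ⟨i + 1, hi⟩) x =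
      ENNReal.ofReal (I.oracle x (cen (tab (i * I.n + x)))) := by
  have ht := G.tab_lt (i := i) (by omega) x
  apply le_antisymm
  · rw [G.oracle_cen x ht]
    refine I.distTo_le (I.mem_before.2 ⟨_, ?_, rfl⟩) x
    exact Nat.lt_succ_of_le (G.tab_le i (by omega) x x.isLt)
  · refine le_iInf₂ fun c hc => ?_
    obtain ⟨j, hj, rfl⟩ := I.mem_before.1 hc
    refine ENNReal.ofReal_le_ofReal ?_
    rw [← G.oracle_cen x j.isLt]
    exact G.tab_min i (by omega) x x.isLt j (Nat.lt_succ_iff.1 hj)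

theorem gap_seq {i : ℕ} (hi : i + 1 < I.k) :
    I.gap G.seq ⟨i + 1, hi⟩ = ENNReal.ofReal (gap (i + 1)) := by
  rw [Instance.gap, G.distTo_before, G.gap_eq i (by omega)]
  rfl

theorem step1 : I.Step1 G.seq := by
  rintro ⟨i, hi⟩ x
  cases i with
  | zero => rw [I.gap_eq_top rfl]; exact le_top
  | succ i =>
    rw [G.gap_seq, G.distTo_before]
    exact ENNReal.ofReal_le_ofReal (G.far i (by omega) x x.isLt)

theorem lt_half_gap_iff (h : Fin I.k) (x y : Fin I.n) :
    I.ed x y < I.gap G.seq h / 2 ↔ (h : ℕ) = 0 ∨ ¬ gap h ≤ I.d x y + I.d x y := by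
  obtain ⟨h, hk⟩ := h
  cases h with
  | zero =>
    rw [I.gap_eq_top rfl, ENNReal.top_div_of_ne_top ENNReal.ofNat_ne_top]
    simp [I.ed_lt_top]
  | succ i =>
    rw [G.gap_seq, Instance.ed, ofReal_lt_half_iff (I.d_nonneg x y)]
    simp

/-- Two centers within half the gap of `x` would violate their separation. So at most one ball
contains `x`, and its center can only be the closest one, which the table records. -/
theorem levelAct_eq_iff {h j : Fin I.k} (hj : j ≤ h) (x : Fin I.n) :
    levelAct I.oracle I.n I.k cen tab gap h x = j ↔ I.ed x (G.seq j) < I.gap G.seq h / 2 := by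
  have htk := G.tab_lt h.isLt x
  have hth := G.tab_le h (by omega) x x.isLt
  have hc : ((h : ℕ) = 0 ∨ ¬ gap h ≤ I.oracle x (cen (tab (h * I.n + x))) +
      I.oracle x (cen (tab (h * I.n + x)))) ↔ I.ed x (G.seq ⟨_, htk⟩) < I.gap G.seq h / 2 := by
    rw [G.oracle_cen x htk, G.lt_half_gap_iff]
  simp only [levelAct, hc]
  constructor
  · intro he
    split_ifs at he with hc
    · have : (⟨_, htk⟩ : Fin I.k) = j := Fin.ext he
      rwa [this] at hc
    · have := j.isLt
      omega
  · intro hlt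
    have hle : I.ed x (G.seq ⟨_, htk⟩) ≤ I.ed x (G.seq j) := by
      refine ENNReal.ofReal_le_ofReal ?_
      rw [← G.oracle_cen x htk, ← G.oracle_cen x j.isLt]
      exact G.tab_min h (by omega) x x.isLt j hj
    rw [if_pos (hle.trans_lt hlt)]
    by_contra hne
    have h1 := G.step1.gap_le_ed (i := ⟨_, htk⟩) (j := j) (t := h) hth hj
      (fun he => hne (congrArg Fin.val he))
    have h2 := I.ed_triangle (G.seq ⟨_, htk⟩) x (G.seq j)
    rw [I.ed_comm _ x] at h2
    have h3 := ENNReal.add_lt_add (hle.trans_lt hlt) hlt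
    rw [ENNReal.add_halves] at h3
    exact absurd (h1.trans h2) h3.not_ge

end GreedyUpTo

namespace Instance

/-- The matching problem for the first `h + 1` centers and their open balls of radius
`gap h / 2`. -/
noncomputable def levelNet (I : Instance) (cen tab : ℕ → ℕ) (gap : ℕ → ℝ) (h : ℕ) : Network :=
  I.network (h + 1) (levelAct I.oracle I.n I.k cen tab gap h)

end Instance

namespace GreedyUpTo

variable {I : Instance} {cen tab : ℕ → ℕ} {gap : ℕ → ℝ}
  (G : GreedyUpTo I.oracle I.n (I.k - 1) cen tab gap)

include G

/-- A point is available to one center only, so injectivity comes for free from the edge condition.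
The other conditions correspond one to one. -/
theorem isFairShift_iff {h : Fin I.k} {g : Fin I.n → Fin I.n} {M : ℕ → ℕ}
    (hM : ∀ j : Fin I.k, j ≤ h → M j = g (G.seq j)) :
    I.IsFairShift (I.upTo G.seq h) (I.gap G.seq h / 2) g ↔
      (I.levelNet cen tab gap h).IsMatching M := by
  have ha := G.step1.injective
  have hfin : ∀ j < (I.levelNet cen tab gap h).p, ∃ j' : Fin I.k, j' ≤ h ∧ (j' : ℕ) = j :=
    fun j hj => ⟨⟨j, lt_of_lt_of_le hj h.isLt⟩, Nat.lt_succ_iff.1 hj, rfl⟩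
  constructor
  · intro hs
    have hcnt := Instance.count_image_eq_cnt ha hs.inj hM
    refine ⟨fun j hj _ => ?_, fun i hi => ?_, ?_⟩
    · obtain ⟨j, hjh, rfl⟩ := hfin j hj
      rw [hM j hjh]
      exact (G.levelAct_eq_iff hjh _).2 (hs.close _ (I.mem_upTo.2 ⟨j, hjh, rfl⟩))
    · have := hs.upper ⟨i, hi⟩
      rwa [hcnt, ← Instance.input_u] at this
    · exact (Instance.lower_iff hs.inj (hcnt _) _).1 hs.lower
  · intro hm
    have hedge : ∀ j : Fin I.k, j ≤ h →
        levelAct I.oracle I.n I.k cen tab gap h (g (G.seq j)) = j := by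
      intro j hj
      rw [← hM j hj]
      refine hm.edge j (Nat.lt_succ_of_le hj) ?_
      rw [hM j hj]
      exact (g _).isLt
    have hinj : Set.InjOn g (I.upTo G.seq h) := by
      intro x hx y hy hxy
      obtain ⟨j, hj, rfl⟩ := I.mem_upTo.1 (Finset.mem_coe.1 hx)
      obtain ⟨j', hj', rfl⟩ := I.mem_upTo.1 (Finset.mem_coe.1 hy)
      have h1 := hedge j hj
      rw [hxy, hedge j' hj'] at h1
      rw [Fin.ext h1]
    have hcnt := Instance.count_image_eq_cnt ha hinj hM
    refine ⟨hinj, fun x hx => ?_, fun i => ?_, ?_⟩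
    · obtain ⟨j, hj, rfl⟩ := I.mem_upTo.1 hx
      exact (G.levelAct_eq_iff hj _).1 (hedge j hj)
    · rw [hcnt, ← Instance.input_u]
      exact hm.fits.1 i i.isLt
    · exact (Instance.lower_iff hinj (hcnt _) _).2 hm.fits.2

theorem exists_shift_eq {h : Fin I.k} {M : ℕ → ℕ} (hf : (I.levelNet cen tab gap h).Full M) :
    ∃ g : Fin I.n → Fin I.n, ∀ j : Fin I.k, j ≤ h → M j = g (G.seq j) := by
  refine ⟨Function.extend G.seq (fun j => if hj : M j < I.n then ⟨M j, hj⟩ else G.seq j) id,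
    fun j hj => ?_⟩
  have hj' : M j < I.n := hf j (Nat.lt_succ_of_le hj)
  rw [G.step1.injective.extend_apply, dif_pos hj']

theorem exists_matching_eq (h : Fin I.k) (g : Fin I.n → Fin I.n) :
    ∃ M : ℕ → ℕ, (I.levelNet cen tab gap h).Full M ∧
      ∀ j : Fin I.k, j ≤ h → M j = g (G.seq j) := by
  refine ⟨fun j => if hj : j < I.k then g (G.seq ⟨j, hj⟩) else 0, fun j hj => ?_, fun j _ => ?_⟩
  · have hj' : j < I.k := lt_of_lt_of_le hj h.isLt
    simp only [hj', dif_pos]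
    exact Fin.isLt _
  · simp

theorem shiftable_iff (h : Fin I.k) :
    I.Shiftable G.seq h ↔ (I.levelNet cen tab gap h).Feasible := by
  constructor
  · rintro ⟨g, hg⟩
    obtain ⟨M, hf, hM⟩ := G.exists_matching_eq h g
    exact ⟨M, (G.isFairShift_iff hM).1 hg, hf⟩
  · rintro ⟨M, hm, hf⟩
    obtain ⟨g, hM⟩ := G.exists_shift_eq hf
    exact ⟨g, (G.isFairShift_iff hM).2 hm⟩

theorem levelNet_zero_feasible : (I.levelNet cen tab gap 0).Feasible :=
  (G.shiftable_iff ⟨0, I.k_pos⟩).1 (G.step1.shiftable_zero rfl)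

/-- For a shorter prefix the gap is larger, so the surviving centers have larger balls, and these
are again disjoint. A point in the ball of a surviving center therefore stays assigned to it. -/
theorem levelNet_grows {h h' : ℕ} (hle : h' ≤ h) (hk : h < I.k) :
    (I.levelNet cen tab gap h).Grows (I.levelNet cen tab gap h') := by
  refine ⟨rfl, rfl, rfl, rfl, rfl, rfl, Nat.succ_le_succ hle, fun x hx hact => ?_⟩
  set j := levelAct I.oracle I.n I.k cen tab gap h x with hj
  have hjh : j ≤ h' := Nat.lt_succ_iff.1 hact
  have h1 := (G.levelAct_eq_iff (h := ⟨h, hk⟩) (j := ⟨j, by omega⟩) (hjh.trans hle) ⟨x, hx⟩).1 hj.symm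
  have h2 : I.gap G.seq ⟨h, hk⟩ / 2 ≤ I.gap G.seq ⟨h', by omega⟩ / 2 :=
    ENNReal.div_le_div_right (G.step1.gap_anti hle) _
  exact (G.levelAct_eq_iff (h := ⟨h', by omega⟩) (j := ⟨j, by omega⟩) hjh ⟨x, hx⟩).2
    (h1.trans_le h2)

/-- A matching of least bottleneck at the first feasible level is what Step 3 asks for. -/
theorem exists_step3 {h : Fin I.k} {M : ℕ → ℕ}
    (hm : (I.levelNet cen tab gap h).IsMatching M) (hf : (I.levelNet cen tab gap h).Full M)
    (hmax : ∀ h' : Fin I.k, h < h' → ¬ (I.levelNet cen tab gap h').Feasible)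
    (hopt : ∀ M', (I.levelNet cen tab gap h).IsMatching M' → (I.levelNet cen tab gap h).Full M' →
      ∃ j' < (h : ℕ) + 1, ∀ j < (h : ℕ) + 1,
        I.oracle (M j) (cen j) ≤ I.oracle (M' j') (cen j')) :
    ∃ g, I.Step2 G.seq h ∧ I.Step3 G.seq h g ∧
      ∀ j : Fin I.k, j ≤ h → M j = g (G.seq j) := by
  obtain ⟨g, hM⟩ := G.exists_shift_eq hf
  refine ⟨g, ⟨(G.shiftable_iff h).2 ⟨M, hm, hf⟩, fun h' hs => ?_⟩,
    ⟨(G.isFairShift_iff hM).2 hm, fun g' hg' => ?_⟩, hM⟩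
  · by_contra! hlt
    exact hmax h' hlt ((G.shiftable_iff h').1 hs)
  · obtain ⟨M', hf', hM'⟩ := G.exists_matching_eq h g'
    obtain ⟨j', hj', hle⟩ := hopt M' ((G.isFairShift_iff hM').1 hg') hf'
    have hj'k : j' < I.k := lt_of_lt_of_le hj' h.isLt
    have hj'h : (⟨j', hj'k⟩ : Fin I.k) ≤ h := Nat.lt_succ_iff.1 hj'
    refine iSup₂_le fun x hx => ?_
    obtain ⟨j, hj, rfl⟩ := I.mem_upTo.1 hx
    refine le_iSup₂_of_le (G.seq ⟨j', hj'k⟩) (I.mem_upTo.2 ⟨_, hj'h, rfl⟩) ?_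
    refine ENNReal.ofReal_le_ofReal ?_
    have h1 := hle j (Nat.lt_succ_of_le hj)
    have h2 := hM' ⟨j', hj'k⟩ hj'h
    dsimp only at h2
    rwa [hM j hj, h2, G.oracle_cen _ j.isLt, G.oracle_cen _ hj'k] at h1

end GreedyUpTo


/-! ### Chains of matching problems -/

/-- Makes each point available to the center `e` if the test `t` succeeds and to none otherwise. -/
def assign (t : Test) (e : NatExpr) : Program :=
  forUp vx (.var vn) (.ite t (.putNat aAct (.var vx) e) (.putNat aAct (.var vx) (.var vk)))

open Classical in
theorem assign_runs {D : ℕ → ℕ → ℝ} {t : Test} {e : NatExpr} {s : State} {n k T : ℕ} {A : ℕ → ℕ}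
    (hn : s.nat vn = n) (hk : s.nat vk = k)
    (hA : ∀ x < n, ∀ s', Same (assign t e) s s' → s'.nat vx = x →
      (if t.Holds D s' then e.eval s' else k) = A x)
    (hT : n * (t.cost + e.cost + 14) + 9 ≤ T) :
    Runs D (assign t e) s (fun s' => (∀ x < n, s'.natArr aAct x = A x) ∧
      ∀ x, n ≤ x → s'.natArr aAct x = s.natArr aAct x) T := by
  refine Runs.forUp n (fun i s' => (∀ x < i, s'.natArr aAct x = A x) ∧
      ∀ x, n ≤ x → s'.natArr aAct x = s.natArr aAct x) rfl ?_ ?_ ?_ (c := t.cost + e.cost + 5) ?_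
  · intro s' h
    exact (h.nat 0 rfl).trans hn
  · simp
  · rintro i s' hi h hx ⟨h1, h2⟩
    have hAi := hA i hi s' h hx
    have hk' : s'.nat vk = k := (h.nat 2 rfl).trans hk
    have key : ∀ v, v = A i → (∀ x < i + 1, Function.update (s'.natArr aAct) i v x = A x) ∧
        ∀ x, n ≤ x → Function.update (s'.natArr aAct) i v x = s.natArr aAct x := by
      rintro v rfl
      refine ⟨fun x hxi => ?_, fun x hxn => ?_⟩
      · rcases Nat.lt_succ_iff_lt_or_eq.1 hxi with hlt | rfl
        · rw [Function.update_of_ne hlt.ne]; exact h1 x hlt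
        · simp
      · rw [Function.update_of_ne (by omega)]; exact h2 x hxn
    refine Runs.straight rfl ?_ (by simp [Program.size, NatExpr.cost]; omega)
    simp only [vx] at hx
    simp only [vk] at hk'
    simp only [Program.run, NatExpr.eval]
    split_ifs at hAi ⊢ with ht
    · simpa [hx] using key _ hAi
    · simpa [hx, hk'] using key _ hAi
  · simp only [NatExpr.cost]
    have : n * (t.cost + e.cost + 5 + 1 + 8) = n * (t.cost + e.cost + 14) := by ring
    omega

namespace Network

/-- With its converse below, this absorbs the contents of an availability array beyond the first `n`
cells, which no matching sees. -/
theorem grows_withAct {N : Network} {act : ℕ → ℕ} (h : ∀ x < N.n, act x = N.act x) :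
    N.Grows { N with act := act } :=
  ⟨rfl, rfl, rfl, rfl, rfl, rfl, le_rfl, fun x hx _ => h x hx⟩

theorem withAct_grows {N : Network} {act : ℕ → ℕ} (h : ∀ x < N.n, act x = N.act x) :
    Grows { N with act := act } N :=
  ⟨rfl, rfl, rfl, rfl, rfl, rfl, le_rfl, fun x hx _ => (h x hx).symm⟩

theorem Grows.trans {N N' N'' : Network} (h : N.Grows N') (h' : N'.Grows N'') : N.Grows N'' := by
  obtain ⟨n, m, p, F, grp, l, u, act⟩ := N
  obtain ⟨n', m', p', F', grp', l', u', act'⟩ := N'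
  obtain ⟨rfl, rfl, rfl, rfl, rfl, rfl, h1, h2⟩ := h
  obtain ⟨h3, h4, h5, h6, h7, h8, h9, h10⟩ := h'
  refine ⟨h3, h4, h5, h6, h7, h8, h9.trans h1, fun x hx hp => ?_⟩
  have hp' := h2 x hx (lt_of_lt_of_le hp h9)
  have hp2 := h10 x hx (lt_of_eq_of_lt hp' hp)
  exact hp2.trans hp'

end Network

/-- The rule for a chain of matching problems of which each one is set up by `assign`. -/
theorem chain_assign_runs {D : ℕ → ℕ → ℝ} {t : Test} {e : NatExpr} {adv : Program} {s : State}
    {n k τe T : ℕ} (St : ℕ → State → Prop) (Nt : ℕ → Network) (h0 : St 0 s)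
    (hst : ∀ τ s s', St τ s → Same (attempt ;; assign t e) s s' → St τ s')
    (hnet : ∀ τ s, St τ s → s.nat vk = k ∧ ({ net s with act := (Nt τ).act } : Network) = Nt τ)
    (hact : ∀ τ s, τ ≤ τe → St τ s → s.nat vx < n →
      (open Classical in if t.Holds D s then e.eval s else k) = (Nt τ).act (s.nat vx))
    (hfree : adv.loopFree = true) (hM : adv.wNatArr aM = false) (hA : adv.wNatArr aAct = false)
    (hflag : adv.wNat vflag = false) (hadv : ∀ τ s, St τ s → τ < τe → St (τ + 1) (adv.run D s))
    (hsize : adv.size ≤ 60) (hcost : t.cost + e.cost ≤ 30)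
    (hsane : ∀ τ ≤ τe, Sane (Nt τ) k ∧ (Nt τ).n = n)
    (hgrow : ∀ τ < τe, (Nt τ).Grows (Nt (τ + 1)))
    (hfeas : (Nt τe).Feasible)
    (hT : (τe + k + 2) * (2200 * n) ≤ T) :
    Runs D (chain (assign t e) adv) s (fun s' => ∃ τ ≤ τe, St τ s' ∧
      (∀ x < n, s'.natArr aAct x = (Nt τ).act x) ∧
      (Nt τ).IsMatching (s'.natArr aM) ∧ (Nt τ).Full (s'.natArr aM) ∧
      ∀ τ' < τ, ¬ (Nt τ').Feasible) T := by
  have hn1 : 1 ≤ n := by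
    obtain ⟨h1, h2⟩ := hsane 0 (Nat.zero_le _)
    exact h2 ▸ h1.k_pos.trans h1.k_le
  have hnk : ∀ τ s, τ ≤ τe → St τ s → s.nat vn = n := fun τ s hτ h => by
    have := congrArg Network.n (hnet τ s h).2
    exact this.trans (hsane τ hτ).2
  set a₀ := s.natArr aAct
  -- `chain_runs` asks for an exact network in memory. Cells from `n` on are never written, so they
  -- keep their initial contents `a₀`.
  set clip : ℕ → ℕ → ℕ := fun τ x => if x < n then (Nt τ).act x else a₀ x with hclip
  set Nt' : ℕ → Network := fun τ => { Nt τ with act := clip τ } with hNt'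
  have hagree : ∀ τ ≤ τe, ∀ x < (Nt τ).n, clip τ x = (Nt τ).act x := fun τ hτ x hx => by
    rw [(hsane τ hτ).2] at hx
    exact if_pos hx
  refine (chain_runs (n := n) (k := k) (τe := τe) (B := 60)
    (fun τ s => τ ≤ τe ∧ St τ s ∧ ∀ x, n ≤ x → s.natArr aAct x = a₀ x) Nt'
    ⟨Nat.zero_le _, h0, fun _ _ => rfl⟩ ?_ ?_ ?_ ?_ ?_ ?_ ?_ (T := T) ?_).mono ?_ le_rfl
  · rintro τ s s' ⟨hτ, h1, h2⟩ h
    have h' : Same (attempt ;; assign t e) s s' :=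
      h.mono (by simp +contextual [Program.wNat]) (by simp +contextual [Program.wNatArr])
        (by simp +contextual [Program.wRealArr])
    refine ⟨hτ, hst τ s s' h1 h', fun x hx => ?_⟩
    rw [h.natArr aAct rfl]
    exact h2 x hx
  · rintro τ s ⟨hτ, h1, -⟩
    exact ⟨hnk τ s hτ h1, (hnet τ s h1).1⟩
  · rintro τ s ⟨-, h1, h2⟩ hτ
    have hsame : ∀ s', Same (assign t e) s s' → St τ s' := fun s' h => hst τ s s' h1
      (h.mono (by simp +contextual [Program.wNat]) (by simp +contextual [Program.wNatArr])
        (by simp +contextual [Program.wRealArr]))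
    refine (assign_runs (hnk τ s hτ h1) (hnet τ s h1).1 (A := (Nt τ).act) ?_
      (T := 60 * n) ?_).mono ?_ le_rfl
    · intro x hx s' h hxs
      rw [← hxs]
      exact hact τ s' hτ (hsame s' h) (hxs ▸ hx)
    · have : n * (t.cost + e.cost + 14) ≤ n * 44 := Nat.mul_le_mul_left _ (by omega)
      omega
    · rintro s' h ⟨h3, h4⟩
      refine ⟨⟨hτ, hsame s' h, fun x hx => (h4 x hx).trans (h2 x hx)⟩, ?_, h.natArr aM rfl⟩
      have h5 := (hnet τ s' (hsame s' h)).2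
      have h6 : s'.natArr aAct = clip τ := by
        funext x
        by_cases hx : x < n
        · rw [h3 x hx, hclip]; simp [hx]
        · rw [h4 x (by omega), h2 x (by omega), hclip]; simp [hx]
      simp only [hNt']
      rw [← h5, ← h6]
      rfl
  · rintro τ s ⟨-, h1, h2⟩ hτ
    obtain ⟨c, hc, hex⟩ := adv.exec_run D hfree s
    have hs := hex.same
    refine Runs.straight hfree ⟨⟨hτ, hadv τ s h1 hτ, fun x hx => ?_⟩, hs.natArr aM hM,
      hs.nat vflag hflag⟩ (hsize.trans (Nat.le_mul_of_pos_right _ hn1))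
    rw [hs.natArr aAct hA]
    exact h2 x hx
  · intro τ hτ
    obtain ⟨h1, h2⟩ := hsane τ hτ
    exact ⟨⟨h1.p_le, h1.k_pos, h1.k_le, h1.m_le, h1.grp_lt, h1.l_le_u⟩, h2⟩
  · intro τ hτ
    exact (Network.withAct_grows (hagree τ hτ.le)).trans ((hgrow τ hτ).trans
      (Network.grows_withAct (hagree (τ + 1) hτ)))
  · exact (Network.grows_withAct (hagree τe le_rfl)).feasible hfeas
  · exact le_trans (Nat.mul_le_mul_left _ (Nat.mul_le_mul_right _ (by norm_num))) hT
  · rintro s' - ⟨τ, hτ, ⟨-, h1, -⟩, h2, h3, h4, h5⟩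
    refine ⟨τ, hτ, h1, fun x hx => ?_, (Network.withAct_grows (hagree τ hτ)).isMatching h3, h4,
      fun τ' hτ' hf => h5 τ' hτ' ((Network.grows_withAct (hagree τ' (by omega))).feasible hf)⟩
    have : s'.natArr aAct = clip τ := congrArg Network.act h2
    rw [this]
    exact if_pos hx

/-! ### A matching of least bottleneck -/

/-- One round of the search for the first feasible threshold. -/
def thresholdRound (d : NatExpr) : Program :=
  chain (assign
    (.and (.natLt (.get aBase (.var vx)) (.var vp)) (.or (.natLe (.var vlen) (.var vpos))
      (.realLe (.dist (.var vx) (.get aCen (.get aBase (.var vx)))) (.get rThr (.var vpos)))))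
    (.get aBase (.var vx)))
    (.setNat vpos (.plus (.var vpos) d))

/-- The memory holds the network `N`, its centers and the sorted thresholds. -/
structure Sorted (N : Network) (k : ℕ) (cen : ℕ → ℕ) (thr : ℕ → ℝ) (len : ℕ) (s : State) :
    Prop where
  net : baseNet s = N
  k_eq : s.nat vk = k
  cen_eq : s.natArr aCen = cen
  thr_eq : s.realArr rThr = thr
  len_eq : s.nat vlen = len

theorem thresholdRound_runs {D : ℕ → ℕ → ℝ} {s : State} {N : Network} {k len pos d τe T : ℕ}
    {e : NatExpr} {cen : ℕ → ℕ} {thr : ℕ → ℝ} (h : Sorted N k cen thr len s) (hpos : s.nat vpos = pos)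
    (he : ∀ s, s.nat vk = k → e.eval s = d) (hc : e.cost = 1) (hs : Sane N k)
    (hthr : ∀ i i', i ≤ i' → i' < len → thr i ≤ thr i')
    (hfeas : (thrNet D cen N k thr len (pos + τe * d)).Feasible)
    (hT : (τe + k + 2) * (2200 * N.n) ≤ T) :
    Runs D (thresholdRound e) s (fun s' => Sorted N k cen thr len s' ∧ ∃ τ ≤ τe,
      s'.nat vpos = pos + τ * d ∧
      (thrNet D cen N k thr len (pos + τ * d)).IsMatching (s'.natArr aM) ∧
      N.Full (s'.natArr aM) ∧
      ∀ τ' < τ, ¬ (thrNet D cen N k thr len (pos + τ' * d)).Feasible) T := by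
  refine (chain_assign_runs (n := N.n) (k := k) (τe := τe)
    (fun τ s => Sorted N k cen thr len s ∧ s.nat vpos = pos + τ * d)
    (fun τ => thrNet D cen N k thr len (pos + τ * d)) ⟨h, by simpa using hpos⟩
    ?_ ?_ ?_ rfl rfl rfl rfl ?_ ?_ ?_ ?_ ?_ hfeas hT).mono ?_ le_rfl
  · rintro τ s s' ⟨h1, h2⟩ h
    exact ⟨⟨(h.baseNet rfl rfl rfl rfl rfl rfl rfl rfl).trans h1.net,
      (h.nat 2 rfl).trans h1.k_eq, (h.natArr aCen rfl).trans h1.cen_eq,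
      (h.realArr rThr rfl).trans h1.thr_eq, (h.nat vlen rfl).trans h1.len_eq⟩,
      (h.nat vpos rfl).trans h2⟩
  · rintro τ s ⟨h1, -⟩
    refine ⟨h1.k_eq, ?_⟩
    conv_rhs => rw [← h1.net]
    rw [← h1.net]
    rfl
  · rintro τ s - ⟨h1, h2⟩ -
    have h3 : s.natArr aBase = N.act := congrArg Network.act h1.net
    have h4 : s.nat vp = N.p := congrArg Network.p h1.net
    have h5 := h1.cen_eq
    have h6 := h1.thr_eq
    have h7 := h1.len_eq
    simp only [aBase, vp, aCen, rThr, vlen, vpos] at h2 h3 h4 h5 h6 h7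
    simp only [thrNet, thrAct, Test.Holds, NatExpr.eval, RealExpr.eval, h2, h3, h4, h5, h6, h7,
      aBase, vp, aCen, rThr, vlen, vpos, not_le]
  · rintro τ s ⟨h1, h2⟩ -
    have h3 := he s h1.k_eq
    refine ⟨⟨Eq.trans ?_ h1.net, ?_, h1.cen_eq, h1.thr_eq, ?_⟩, ?_⟩
    · simp [Program.run, baseNet, net]
    · simpa [Program.run] using h1.k_eq
    · simpa [Program.run] using h1.len_eq
    · simp only [Program.run, NatExpr.eval, State.nat_setNat, h3, h2, if_true]
      ring
  · simp [Program.size, NatExpr.cost, hc]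
  · simp [Test.cost, NatExpr.cost, RealExpr.cost]
  · exact fun τ _ => ⟨hs.thrNet _, rfl⟩
  · intro τ _
    exact thrNet_grows hs hthr (Nat.add_le_add_left (Nat.mul_le_mul_right _ (Nat.le_succ τ)) _)
  · rintro s' - ⟨τ, hτ, ⟨h1, h2⟩, -, h3, h4, h5⟩
    exact ⟨h1, τ, hτ, h2, h3, h4, h5⟩

/-- Step 3 of the algorithm. -/
def bottleneck : Program :=
  forUp vx (.var vn) (.putNat aBase (.var vx) (.get aAct (.var vx))) ;;
  fillRows ;; mergeRows ;;
  .setNat vpos (.minus (.var vk) (.lit 1)) ;; thresholdRound (.var vk) ;;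
  .setNat vpos (.minus (.plus (.var vpos) (.lit 1)) (.var vk)) ;; thresholdRound (.lit 1)

theorem bottleneck_runs {D : ℕ → ℕ → ℝ} {s : State} {N : Network} {k T : ℕ} {cen : ℕ → ℕ}
    (hnet : ({ net s with act := N.act } : Network) = N)
    (hact : ∀ x < N.n, s.natArr aAct x = N.act x) (hk : s.nat vk = k) (hcen : s.natArr aCen = cen)
    (hs : Sane N k) (hp : 0 < N.p) (hl : ∑ g ∈ Finset.range N.m, N.l g ≤ k) (hf : N.Feasible)
    (hT : 30000 * (N.n * k) ≤ T) :
    Runs D bottleneck s (fun s' => N.IsMatching (s'.natArr aM) ∧ N.Full (s'.natArr aM) ∧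
      ∀ M', N.IsMatching M' → N.Full M' → ∃ j' < N.p, ∀ j < N.p,
        D (s'.natArr aM j) (cen j) ≤ D (M' j') (cen j')) T := by
  have hk1 := hs.k_pos
  have hkn := hs.k_le
  have hn : N.n ≤ N.n * k := Nat.le_mul_of_pos_right _ hk1
  have hkk : k * N.n = N.n * k := Nat.mul_comm _ _
  have hvn : s.nat vn = N.n := congrArg Network.n hnet
  refine Runs.seq (T₁ := 26 * N.n) (T₂ := 29970 * (N.n * k)) (Runs.forUp N.n
    (fun i s' => ∀ x < i, s'.natArr aBase x = N.act x) rfl ?_ ?_ ?_ (c := 4) ?_) ?_ (by omega)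
  · exact fun s' h => (h.nat 0 rfl).trans hvn
  · simp
  · intro i s' hi h hx hI
    refine Runs.straight rfl ?_ (by simp [Program.size, NatExpr.cost])
    have h1 : s'.natArr 7 i = N.act i := by rw [h.natArr 7 rfl]; exact hact i hi
    simp only [vx, aBase] at hx hI
    intro x hxi
    rcases Nat.lt_succ_iff_lt_or_eq.1 hxi with hlt | rfl
    · simpa [hx, Function.update_apply, hlt.ne] using hI x hlt
    · simpa [hx] using h1
  · simp only [NatExpr.cost]; omega
  intro s1 h1 hbase
  have hnet1 : ({ baseNet s1 with act := N.act } : Network) = N := by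
    refine Eq.trans ?_ hnet
    simp only [baseNet, h1.net rfl rfl rfl rfl rfl rfl rfl rfl]
  obtain ⟨N', hN'⟩ : ∃ N', N' = baseNet s1 := ⟨_, rfl⟩
  rw [← hN'] at hnet1
  have hact' : ∀ x < N.n, N'.act x = N.act x := fun x hx => by rw [hN']; exact hbase x hx
  have hN'eq : N' = { N with act := N'.act } := by rw [← hnet1]
  have hg1 : N.Grows N' := by rw [hN'eq]; exact Network.grows_withAct hact'
  have hg2 : N'.Grows N := by rw [hN'eq]; exact Network.withAct_grows hact'
  have en : N'.n = N.n := hg1.n_eq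
  have ep : N'.p = N.p := by rw [hN'eq]
  have hs' : Sane N' k := by
    rw [hN'eq]; exact ⟨hs.p_le, hs.k_pos, hs.k_le, hs.m_le, hs.grp_lt, hs.l_le_u⟩
  have hl' : ∑ g ∈ Finset.range N'.m, N'.l g ≤ k := by rw [hN'eq]; exact hl
  have hk1' : s1.nat vk = k := (h1.nat 2 rfl).trans hk
  have hcen1 : s1.natArr aCen = cen := (h1.natArr aCen rfl).trans hcen
  rw [← en] at hT hn hkk ⊢
  clear hbase h1 hact hvn hnet1 hN'eq
  refine Runs.seq (T₁ := 500 * (N'.n * k)) (T₂ := 29470 * (N'.n * k))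
    (fillRows_runs hN'.symm hk1' hcen1 hs' le_rfl) ?_ (by omega)
  rintro s2 h2 ⟨hent, hlast⟩
  have hrows : Rows D cen N' k (s2.natArr aRow) := ⟨hent, hlast⟩
  have hN2 : baseNet s2 = N' := (h2.baseNet rfl rfl rfl rfl rfl rfl rfl rfl).trans hN'.symm
  have hk2 : s2.nat vk = k := (h2.nat 2 rfl).trans hk1'
  have hcen2 : s2.natArr aCen = cen := (h2.natArr aCen rfl).trans hcen1
  refine Runs.seq (T₁ := 300 * (N'.n * k)) (T₂ := 29170 * (N'.n * k))
    (mergeRows_runs hN2 hk2 hcen2 rfl hs' hrows le_rfl) ?_ (by omega)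
  rintro s3 h3 ⟨hlen, hthr, hcover⟩
  have hS : Sorted N' k cen (s3.realArr rThr) (s3.nat vlen) s3 :=
    ⟨(h3.baseNet rfl rfl rfl rfl rfl rfl rfl rfl).trans hN2, (h3.nat 2 rfl).trans hk2,
      (h3.natArr aCen rfl).trans hcen2, rfl, rfl⟩
  generalize s3.realArr rThr = thr at *
  generalize s3.nat vlen = len at *
  have hN'f : N'.Feasible := hg1.feasible hf
  have hset : ∀ (s : State) (v : ℕ), Sorted N' k cen thr len s →
      Sorted N' k cen thr len (s.setNat vpos v) := by
    intro s v h
    refine ⟨Eq.trans ?_ h.net, ?_, h.cen_eq, h.thr_eq, ?_⟩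
    · simp [baseNet, net]
    · simpa using h.k_eq
    · simpa using h.len_eq
  refine Runs.straight_seq (T₂ := 29160 * (N'.n * k)) rfl ?_
    (by simp only [Program.size, NatExpr.cost]; omega)
  simp only [Program.run, NatExpr.eval]
  have hkv : s3.nat 2 = k := hS.k_eq
  -- After `2 * k` strides of length `k` the position is past the list, where the restriction
  -- disappears and feasibility is known.
  have hlast' : len ≤ (k - 1) + 2 * k * k := by omega
  refine Runs.seq (T₁ := 14000 * (N'.n * k)) (T₂ := 15160 * (N'.n * k))
    (thresholdRound_runs (hset s3 _ hS) (pos := k - 1) (by simp [hkv]) (e := .var vk) (d := k)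
      (fun _ h => h) rfl hs' hthr (τe := 2 * k)
      ((grows_thrNet_of_le hs' hlast').feasible hN'f) ?_) ?_ (by omega)
  · have : (2 * k + k + 2) * (2200 * N'.n) ≤ (5 * k) * (2200 * N'.n) :=
      Nat.mul_le_mul_right _ (by omega)
    have h2 : (5 * k) * (2200 * N'.n) = 11000 * (N'.n * k) := by ring
    omega
  rintro s4 - ⟨hS4, τ₁, hτ₁, hpos4, hm4, hf4, hinf4⟩
  refine Runs.straight_seq (T₂ := 15150 * (N'.n * k)) rfl ?_
    (by simp only [Program.size, NatExpr.cost]; omega)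
  simp only [Program.run, NatExpr.eval]
  have hkv4 : s4.nat 2 = k := hS4.k_eq
  simp only [vpos] at hpos4
  -- The second round covers the last block of `k` positions and ends where the first round stopped,
  -- at a feasible position.
  have hend : τ₁ * k + (k - 1) * 1 = k - 1 + τ₁ * k := by omega
  refine (thresholdRound_runs (hset s4 _ hS4) (pos := τ₁ * k) ?_ (e := .lit 1) (d := 1)
    (fun _ _ => rfl) rfl hs' hthr (τe := k - 1) ⟨s4.natArr aM, ?_, hf4⟩ (T := 15150 * (N'.n * k))
    ?_).mono ?_ le_rfl
  · simp only [vpos, vk, State.nat_setNat, if_true, hpos4, hkv4]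
    omega
  · rw [hend]; exact hm4
  · have : (k - 1 + k + 2) * (2200 * N'.n) ≤ (3 * k) * (2200 * N'.n) :=
      Nat.mul_le_mul_right _ (by omega)
    have h2 : (3 * k) * (2200 * N'.n) = 6600 * (N'.n * k) := by ring
    omega
  rintro s5 - ⟨-, τ₂, hτ₂, -, hm5, hf5, hinf5⟩
  rw [mul_one] at hm5
  have hM5 : N'.IsMatching (s5.natArr aM) := (thrNet_grows_base hs' _).isMatching hm5
  refine ⟨hg2.isMatching hM5, fun j hj => en ▸ hf5 j (ep ▸ hj), fun M' hM' hf' => ?_⟩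
  rw [← ep]
  refine le_of_first_feasible hrows hs' (ep ▸ hp) hl' hthr hcover hm5 hf5 (fun h0 => ?_)
    (hg1.isMatching hM') (fun j hj => en.symm ▸ hf' j (ep ▸ hj))
  -- If the second round stops at its first position, the infeasible predecessor is the last failed
  -- stride of the first round.
  rcases Nat.eq_zero_or_pos τ₂ with rfl | h2
  · have h1 : τ₁ ≠ 0 := by rintro rfl; simp at h0
    obtain ⟨τ, rfl⟩ := Nat.exists_eq_succ_of_ne_zero h1
    have := hinf4 τ (Nat.lt_succ_self τ)
    have he : (τ + 1) * k + 0 - 1 = k - 1 + τ * k := by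
      rw [Nat.add_mul]; omega
    rw [he]
    exact this
  · have := hinf5 (τ₂ - 1) (by omega)
    rwa [mul_one, ← Nat.add_sub_assoc h2] at this


/-! ### The longest prefix with a fair shift -/

/-- The part of the memory that holds the instance. -/
structure Loaded (I : Instance) (s : State) : Prop where
  n_eq : s.nat vn = I.n
  m_eq : s.nat vm = I.m
  k_eq : s.nat vk = I.k
  grp_eq : s.natArr aGrp = I.input.natArr 0
  l_eq : s.natArr aL = I.input.natArr 1
  u_eq : s.natArr aU = I.input.natArr 2

theorem loaded_input (I : Instance) : Loaded I I.input := ⟨rfl, rfl, rfl, rfl, rfl, rfl⟩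

theorem Loaded.same {I : Instance} {s s' : State} {P : Program} (hl : Loaded I s)
    (h : Same P s s') (h0 : P.wNat vn = false) (h1 : P.wNat vm = false) (h2 : P.wNat vk = false)
    (h3 : P.wNatArr aGrp = false) (h4 : P.wNatArr aL = false) (h5 : P.wNatArr aU = false) :
    Loaded I s' :=
  ⟨(h.nat _ h0).trans hl.n_eq, (h.nat _ h1).trans hl.m_eq, (h.nat _ h2).trans hl.k_eq,
    (h.natArr _ h3).trans hl.grp_eq, (h.natArr _ h4).trans hl.l_eq, (h.natArr _ h5).trans hl.u_eq⟩

/-- Step 2 of the algorithm. -/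
def longestPrefix : Program :=
  .setNat vF (.var vk) ;;
  forUp vx (.var vm) (.setNat vF (.minus (.var vF) (.get aL (.var vx)))) ;;
  .setNat vp (.plus (.minus (.var vk) (.lit 1)) (.lit 1)) ;;
  chain (assign
    (.or (.natLe (.var vp) (.lit 1)) (.not (.realLe (.get rGap (.minus (.var vp) (.lit 1)))
      (.plus (.dist (.var vx) (.get aCen (.get aTab (.plus (.var voff) (.var vx)))))
        (.dist (.var vx) (.get aCen (.get aTab (.plus (.var voff) (.var vx)))))))))
    (.get aTab (.plus (.var voff) (.var vx))))
    (.setNat vp (.minus (.var vp) (.lit 1)) ;; .setNat voff (.minus (.var voff) (.var vn)))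

/-- The memory holds what describes the level networks of the instance. -/
structure Prepared (I : Instance) (cen tab : ℕ → ℕ) (gap : ℕ → ℝ) (s : State) : Prop
    extends Loaded I s where
  F_eq : s.nat vF = I.k - ∑ i, I.l i
  cen_eq : s.natArr aCen = cen
  tab_eq : s.natArr aTab = tab
  gap_eq : s.realArr rGap = gap

theorem longestPrefix_runs {I : Instance} {s : State} {cen tab : ℕ → ℕ} {gap : ℕ → ℝ} {T : ℕ}
    (G : GreedyUpTo I.oracle I.n (I.k - 1) cen tab gap) (hm : I.m ≤ I.n) (hL : Loaded I s)
    (hcen : s.natArr aCen = cen) (htab : s.natArr aTab = tab) (hgap : s.realArr rGap = gap)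
    (hoff : s.nat voff = (I.k - 1) * I.n) (hT : 7000 * (I.n * I.k) ≤ T) :
    Runs I.oracle longestPrefix s (fun s' => ∃ h < I.k, Prepared I cen tab gap s' ∧
      s'.nat vp = h + 1 ∧
      (∀ x < I.n, s'.natArr aAct x = (I.levelNet cen tab gap h).act x) ∧
      (I.levelNet cen tab gap h).Feasible ∧
      ∀ h' < I.k, h < h' → ¬ (I.levelNet cen tab gap h').Feasible) T := by
  have hk1 := I.k_pos
  have hkn := I.k_le_n
  have hn : I.n ≤ I.n * I.k := Nat.le_mul_of_pos_right _ hk1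
  unfold longestPrefix
  refine Runs.straight_seq (T₂ := 6990 * (I.n * I.k)) rfl ?_
    (by simp only [Program.size, NatExpr.cost]; omega)
  simp only [Program.run, NatExpr.eval]
  have hL0 : Loaded I (s.setNat vF (s.nat vk)) := by
    obtain ⟨h1, h2, h3, h4, h5, h6⟩ := hL
    exact ⟨by simpa using h1, by simpa using h2, by simpa using h3, h4, h5, h6⟩
  refine Runs.seq (T₁ := 30 * I.n) (T₂ := 6950 * (I.n * I.k)) (Runs.forUp I.m
    (fun i s' => s'.nat vF = I.k - ∑ g ∈ Finset.range i, I.input.natArr 1 g) rfl ?_ ?_ ?_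
    (c := 5) ?_) ?_ (by omega)
  · exact fun s' h => (hL0.same h rfl rfl rfl rfl rfl rfl).m_eq
  · simpa using hL.k_eq
  · intro i s' hi h hx hI
    refine Runs.straight rfl ?_ (by simp [Program.size, NatExpr.cost])
    have h1 := (hL0.same h rfl rfl rfl rfl rfl rfl).l_eq
    simp only [vx, vF, aL] at hx hI h1
    rw [Finset.sum_range_succ]
    simp [Program.run, NatExpr.eval, hx, hI, h1, Nat.sub_sub]
  · simp only [NatExpr.cost]; omega
  intro s1 h1 hF1
  have hL1 : Loaded I s1 := hL0.same h1 rfl rfl rfl rfl rfl rfl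
  have hcen1 : s1.natArr aCen = cen := (h1.natArr aCen rfl).trans hcen
  have htab1 : s1.natArr aTab = tab := (h1.natArr aTab rfl).trans htab
  have hgap1 : s1.realArr rGap = gap := (h1.realArr rGap rfl).trans hgap
  have hoff1 : s1.nat voff = (I.k - 1) * I.n := (h1.nat voff rfl).trans (by simpa using hoff)
  rw [Instance.sum_input_l] at hF1
  clear hL0 h1
  refine Runs.straight_seq (T₂ := 6940 * (I.n * I.k)) rfl ?_
    (by simp only [Program.size, NatExpr.cost]; omega)
  simp only [Program.run, NatExpr.eval]
  -- The chain runs from the longest prefix downwards, with `h = k - 1 - τ`. The row offset drops by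
  -- `n` each time, so no multiplication is needed.
  refine (chain_assign_runs (n := I.n) (k := I.k) (τe := I.k - 1)
    (fun τ s => Prepared I cen tab gap s ∧ s.nat vp = I.k - 1 - τ + 1 ∧
      s.nat voff = (I.k - 1 - τ) * I.n)
    (fun τ => I.levelNet cen tab gap (I.k - 1 - τ)) ?_
    ?_ ?_ ?_ rfl rfl rfl rfl ?_ ?_ ?_ ?_ ?_ ?_ (T := 6940 * (I.n * I.k)) ?_).mono ?_ le_rfl
  · obtain ⟨h1, h2, h3, h4, h5, h6⟩ := hL1
    refine ⟨⟨⟨by simpa using h1, by simpa using h2, by simpa using h3, h4, h5, h6⟩,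
      by simpa using hF1, hcen1, htab1, hgap1⟩, ?_, by simpa using hoff1⟩
    simp only [vk] at h3
    simp [h3]
  · rintro τ s s' ⟨h1, h2, h3⟩ h
    exact ⟨⟨h1.toLoaded.same h rfl rfl rfl rfl rfl rfl, (h.nat vF rfl).trans h1.F_eq,
      (h.natArr aCen rfl).trans h1.cen_eq, (h.natArr aTab rfl).trans h1.tab_eq,
      (h.realArr rGap rfl).trans h1.gap_eq⟩, (h.nat vp rfl).trans h2, (h.nat voff rfl).trans h3⟩
  · rintro τ s ⟨h1, h2, h3⟩
    refine ⟨h1.k_eq, ?_⟩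
    simp only [net, h1.n_eq, h1.m_eq, h2, h1.F_eq, h1.grp_eq, h1.l_eq, h1.u_eq]
    rfl
  -- The test `vp ≤ 1` recognizes `h = 0`, whose infinite gap has no cell of its own.
  · rintro τ s - ⟨h1, h2, h3⟩ -
    have h4 := h1.cen_eq
    have h5 := h1.tab_eq
    have h6 := h1.gap_eq
    simp only [vp, voff, aCen, aTab, rGap] at h2 h3 h4 h5 h6
    simp only [Instance.levelNet, Instance.network, levelAct, Test.Holds, NatExpr.eval,
      RealExpr.eval, h2, h3, h4, h5, h6, vp, voff, aCen, aTab, rGap, Nat.add_sub_cancel,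
      add_le_iff_nonpos_left, Nat.le_zero]
  · rintro τ s ⟨h1, h2, h3⟩ hτ
    have h7 := h1.n_eq
    simp only [vp, voff, vn] at h2 h3 h7
    refine ⟨⟨⟨?_, ?_, ?_, h1.grp_eq, h1.l_eq, h1.u_eq⟩, ?_, h1.cen_eq, h1.tab_eq, h1.gap_eq⟩,
      ?_, ?_⟩
    · simpa [Program.run] using h1.n_eq
    · simpa [Program.run] using h1.m_eq
    · simpa [Program.run] using h1.k_eq
    · simpa [Program.run] using h1.F_eq
    · simp [Program.run, NatExpr.eval, h2]; omega
    · obtain ⟨q, hq⟩ : ∃ q, I.k - 1 - τ = q + 1 := ⟨I.k - 1 - τ - 1, by omega⟩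
      have hq' : I.k - 1 - (τ + 1) = q := by omega
      rw [hq] at h3
      simp [Program.run, NatExpr.eval, h3, h7, hq', Nat.add_mul]
  · simp [Program.size, NatExpr.cost]
  · simp [Test.cost, NatExpr.cost, RealExpr.cost]
  · exact fun τ _ => ⟨Instance.network_sane hm (by omega) _, rfl⟩
  · exact fun τ _ => G.levelNet_grows (by omega) (by omega)
  · rw [Nat.sub_self]; exact G.levelNet_zero_feasible
  · have : (I.k - 1 + I.k + 2) * (2200 * I.n) ≤ (3 * I.k) * (2200 * I.n) :=
      Nat.mul_le_mul_right _ (by omega)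
    have h2 : (3 * I.k) * (2200 * I.n) = 6600 * (I.n * I.k) := by ring
    omega
  · rintro s' - ⟨τ, hτ, ⟨h1, h2, h3⟩, h4, h5, h6, h7⟩
    refine ⟨I.k - 1 - τ, by omega, h1, h2, h4, ⟨_, h5, h6⟩, fun h' hk' hlt => ?_⟩
    have := h7 (I.k - 1 - h') (by omega)
    rwa [show I.k - 1 - (I.k - 1 - h') = h' by omega] at this


/-! ### Completing the centers -/

/-- Adds the point in `vw` to the output. -/
def take : Program :=
  .putNat aOut (.var vlen) (.var vw) ;; .putNat aChosen (.var vw) (.lit 1) ;;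
  .putNat aCnt (.get aGrp (.var vw)) (.plus (.get aCnt (.get aGrp (.var vw))) (.lit 1)) ;;
  .setNat vlen (.plus (.var vlen) (.lit 1))

/-- The memory holds the list of the members of `C`, their flags and their numbers by groups. -/
structure Selected (I : Instance) (C : Finset (Fin I.n)) (s : State) : Prop where
  len_eq : s.nat vlen = C.card
  out_iff : ∀ x : Fin I.n, x ∈ C ↔ ∃ i < C.card, s.natArr aOut i = x
  chosen_iff : ∀ x : Fin I.n, s.natArr aChosen x = 0 ↔ x ∉ C
  cnt_eq : ∀ i : Fin I.m, s.natArr aCnt i = I.count C i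

theorem Selected.setNat {I : Instance} {C : Finset (Fin I.n)} {s : State} (h : Selected I C s)
    {x : ℕ} (hx : x ≠ vlen) (v : ℕ) : Selected I C (s.setNat x v) := by
  refine ⟨?_, h.out_iff, h.chosen_iff, h.cnt_eq⟩
  rw [State.nat_setNat, if_neg hx.symm, h.len_eq]

theorem Selected.take {I : Instance} {C : Finset (Fin I.n)} {s : State} {D : ℕ → ℕ → ℝ}
    (h : Selected I C s) (hg : s.natArr aGrp = I.input.natArr 0) {x : Fin I.n}
    (hw : s.nat vw = x) (hx : x ∉ C) : Selected I (insert x C) (take.run D s) := by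
  have h1 := h.len_eq
  have hgx := Instance.input_group x
  simp only [vw, vlen, aGrp] at hw h1 hg
  refine ⟨?_, fun y => ?_, fun y => ?_, fun i => ?_⟩
  · rw [Finset.card_insert_of_notMem hx]
    simp [FairKCenter.take, Program.run, NatExpr.eval, h1]
  · rw [Finset.card_insert_of_notMem hx, Finset.mem_insert, h.out_iff]
    simp only [FairKCenter.take, Program.run, NatExpr.eval, h1, hw, vlen, vw, aOut, aChosen, aCnt,
      aGrp, State.natArr_setNat, State.natArr_putNat, State.nat_putNat]
    norm_num
    constructor
    · rintro (rfl | ⟨i, hi, he⟩)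
      · exact ⟨_, le_rfl, by simp⟩
      · exact ⟨i, hi.le, by rw [Function.update_of_ne hi.ne, he]⟩
    · rintro ⟨i, hi, he⟩
      rcases lt_or_eq_of_le hi with hlt | rfl
      · rw [Function.update_of_ne hlt.ne] at he
        exact Or.inr ⟨i, hlt, he⟩
      · rw [Function.update_self] at he
        exact Or.inl (Fin.ext he.symm)
  · have := h.chosen_iff y
    simp only [aChosen] at this
    simp only [FairKCenter.take, Program.run, NatExpr.eval, h1, hw, vlen, vw, aOut, aChosen, aCnt,
      aGrp, State.natArr_setNat, State.natArr_putNat, State.nat_putNat, Finset.mem_insert]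
    norm_num
    rw [Function.update_apply]
    by_cases hyx : y = x
    · simp [hyx]
    · simp [Fin.val_ne_of_ne hyx, hyx, this]
  · have := h.cnt_eq i
    simp only [aCnt] at this
    rw [I.count_insert hx]
    simp only [FairKCenter.take, Program.run, NatExpr.eval, h1, hw, hg, vlen, vw, aOut,
      aChosen, aCnt, aGrp, State.natArr_setNat, State.natArr_putNat, State.nat_putNat]
    norm_num
    simp only [hgx]
    rw [Function.update_apply]
    by_cases hi : I.group x = i
    · subst hi; simp [this]
    · simp [Fin.val_ne_of_ne (Ne.symm hi), hi, this]

/-- Step 4 of the algorithm: the centers of the matching, then points of the groups below their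
lower bounds, then points of the groups below their upper bounds. -/
def complete : Program :=
  forUp vx (.var vn) (.putNat aChosen (.var vx) (.lit 0)) ;;
  forUp vx (.var vm) (.putNat aCnt (.var vx) (.lit 0)) ;;
  .setNat vlen (.lit 0) ;;
  forUp vx (.var vp) (.setNat vw (.get aM (.var vx)) ;; take) ;;
  forUp vx (.var vn) (.when (.and (.natLe (.get aChosen (.var vx)) (.lit 0))
      (.natLt (.get aCnt (.get aGrp (.var vx))) (.get aL (.get aGrp (.var vx)))))
    (.setNat vw (.var vx) ;; take)) ;;
  forUp vx (.var vn) (.when (.and (.natLe (.get aChosen (.var vx)) (.lit 0))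
      (.and (.natLt (.var vlen) (.var vk))
        (.natLt (.get aCnt (.get aGrp (.var vx))) (.get aU (.get aGrp (.var vx))))))
    (.setNat vw (.var vx) ;; take))

/-- Such a point trades one unit of deficit for one of size, so the first pass cannot use up the
budget `k`. -/
theorem Instance.sum_sub_count_insert {I : Instance} {C : Finset (Fin I.n)} {x : Fin I.n}
    (hx : x ∉ C) (h : I.count C (I.group x) < I.l (I.group x)) :
    ∑ i, (I.l i - I.count (insert x C) i) + (insert x C).card =
      ∑ i, (I.l i - I.count C i) + C.card := by
  have h1 : ∑ i, (I.l i - I.count C i) = ∑ i, (I.l i - I.count (insert x C) i) +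
      ∑ i, if I.group x = i then 1 else 0 := by
    rw [← Finset.sum_add_distrib]
    refine Finset.sum_congr rfl fun i _ => ?_
    rw [I.count_insert hx]
    split_ifs with hi
    · subst hi; omega
    · omega
  rw [Finset.sum_ite_eq, if_pos (Finset.mem_univ _)] at h1
  rw [Finset.card_insert_of_notMem hx, h1]
  ring

/-- The rule for the passes of `complete` through all points. -/
theorem pass_runs {I : Instance} {s : State} {D : ℕ → ℕ → ℝ} {t : Test} {T : ℕ}
    (hL : Loaded I s) (P : Finset (Fin I.n) → Prop) (Q : Finset (Fin I.n) → Fin I.n → Prop)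
    (h0 : ∃ C, Selected I C s ∧ P C) (hQ : ∀ C y x, Q C x → Q (insert y C) x)
    (hmem : ∀ C x, Q (insert x C) x)
    (ht : ∀ s' C (x : Fin I.n), Loaded I s' → Selected I C s' → s'.nat vx = x →
      (t.Holds D s' → x ∉ C ∧ (P C → P (insert x C))) ∧ (¬ t.Holds D s' → Q C x))
    (hc : t.cost ≤ 20) (hT : 70 * I.n ≤ T) :
    Runs D (forUp vx (.var vn) (.when t (.setNat vw (.var vx) ;; take))) s
      (fun s' => ∃ C, Selected I C s' ∧ P C ∧ ∀ x, Q C x) T := by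
  have hn : 1 ≤ I.n := I.k_pos.trans I.k_le_n
  refine (Runs.forUp I.n (fun i s' => ∃ C, Selected I C s' ∧ P C ∧ ∀ x : Fin I.n, x < i → Q C x)
    rfl ?_ ?_ ?_ (c := 50) ?_).mono (T' := T) ?_ le_rfl
  · exact fun s' h => (hL.same h rfl rfl rfl rfl rfl rfl).n_eq
  · obtain ⟨C, h1, h2⟩ := h0
    exact ⟨C, h1.setNat (by decide) _, h2, fun x hx => absurd hx (Nat.not_lt_zero _)⟩
  · rintro i s' hi h hx ⟨C, h1, h2, h3⟩
    have hL' := hL.same h rfl rfl rfl rfl rfl rfl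
    obtain ⟨hyes, hno⟩ := ht s' C ⟨i, hi⟩ hL' h1 hx
    refine Runs.straight rfl ?_ ?_
    · rw [Program.run]
      split_ifs with hb
      · obtain ⟨h4, h5⟩ := hyes hb
        refine ⟨insert ⟨i, hi⟩ C, Selected.setNat ?_ (by decide) _, h5 h2, fun x hxi => ?_⟩
        · have h6 := (h1.setNat (x := vw) (by decide) i).take (D := D) (x := ⟨i, hi⟩) hL'.grp_eq
            (by simp) h4
          simp only [vx] at hx
          rwa [Program.run, Program.run, NatExpr.eval, hx]
        · rcases Nat.lt_succ_iff_lt_or_eq.1 hxi with hlt | he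
          · exact hQ _ _ _ (h3 x hlt)
          · rw [show x = ⟨i, hi⟩ from Fin.ext he]
            exact hmem _ _
      · refine ⟨C, h1.setNat (by decide) _, h2, fun x hxi => ?_⟩
        rcases Nat.lt_succ_iff_lt_or_eq.1 hxi with hlt | he
        · exact h3 x hlt
        · rw [show x = ⟨i, hi⟩ from Fin.ext he]
          exact hno hb
    · simp [Program.size, NatExpr.cost, take]
      omega
  · simp only [NatExpr.cost]; omega
  · rintro s' - ⟨C, h1, h2, h3⟩
    exact ⟨C, h1, h2, fun x => h3 x x.isLt⟩

theorem complete_runs {I : Instance} {s : State} {D : ℕ → ℕ → ℝ} {A : Finset (Fin I.n)}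
    {φ : ℕ → Fin I.n} {p T : ℕ} (hL : Loaded I s) (hm : I.m ≤ I.n) (hp : s.nat vp = p)
    (hpk : p ≤ I.k) (hM : ∀ j < p, s.natArr aM j = φ j) (hφ : Set.InjOn φ (Set.Iio p))
    (hA : (Finset.range p).image φ = A) (hu : ∀ i, I.count A i ≤ I.u i)
    (hl : ∑ i, (I.l i - I.count A i) + A.card ≤ I.k) (hT : 300 * I.n ≤ T) :
    Runs D complete s (fun s' => A ⊆ I.output s' ∧ I.Feasible (I.output s')) T := by
  have hn : 1 ≤ I.n := I.k_pos.trans I.k_le_n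
  have hkn := I.k_le_n
  refine Runs.seq (T₁ := 25 * I.n) (T₂ := 270 * I.n) (Runs.forUp I.n
    (fun i s' => ∀ x < i, s'.natArr aChosen x = 0) rfl ?_ ?_ ?_ (c := 3) ?_) ?_ (by omega)
  · exact fun s' h => (hL.same h rfl rfl rfl rfl rfl rfl).n_eq
  · simp
  · intro i s' hi h hx hI
    refine Runs.straight rfl ?_ (by simp [Program.size, NatExpr.cost])
    simp only [vx, aChosen] at hx hI
    intro x hxi
    rcases Nat.lt_succ_iff_lt_or_eq.1 hxi with hlt | rfl
    · simpa [hx, Function.update_apply, hlt.ne] using hI x hlt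
    · simp [hx]
  · simp only [NatExpr.cost]; omega
  intro s1 h1 hch1
  have hL1 : Loaded I s1 := hL.same h1 rfl rfl rfl rfl rfl rfl
  refine Runs.seq (T₁ := 25 * I.n) (T₂ := 240 * I.n) (Runs.forUp I.m
    (fun i s' => ∀ x < i, s'.natArr aCnt x = 0) rfl ?_ ?_ ?_ (c := 3) ?_) ?_ (by omega)
  · exact fun s' h => (hL1.same h rfl rfl rfl rfl rfl rfl).m_eq
  · simp
  · intro i s' hi h hx hI
    refine Runs.straight rfl ?_ (by simp [Program.size, NatExpr.cost])
    simp only [vx, aCnt] at hx hI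
    intro x hxi
    rcases Nat.lt_succ_iff_lt_or_eq.1 hxi with hlt | rfl
    · simpa [hx, Function.update_apply, hlt.ne] using hI x hlt
    · simp [hx]
  · simp only [NatExpr.cost]; omega
  intro s2 h2 hcnt2
  have hL2 : Loaded I s2 := hL1.same h2 rfl rfl rfl rfl rfl rfl
  have hch2 : ∀ x < I.n, s2.natArr aChosen x = 0 := by
    rw [h2.natArr aChosen rfl]; exact hch1
  have hp2 : s2.nat vp = p := (h2.nat vp rfl).trans ((h1.nat vp rfl).trans hp)
  have hM2 : ∀ j < p, s2.natArr aM j = φ j := by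
    rw [h2.natArr aM rfl, h1.natArr aM rfl]; exact hM
  clear h1 h2 hch1 hL1 hM hp hL
  refine Runs.straight_seq (T₂ := 235 * I.n) rfl ?_
    (by simp only [Program.size, NatExpr.cost]; omega)
  simp only [Program.run, NatExpr.eval]
  have hL3 : Loaded I (s2.setNat vlen 0) := by
    obtain ⟨h1, h2, h3, h4, h5, h6⟩ := hL2
    exact ⟨by simpa using h1, by simpa using h2, by simpa using h3, h4, h5, h6⟩
  have hS3 : Selected I ∅ (s2.setNat vlen 0) :=
    ⟨by simp, by simp, fun x => by simpa using hch2 x x.isLt,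
      fun i => by simpa [Instance.count] using hcnt2 i i.isLt⟩
  have hp3 : (s2.setNat vlen 0).nat vp = p := by simpa using hp2
  have hM3 : ∀ j < p, (s2.setNat vlen 0).natArr aM j = φ j := hM2
  generalize s2.setNat vlen 0 = s3 at hL3 hS3 hp3 hM3
  clear hL2 hch2 hcnt2 hp2 hM2
  refine Runs.seq (T₁ := 60 * I.n) (T₂ := 170 * I.n) (Runs.forUp p
    (fun i s' => Selected I ((Finset.range i).image φ) s') rfl ?_ ?_ ?_ (c := 40) ?_) ?_ (by omega)
  · exact fun s' h => (h.nat vp rfl).trans hp3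
  · simpa using hS3.setNat (by decide) _
  · intro i s' hi h hx hI
    have hL' := hL3.same h rfl rfl rfl rfl rfl rfl
    have hMi : s'.natArr aM i = φ i := by rw [h.natArr aM rfl]; exact hM3 i hi
    refine Runs.straight rfl ?_ (by simp [Program.size, NatExpr.cost, take])
    rw [Finset.range_add_one, Finset.image_insert]
    refine Selected.setNat ?_ (by decide) _
    have hnew : φ i ∉ (Finset.range i).image φ := by
      simp only [Finset.mem_image, Finset.mem_range, not_exists, not_and]
      intro j hj he
      have := hφ (Set.mem_Iio.2 (hj.trans hi)) (Set.mem_Iio.2 hi) he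
      omega
    have h6 := (hI.setNat (x := vw) (by decide) (φ i)).take (x := φ i) (D := D) hL'.grp_eq
      (by simp) hnew
    simp only [vx, aM] at hx hMi
    rwa [Program.run, Program.run, NatExpr.eval, NatExpr.eval, hx, hMi]
  · simp only [NatExpr.cost]; omega
  intro s4 h4 hS4
  rw [hA] at hS4
  have hL4 : Loaded I s4 := hL3.same h4 rfl rfl rfl rfl rfl rfl
  clear h4 hS3 hL3 hp3 hM3
  have hgrp : ∀ s', Loaded I s' → ∀ x : Fin I.n, s'.natArr 0 x = I.group x := fun s' h x => by
    rw [← Instance.input_group]; exact congrFun h.grp_eq _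
  -- Counts only grow, so the reason for rejecting a point stays valid and a single pass suffices.
  refine Runs.seq (T₁ := 70 * I.n) (T₂ := 70 * I.n) (pass_runs hL4
    (fun C => A ⊆ C ∧ (∀ i, I.count C i ≤ I.u i) ∧ ∑ i, (I.l i - I.count C i) + C.card ≤ I.k)
    (fun C x => x ∈ C ∨ I.l (I.group x) ≤ I.count C (I.group x)) ⟨A, hS4, subset_rfl, hu, hl⟩
    ?_ (fun C x => Or.inl (Finset.mem_insert_self _ _)) ?_
    (by simp [Test.cost, NatExpr.cost]) le_rfl) ?_ (by omega)
  · rintro C y x (h | h)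
    · exact Or.inl (Finset.mem_insert_of_mem h)
    · exact Or.inr (h.trans (I.count_mono (Finset.subset_insert _ _) _))
  · intro s' C x hL' hS' hx
    have e1 := hgrp s' hL' x
    have e2 := hS'.cnt_eq (I.group x)
    have e3 : s'.natArr 1 (I.group x) = I.l (I.group x) := by
      rw [← Instance.input_l]; exact congrFun hL'.l_eq _
    have e4 := hS'.chosen_iff x
    simp only [vx, aCnt, aChosen] at hx e2 e4
    refine ⟨fun hb => ?_, fun hb => ?_⟩
    · simp only [Test.Holds, NatExpr.eval, hx, e1, e2, e3, vx, aCnt, aChosen, aGrp, aL, not_le,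
        Nat.le_zero, e4] at hb
      refine ⟨hb.1, fun ⟨h1, h2, h3⟩ => ⟨h1.trans (Finset.subset_insert _ _), fun i => ?_, ?_⟩⟩
      · rw [I.count_insert hb.1]
        have := I.l_le_u i
        have := h2 i
        split_ifs with hi
        · subst hi; omega
        · omega
      · rwa [Instance.sum_sub_count_insert hb.1 hb.2]
    · simp only [Test.Holds, NatExpr.eval, hx, e1, e2, e3, vx, aCnt, aChosen, aGrp, aL, not_le,
        Nat.le_zero, e4, not_and, not_lt] at hb
      exact or_iff_not_imp_left.2 hb
  rintro s5 h5 ⟨C, hS5, ⟨hAC, hu5, hl5⟩, hlow⟩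
  have hL5 : Loaded I s5 := hL4.same h5 rfl rfl rfl rfl rfl rfl
  -- A deficient group has a point outside `C`, since its lower bound is at most its size, and the
  -- pass would have taken that point.
  have hlow' : ∀ i, I.l i ≤ I.count C i := by
    intro i
    by_contra! hlt
    obtain ⟨x, hx, rfl⟩ := I.exists_notMem_of_count_lt (hlt.trans_le (I.l_le_u i))
    exact absurd ((hlow x).resolve_left hx) (not_le.2 hlt)
  refine (pass_runs hL5
    (fun C => A ⊆ C ∧ (∀ i, I.l i ≤ I.count C i ∧ I.count C i ≤ I.u i) ∧ C.card ≤ I.k)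
    (fun C x => x ∈ C ∨ I.k ≤ C.card ∨ I.u (I.group x) ≤ I.count C (I.group x))
    ⟨C, hS5, hAC, fun i => ⟨hlow' i, hu5 i⟩, by omega⟩
    ?_ (fun C x => Or.inl (Finset.mem_insert_self _ _)) ?_
    (by simp [Test.cost, NatExpr.cost]) le_rfl).mono ?_ le_rfl
  · rintro C y x (h | h | h)
    · exact Or.inl (Finset.mem_insert_of_mem h)
    · exact Or.inr (Or.inl (h.trans (Finset.card_le_card (Finset.subset_insert _ _))))
    · exact Or.inr (Or.inr (h.trans (I.count_mono (Finset.subset_insert _ _) _)))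
  · intro s' C x hL' hS' hx
    have e1 := hgrp s' hL' x
    have e2 := hS'.cnt_eq (I.group x)
    have e3 : s'.natArr 2 (I.group x) = I.u (I.group x) := by
      rw [← Instance.input_u]; exact congrFun hL'.u_eq _
    have e4 := hS'.chosen_iff x
    have e5 := hS'.len_eq
    have e6 := hL'.k_eq
    simp only [vx, aCnt, aChosen, vlen, vk] at hx e2 e4 e5 e6
    refine ⟨fun hb => ?_, fun hb => ?_⟩
    · simp only [Test.Holds, NatExpr.eval, hx, e1, e2, e3, e5, e6, vx, vlen, vk, aCnt, aChosen,
        aGrp, aU, not_le, Nat.le_zero, e4] at hb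
      refine ⟨hb.1, fun ⟨h1, h2, h3⟩ => ⟨h1.trans (Finset.subset_insert _ _), fun i => ?_, ?_⟩⟩
      · rw [I.count_insert hb.1]
        have := h2 i
        split_ifs with hi
        · subst hi; omega
        · omega
      · rw [Finset.card_insert_of_notMem hb.1]
        omega
    · simp only [Test.Holds, NatExpr.eval, hx, e1, e2, e3, e5, e6, vx, vlen, vk, aCnt, aChosen,
        aGrp, aU, not_le, Nat.le_zero, e4, not_and, not_lt] at hb
      by_cases h1 : x ∈ C
      · exact Or.inl h1
      · by_cases h2 : I.k ≤ C.card
        · exact Or.inr (Or.inl h2)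
        · exact Or.inr (Or.inr (hb h1 (not_le.1 h2)))
  rintro s6 - ⟨C', hS6, ⟨hAC', hb6, hk6⟩, hQ⟩
  -- With fewer than `k ≤ ∑ u` points, some group is below its upper bound and has an unused point
  -- that the second pass would have taken.
  have hcard : C'.card = I.k := by
    by_contra hne
    have hlt : ∑ i, I.count C' i < ∑ i, I.u i := by
      rw [← Instance.card_eq_sum_count]
      have := I.le_sum_u
      omega
    obtain ⟨i, -, hi⟩ := Finset.exists_lt_of_sum_lt hlt
    obtain ⟨x, hx, rfl⟩ := I.exists_notMem_of_count_lt hi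
    rcases hQ x with h | h | h
    · exact hx h
    · omega
    · omega
  have hout : I.output s6 = C' := by
    ext x
    rw [hS6.out_iff, hcard]
    simp [Instance.output]
  rw [hout]
  exact ⟨hAC', hcard, hb6⟩


/-- The algorithm. -/
def fairCenters : Program := greedy ;; longestPrefix ;; bottleneck ;; complete

theorem fairCenters_runs (I : Instance) (hm : I.m ≤ I.n) :
    Runs I.oracle fairCenters I.input (fun s => I.IsOutput (I.output s)) (40000 * (I.n * I.k)) := by
  have hn : I.n ≤ I.n * I.k := Nat.le_mul_of_pos_right _ I.k_pos
  have hL := loaded_input I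
  refine Runs.seq (T₁ := 200 * (I.n * I.k)) (T₂ := 39800 * (I.n * I.k))
    (greedy_runs hL.n_eq hL.k_eq I.k_pos I.k_le_n le_rfl) ?_ (by omega)
  rintro s1 h1 ⟨G, hoff⟩
  have hL1 := hL.same h1 rfl rfl rfl rfl rfl rfl
  refine Runs.seq (T₁ := 7000 * (I.n * I.k)) (T₂ := 32800 * (I.n * I.k))
    (longestPrefix_runs G hm hL1 rfl rfl rfl hoff le_rfl) ?_ (by omega)
  generalize s1.natArr aCen = cen at *
  generalize s1.natArr aTab = tab at *
  generalize s1.realArr rGap = gap at *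
  rintro s2 - ⟨h, hk, hP, hp, hact, hf, hmax⟩
  set N := I.levelNet cen tab gap h with hN
  have hl : ∑ g ∈ Finset.range N.m, N.l g ≤ I.k := by
    have : ∑ g ∈ Finset.range N.m, N.l g = ∑ i, I.l i := Instance.sum_input_l
    rw [this]
    exact I.sum_l_le
  refine Runs.seq (T₁ := 30000 * (I.n * I.k)) (T₂ := 2800 * (I.n * I.k))
    (bottleneck_runs (N := N) ?_ hact hP.k_eq hP.cen_eq (Instance.network_sane hm hk _)
      (Nat.succ_pos h) hl hf le_rfl) ?_ (by omega)
  · simp only [net, hP.n_eq, hP.m_eq, hp, hP.F_eq, hP.grp_eq, hP.l_eq, hP.u_eq]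
    rfl
  rintro s3 h3 ⟨hM, hfull, hopt⟩
  have hL3 := hP.toLoaded.same h3 rfl rfl rfl rfl rfl rfl
  obtain ⟨g, hs2, hs3, hg⟩ := G.exists_step3 (h := ⟨h, hk⟩) hM hfull
    (fun h' hlt => hmax h' h'.isLt hlt) hopt
  -- The default value of `φ` is never used: only indices `j ≤ h < k` are read.
  refine (complete_runs (A := (I.upTo G.seq ⟨h, hk⟩).image g) (p := h + 1)
    (φ := fun j => if hj : j < I.k then g (G.seq ⟨j, hj⟩) else G.seq ⟨h, hk⟩) hL3 hm
    ((h3.nat vp rfl).trans hp) hk ?_ ?_ ?_ hs3.1.upper ?_ le_rfl).mono ?_ (by omega)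
  · intro j hj
    have hjk : j < I.k := by omega
    rw [dif_pos hjk]
    exact hg ⟨j, hjk⟩ (Nat.lt_succ_iff.1 hj)
  · intro j hj j' hj' he
    rw [Set.mem_Iio] at hj hj'
    have hjk : j < I.k := by omega
    have hjk' : j' < I.k := by omega
    simp only [hjk, hjk', dif_pos] at he
    have h4 := hs3.1.inj (Finset.mem_coe.2 (I.mem_upTo.2 ⟨⟨j, hjk⟩, Nat.lt_succ_iff.1 hj, rfl⟩))
      (Finset.mem_coe.2 (I.mem_upTo.2 ⟨⟨j', hjk'⟩, Nat.lt_succ_iff.1 hj', rfl⟩)) he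
    exact congrArg Fin.val (G.step1.injective h4)
  · ext x
    simp only [Finset.mem_image, Finset.mem_range, I.mem_upTo]
    constructor
    · rintro ⟨j, hj, rfl⟩
      have hjk : j < I.k := by omega
      rw [dif_pos hjk]
      exact ⟨_, ⟨⟨j, hjk⟩, Nat.lt_succ_iff.1 hj, rfl⟩, rfl⟩
    · rintro ⟨_, ⟨j, hj, rfl⟩, rfl⟩
      exact ⟨j, Nat.lt_succ_of_le hj, by simp⟩
  · rw [Finset.card_image_of_injOn hs3.1.inj]
    exact hs3.1.lower
  · rintro s4 - h4
    exact ⟨G.seq, ⟨h, hk⟩, g, G.step1, hs2, hs3, h4⟩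

end FairKCenter

/-- First part: no step of the algorithm can get stuck, whatever choices were made before, and every
output is feasible and costs at most three times the optimum. Second part: one fixed program carries
out the algorithm on every instance with `m ≤ n` within `K * (n * k)` steps. -/
theorem mainTheorem1 :
    (∀ I : FairKCenter.Instance,
      (∃ a, I.Step1 a) ∧
      ∀ a, I.Step1 a → (∃ h, I.Step2 a h) ∧
        ∀ h, I.Step2 a h → (∃ g, I.Step3 a h g) ∧
          ∀ g, I.Step3 a h g → (∃ C, I.Step4 a h g C) ∧
            ∀ C, I.Step4 a h g C → I.Feasible C ∧ I.cost C ≤ 3 * I.opt) ∧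
    (∃ (P : FairKCenter.Program) (K : ℕ),
      ∀ I : FairKCenter.Instance, I.m ≤ I.n →
        ∃ (s : FairKCenter.State) (t : ℕ),
          FairKCenter.Exec I.oracle P I.input s t ∧
          t ≤ K * (I.n * I.k) ∧
          I.IsOutput (I.output s) ∧
          I.Feasible (I.output s) ∧
          I.cost (I.output s) ≤ 3 * I.opt) := by
  refine ⟨fun I => ⟨I.exists_step1, fun a h1 => ⟨h1.exists_step2, fun h h2 =>
    ⟨h2.exists_step3, fun g h3 => ⟨h3.exists_step4, fun C h4 =>
      ⟨h4.2, FairKCenter.Instance.cost_le_of_steps h1 h2 h3 h4⟩⟩⟩⟩⟩,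
    FairKCenter.fairCenters, 40000, fun I hm => ?_⟩
  obtain ⟨s, t, h, ht, hout⟩ := FairKCenter.fairCenters_runs I hm
  exact ⟨s, t, h, ht, hout, hout.feasible, hout.cost_le⟩
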